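/- Let $M$ be a compact Riemannian manifold (without boundary) of dimension $n$, and let $x\colon M\to\mathbb R^N$ be a smooth isometric embedding with mean curvature function $H=\frac1n\left|\sum_{i=1}^n \mathrm{II}(e_i,e_i)\right|$, where $\mathrm{II}$ is the second fundamental form and $(e_i)$ a local orthonormal frame of $TM$. Let $S$ be a Dirac bundle over $M$, that is, a smooth real or complex vector bundle with a Euclidean, respectively Hermitian, fibre metric $\langle\cdot,\cdot\rangle$, a metric connection $\nabla$ and a Clifford multiplication $TM\otimes S\to S$, $v\cdot v\cdot\sigma=-|v|^2\sigma$, such that $\langle v\cdot\sigma,\tau\rangle+\langle\sigma,v\cdot\tau\rangle=0$ and $\nabla_v(Y\cdot\sigma)=(\nabla_vY)\cdot\sigma+Y\cdot\nabla_v\sigma$ for vector fields $Y$ and sections $\sigma$, where $\nabla_v Y$ is the Levi-Civita derivative (in the complex case the Clifford multiplication and $\nabla$ are complex linear on $S$). Let $D=\sum_i e_i\cdot\nabla_{e_i}$ be its Dirac operator and $\mathfrak R=\sum_{i<j}e_i\cdot e_j\cdot R_{e_i,e_j}$, with $R_{X,Y}=[\nabla_X,\nabla_Y]-\nabla_{[X,Y]}$,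 its curvature morphism. Let $\{\lambda_j;\varphi_j\}_{j\ge1}$ be a spectral resolution of $D^2$: the $\varphi_j$ are smooth sections that form an orthonormal basis of $L^2(S)$ (over the scalar field of $S$), $D^2\varphi_j=\lambda_j\varphi_j$, and $\lambda_1\le\lambda_2\le\cdots$. Suppose that $R\in\mathbb R$ satisfies $\operatorname{Re}\int_M\langle\mathfrak R\varphi_i,\varphi_i\rangle\ge R$ for all $i$, and put $\eta_i=\lambda_i+\frac14n^2\sup_MH^2-R$. Then $$\sum_{i=1}^n(\eta_{i+1}-\eta_1)\le4\eta_1 .$$ -/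

import Mathlib

open Bundle Manifold MeasureTheory Filter
open scoped ContDiff ENNReal

noncomputable section

namespace DiracEigenvalues

/-! ### Riemannian geometry -/

section Riemannian

variable {n : ℕ} (M : Type*) [TopologicalSpace M] [ChartedSpace (EuclideanSpace ℝ (Fin n)) M]
  [RiemannianBundle (fun x : M ↦ TangentSpace (𝓡 n) x)]

variable {M} in
/-- The Gram matrix `g(∂ᵢ, ∂ⱼ)` of the coordinate vector fields of the chart at `p`, at the point
of `M` with coordinates `y`. -/
def gramMatrix (p : M) (y : EuclideanSpace ℝ (Fin n)) : Matrix (Fin n) (Fin n) ℝ :=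
  let coordField (i : Fin n) : TangentSpace (𝓡 n) ((extChartAt (𝓡 n) p).symm y) :=
    mfderiv 𝓘(ℝ, EuclideanSpace ℝ (Fin n)) (𝓡 n) (extChartAt (𝓡 n) p).symm y
      (EuclideanSpace.single i (1 : ℝ))
  Matrix.of fun i j ↦ inner ℝ (coordField i) (coordField j)

variable {M} in
/-- The Riemannian volume of the domain of the chart at `p`: the image under the inverse chart of
`√det(gᵢⱼ) dy`. -/
def chartVolume [MeasurableSpace M] (p : M) : Measure M :=
  ((volume.restrict (extChartAt (𝓡 n) p).target).withDensity
    fun y ↦ ENNReal.ofReal (Real.sqrt (gramMatrix p y).det)).map (extChartAt (𝓡 n) p).symm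

/-- The Riemannian volume measure: the least measure dominating the volumes of all chart domains.
As those agree on overlaps, its restriction to a chart domain is `√det(gᵢⱼ) dy`. -/
def riemannianVolume [MeasurableSpace M] : Measure M := ⨆ p : M, chartVolume (n := n) p

instance (p : M) : FiniteDimensional ℝ (TangentSpace (𝓡 n) p) :=
  inferInstanceAs (FiniteDimensional ℝ (EuclideanSpace ℝ (Fin n)))

variable {M} in
/-- An orthonormal basis of the tangent space at `p`. The quantities below that are defined with
its help do not depend on the choice. -/
def frame (p : M) :
    OrthonormalBasis (Fin (Module.finrank ℝ (TangentSpace (𝓡 n) p))) ℝ (TangentSpace (𝓡 n) p) :=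
  stdOrthonormalBasis ℝ (TangentSpace (𝓡 n) p)

variable {M} {N : ℕ}

/-- Smooth isometric embeddings into Euclidean space. -/
structure IsIsometricEmbedding (x : M → EuclideanSpace ℝ (Fin N)) : Prop where
  smooth : ContMDiff (𝓡 n) 𝓘(ℝ, EuclideanSpace ℝ (Fin N)) ∞ x
  isEmbedding : Topology.IsEmbedding x
  inner_mvfderiv : ∀ (p : M) (u v : TangentSpace (𝓡 n) p),
    inner ℝ (mvfderiv (𝓡 n) x p u) (mvfderiv (𝓡 n) x p v) = inner ℝ u v

variable [IsManifold (𝓡 n) ∞ M]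

/-- The second fundamental form `II(u, v) = (D_u (dx V))^⊥`, where `V` is a vector field near `p`
with `V p = v`: the component normal to `dx(T_p M)`. -/
def secondFundamentalForm (x : M → EuclideanSpace ℝ (Fin N)) (p : M)
    (u v : TangentSpace (𝓡 n) p) : EuclideanSpace ℝ (Fin N) :=
  (LinearMap.range (mvfderiv (𝓡 n) x p).toLinearMap)ᗮ.starProjection
    (mvfderiv (𝓡 n)
      (fun q ↦ mvfderiv (𝓡 n) x q (FiberBundle.extend (EuclideanSpace ℝ (Fin n)) v q)) p u)

/-- The mean curvature vector field `∑ᵢ II(eᵢ, eᵢ)`. -/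
def meanCurvatureVector (x : M → EuclideanSpace ℝ (Fin N)) (p : M) : EuclideanSpace ℝ (Fin N) :=
  ∑ i, secondFundamentalForm (n := n) x p (frame p i) (frame p i)

/-- The mean curvature function `H = |∑ᵢ II(eᵢ, eᵢ)| / n`. -/
def meanCurvature (x : M → EuclideanSpace ℝ (Fin N)) (p : M) : ℝ :=
  ‖meanCurvatureVector (n := n) x p‖ / n

end Riemannian

/-! ### Dirac bundles -/

section Dirac

variable {n : ℕ} (𝕜 : Type*) [RCLike 𝕜]
  (M : Type*) [TopologicalSpace M] [ChartedSpace (EuclideanSpace ℝ (Fin n)) M]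
  [IsManifold (𝓡 n) ∞ M]
  [RiemannianBundle (fun x : M ↦ TangentSpace (𝓡 n) x)]
  [IsContMDiffRiemannianBundle (𝓡 n) ∞ (EuclideanSpace ℝ (Fin n))
    (fun x : M ↦ TangentSpace (𝓡 n) x)]
  (F : Type*) [NormedAddCommGroup F] [NormedSpace ℝ F] [FiniteDimensional ℝ F]
  (S : M → Type*) [TopologicalSpace (TotalSpace F S)] [∀ x, NormedAddCommGroup (S x)]
  [∀ x, InnerProductSpace ℝ (S x)] [FiberBundle F S] [VectorBundle ℝ F S]
  [ContMDiffVectorBundle ∞ F S (𝓡 n)] [IsContMDiffRiemannianBundle (𝓡 n) ∞ F S]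
  [∀ x, InnerProductSpace 𝕜 (S x)]

set_option synthInstance.maxHeartbeats 400000 in
/-- The structure of a Dirac bundle over the Riemannian manifold `M`, real (`𝕜 = ℝ`) or complex
(`𝕜 = ℂ`), on the smooth vector bundle `S` with fiber metric `inner 𝕜`. The real inner product on
the fibers induces the same norm, hence is the real part of `inner 𝕜`; in the real case the two
coincide. -/
structure DiracBundle where
  /-- The Levi-Civita connection of `M`. -/
  leviCivita : CovariantDerivative (𝓡 n) (EuclideanSpace ℝ (Fin n))
    (TangentSpace (𝓡 n) : M → Type _)
  leviCivita_smooth : CovariantDerivative.ContMDiffCovariantDerivative leviCivita ∞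
  leviCivita_torsion : leviCivita.torsion = 0
  leviCivita_metric : leviCivita.IsMetricCompatible
  /-- Scalar multiplication (by the imaginary unit, say) preserves smoothness of sections. -/
  smul_smooth : ∀ (a : 𝕜) (σ : ∀ x, S x) (p : M),
    ContMDiffAt (𝓡 n) ((𝓡 n).prod 𝓘(ℝ, F)) ∞ (fun x ↦ TotalSpace.mk' F x (σ x)) p →
    ContMDiffAt (𝓡 n) ((𝓡 n).prod 𝓘(ℝ, F)) ∞ (fun x ↦ TotalSpace.mk' F x (a • σ x)) p
  /-- Clifford multiplication by tangent vectors. By the universal property of Clifford algebras,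
  the relation `clifford_sq` makes each fiber of `S` a left module over the Clifford algebra of
  the tangent space. -/
  clifford : ∀ p : M, TangentSpace (𝓡 n) p →ₗ[ℝ] S p →ₗ[ℝ] S p
  clifford_smul : ∀ (p : M) (v : TangentSpace (𝓡 n) p) (a : 𝕜) (s : S p),
    clifford p v (a • s) = a • clifford p v s
  clifford_sq : ∀ (p : M) (v : TangentSpace (𝓡 n) p) (s : S p),
    clifford p v (clifford p v s) = -(‖v‖ ^ 2 • s)
  clifford_skew : ∀ (p : M) (v : TangentSpace (𝓡 n) p) (s t : S p),
    inner 𝕜 (clifford p v s) t + inner 𝕜 s (clifford p v t) = 0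
  clifford_smooth : ∀ (Y : ∀ x : M, TangentSpace (𝓡 n) x) (σ : ∀ x, S x) (p : M),
    ContMDiffAt (𝓡 n) ((𝓡 n).prod 𝓘(ℝ, EuclideanSpace ℝ (Fin n))) ∞
      (fun x ↦ TotalSpace.mk' (EuclideanSpace ℝ (Fin n)) x (Y x)) p →
    ContMDiffAt (𝓡 n) ((𝓡 n).prod 𝓘(ℝ, F)) ∞ (fun x ↦ TotalSpace.mk' F x (σ x)) p →
    ContMDiffAt (𝓡 n) ((𝓡 n).prod 𝓘(ℝ, F)) ∞
      (fun x ↦ TotalSpace.mk' F x (clifford x (Y x) (σ x))) p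
  /-- The connection of `S`; `conn σ p v` is `∇_v σ` at `p`. -/
  conn : CovariantDerivative (𝓡 n) F S
  conn_smooth : CovariantDerivative.ContMDiffCovariantDerivative conn ∞
  conn_metric : conn.IsMetricCompatible
  conn_smul : ∀ (a : 𝕜) (σ : ∀ x, S x) (p : M) (v : TangentSpace (𝓡 n) p),
    ContMDiffAt (𝓡 n) ((𝓡 n).prod 𝓘(ℝ, F)) ∞ (fun x ↦ TotalSpace.mk' F x (σ x)) p →
    conn (fun x ↦ a • σ x) p v = a • conn σ p v
  /-- `∇_v (Y · σ) = (∇_v Y) · σ + Y · ∇_v σ`. -/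
  conn_clifford : ∀ (Y : ∀ x : M, TangentSpace (𝓡 n) x) (σ : ∀ x, S x) (p : M)
      (v : TangentSpace (𝓡 n) p),
    ContMDiffAt (𝓡 n) ((𝓡 n).prod 𝓘(ℝ, EuclideanSpace ℝ (Fin n))) ∞
      (fun x ↦ TotalSpace.mk' (EuclideanSpace ℝ (Fin n)) x (Y x)) p →
    ContMDiffAt (𝓡 n) ((𝓡 n).prod 𝓘(ℝ, F)) ∞ (fun x ↦ TotalSpace.mk' F x (σ x)) p →
    conn (fun x ↦ clifford x (Y x) (σ x)) p v =
      clifford p (leviCivita Y p v) (σ p) + clifford p (Y p) (conn σ p v)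

namespace DiracBundle

variable {𝕜 M F S} (B : DiracBundle (n := n) 𝕜 M F S)

/-- The Dirac operator `D σ = ∑ᵢ eᵢ · ∇_{eᵢ} σ`. -/
def dirac (σ : ∀ x, S x) (p : M) : S p :=
  ∑ i, B.clifford p (frame p i) (B.conn σ p (frame p i))

/-- The curvature `R_{u,v} σ = ∇_U ∇_V σ - ∇_V ∇_U σ - ∇_{[U,V]} σ` at `p`, where `U` and `V` are
vector fields near `p` with `U p = u` and `V p = v`. -/
def curvature (σ : ∀ x, S x) (p : M) (u v : TangentSpace (𝓡 n) p) : S p :=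
  let U : ∀ x : M, TangentSpace (𝓡 n) x := FiberBundle.extend (EuclideanSpace ℝ (Fin n)) u
  let V : ∀ x : M, TangentSpace (𝓡 n) x := FiberBundle.extend (EuclideanSpace ℝ (Fin n)) v
  B.conn (fun x ↦ B.conn σ x (V x)) p u - B.conn (fun x ↦ B.conn σ x (U x)) p v
    - B.conn σ p (VectorField.mlieBracket (𝓡 n) U V p)

/-- The curvature morphism `ℜ σ = ∑_{i<j} eᵢ · eⱼ · R_{eᵢ,eⱼ} σ`. -/
def curvatureMorphism (σ : ∀ x, S x) (p : M) : S p :=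
  ∑ i, ∑ j ∈ Finset.Ioi i,
    B.clifford p (frame p i) (B.clifford p (frame p j) (B.curvature σ p (frame p i) (frame p j)))

variable [mM : MeasurableSpace M]

/-- A spectral resolution of `D²`: a nondecreasing sequence `ev` of reals and an orthonormal basis
`φ` of `L²(S)` (that is, an orthonormal sequence whose finite linear combinations are dense in the
space of measurable square integrable sections) of smooth sections with `D² φⱼ = evⱼ φⱼ`. -/
structure IsSpectralResolution (ev : ℕ → ℝ) (φ : ℕ → ∀ x, S x) : Prop where
  monotone : Monotone ev
  smooth : ∀ j, ContMDiff (𝓡 n) ((𝓡 n).prod 𝓘(ℝ, F)) ∞ (fun x ↦ TotalSpace.mk' F x (φ j x))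
  eigen : ∀ j p, B.dirac (B.dirac (φ j)) p = ev j • φ j p
  orthonormal : ∀ i j,
    ∫ p, inner 𝕜 (φ i p) (φ j p) ∂(riemannianVolume (n := n) M) = if i = j then 1 else 0
  dense : ∀ σ : ∀ x, S x,
    Measurable[mM, borel (TotalSpace F S)] (fun x ↦ TotalSpace.mk' F x (σ x)) →
    ∫⁻ p, ‖σ p‖ₑ ^ 2 ∂(riemannianVolume (n := n) M) < ⊤ →
    ∀ ε : ℝ≥0∞, 0 < ε → ∃ (s : Finset ℕ) (a : ℕ → 𝕜),
      ∫⁻ p, ‖σ p - ∑ j ∈ s, a j • φ j p‖ₑ ^ 2 ∂(riemannianVolume (n := n) M) < ε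

end DiracBundle

end Dirac

end DiracEigenvalues

end

noncomputable section

set_option linter.unusedSectionVars false

namespace DiracEigenvalues

/-! ### Abstract spectral inequalities -/

section Abstract

/-! Let σ = φ₀ be the ground state, with unit norm and eigenvalue `ev 0` = λ₁. The trial sections
are f_i σ, where the f_i are linear coordinates of the embedding. Origin and axes of ℝ^N are at
one's disposal. With the origin at the centre of mass of |σ|² every f_i σ is orthogonal to σ; with
the axes along eigenvectors of the second moment operator the f_i σ are mutually orthogonal
(`exists_orthonormalBasis_integral_eq_zero`).

By the commutator formula `dirac_dirac_smul`, (D² - λ₁)(f_i σ) = -2∇_{∇f_i}σ - (Δf_i)σ with Δ = div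
grad. The divergence theorem turns its pairing with f_i σ into a_i = ∫|∇f_i|²|σ|²
(`integral_inner_commutator`). Since ∇f_i is the tangential part of the i-th vector of an
orthonormal basis, 0 ≤ a_i ≤ 1 and Σ a_i = n.

Cauchy–Schwarz gives a_i r_i ≤ ‖(D² - λ₁)f_i σ‖², where r_i = a_i/‖f_i σ‖² is the Rayleigh quotient
of f_i σ minus λ₁. Weights in [0,1] of total mass n make Σ a_i r_i at least the sum of the n
smallest r_i, and by Ky Fan n orthogonal trial sections orthogonal to σ have Σ r_i ≥ Σ_{i=1}^n
(λ_{i+1} - λ₁). Hence this sum is at most Σ_i ‖(D² - λ₁)f_i σ‖² (`sum_sub_le_sum_norm_sq`).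

The right side equals 4∫|∇σ|² + n²∫H²|σ|²: the cross term contains Σ Δf_i ∇f_i, the tangential part
of the mean curvature vector, which is zero, and Σ(Δf_i)² = n²H². The integrated Weitzenböck formula
bounds ∫|∇σ|² by λ₁ - R, and the result is 4η₁.

In the geometric part, local orthonormal frames are replaced by the gradients Z_α of the linear
coordinates. These are globally smooth; Σ⟨Z_α,u⟩Z_α = u, so they compute traces; and Σ ∇_u Z_α ⊗ Z_α
= 0 (`sum_inner_conn_gradField_mul`), so under differentiation they behave like a frame that is
parallel at the point. -/

/-- A weighted sum with weights in `[0, 1]` of total mass `n` dominates the sum of the terms over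
some subset of cardinality `n`. -/
lemma exists_subset_card_eq_sum_le {ι : Type*} [DecidableEq ι] (I : Finset ι) (a r : ι → ℝ) (n : ℕ)
    (ha0 : ∀ i ∈ I, 0 ≤ a i) (ha1 : ∀ i ∈ I, a i ≤ 1) (hsum : ∑ i ∈ I, a i = n) :
    ∃ T ⊆ I, T.card = n ∧ ∑ i ∈ T, r i ≤ ∑ i ∈ I, a i * r i := by
  have hn : n ≤ I.card := by
    have : (n : ℝ) ≤ I.card := by
      rw [← hsum]
      simpa using Finset.sum_le_sum ha1
    exact_mod_cast this
  -- Exchange argument: for a minimising `T`, swapping one element for an outside one cannot lower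
  -- the sum, so every value of `r` outside `T` is at least every value inside.
  obtain ⟨T, hT, hmin⟩ := Finset.exists_min_image (I.powersetCard n) (fun T ↦ ∑ i ∈ T, r i)
    (Finset.powersetCard_nonempty.2 hn)
  obtain ⟨hTI, hTc⟩ := Finset.mem_powersetCard.1 hT
  refine ⟨T, hTI, hTc, ?_⟩
  have hswap : ∀ i ∈ T, ∀ j ∈ I \ T, r i ≤ r j := by
    intro i hi j hj
    obtain ⟨hjI, hjT⟩ := Finset.mem_sdiff.1 hj
    have hjE : j ∉ T.erase i := fun h ↦ hjT (Finset.mem_of_mem_erase h)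
    have h1 := hmin (insert j (T.erase i)) (by
      rw [Finset.mem_powersetCard]
      refine ⟨Finset.insert_subset hjI ((Finset.erase_subset _ _).trans hTI), ?_⟩
      rw [Finset.card_insert_of_notMem hjE, Finset.card_erase_add_one hi, hTc])
    rw [Finset.sum_insert hjE] at h1
    have h2 := Finset.add_sum_erase T r hi
    linarith
  have hsplit (f : ι → ℝ) : ∑ i ∈ I, f i = ∑ i ∈ I \ T, f i + ∑ i ∈ T, f i :=
    (Finset.sum_sdiff hTI).symm
  rcases T.eq_empty_or_nonempty with rfl | hne
  · have hn0 : n = 0 := by simpa using hTc.symm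
    subst hn0
    have : ∀ i ∈ I, a i = 0 := (Finset.sum_eq_zero_iff_of_nonneg ha0).1 (by simpa using hsum)
    rw [Finset.sum_empty]
    exact (Finset.sum_eq_zero fun i hi ↦ by rw [this i hi, zero_mul]).ge
  -- The value `r i₀` separates `T` from its complement, and by `h3` the mass missing inside `T` is
  -- exactly the mass placed outside.
  obtain ⟨i₀, hi₀, hmax⟩ := T.exists_max_image r hne
  have h1 : r i₀ * ∑ i ∈ I \ T, a i ≤ ∑ i ∈ I \ T, a i * r i := by
    rw [Finset.mul_sum]
    refine Finset.sum_le_sum fun j hj ↦ ?_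
    have := hswap i₀ hi₀ j hj
    nlinarith [ha0 j (Finset.mem_sdiff.1 hj).1]
  have h2 : ∑ i ∈ T, (1 - a i) * r i ≤ r i₀ * ∑ i ∈ T, (1 - a i) := by
    rw [Finset.mul_sum]
    refine Finset.sum_le_sum fun j hj ↦ ?_
    have := hmax j hj
    nlinarith [ha1 j (hTI hj)]
  have h3 : ∑ i ∈ T, (1 - a i) = ∑ i ∈ I \ T, a i := by
    rw [Finset.sum_sub_distrib]
    have := hsplit a
    simp only [Finset.sum_const, hTc, nsmul_eq_mul, mul_one]
    linarith
  have h4 : ∑ i ∈ T, (1 - a i) * r i = ∑ i ∈ T, r i - ∑ i ∈ T, a i * r i := by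
    rw [← Finset.sum_sub_distrib]
    exact Finset.sum_congr rfl fun i _ ↦ by ring
  rw [hsplit (fun i ↦ a i * r i)]
  rw [h3] at h2
  linarith

variable {𝕜 W : Type*} [RCLike 𝕜] [SeminormedAddCommGroup W] [InnerProductSpace 𝕜 W]

/-- The partial Fourier sums of a vector in the closed span of an orthonormal sequence converge. -/
lemma tendsto_norm_sub_partialSum {φ : ℕ → W} (hφ : Orthonormal 𝕜 φ) {e : W}
    (hd : ∀ ε : ℝ, 0 < ε → ∃ (s : Finset ℕ) (a : ℕ → 𝕜), ‖e - ∑ j ∈ s, a j • φ j‖ < ε) :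
    Tendsto (fun K ↦ ‖e - ∑ k ∈ Finset.range K, inner 𝕜 (φ k) e • φ k‖) atTop (nhds 0) := by
  rw [Metric.tendsto_atTop]
  intro ε hε
  obtain ⟨s, a, hs⟩ := hd ε hε
  refine ⟨s.sup id + 1, fun K hK ↦ ?_⟩
  rw [Real.dist_eq, sub_zero, abs_norm]
  refine lt_of_le_of_lt ?_ hs
  have hsK : s ⊆ Finset.range K := fun j hj ↦
    Finset.mem_range.2 (lt_of_lt_of_le (Nat.lt_succ_of_le (Finset.le_sup (f := id) hj)) hK)
  set P := ∑ k ∈ Finset.range K, inner 𝕜 (φ k) e • φ k with hP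
  have horth : ∀ j ∈ Finset.range K, inner 𝕜 (φ j) (e - P) = 0 := by
    intro j hj
    rw [inner_sub_right, hP, hφ.inner_right_sum _ hj, sub_self]
  set y := ∑ j ∈ s, a j • φ j with hy
  -- Best approximation: `P` is the orthogonal projection of `e` to a span containing `y`, so
  -- Pythagoras gives `‖e - P‖ ≤ ‖e - y‖`.
  have hyP : inner 𝕜 (P - y) (e - P) = 0 := by
    rw [inner_sub_left, hP, hy, sum_inner, sum_inner, ← hP,
      Finset.sum_eq_zero, Finset.sum_eq_zero, sub_self]
    · intro j hj
      rw [inner_smul_left, horth j (hsK hj), mul_zero]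
    · intro j hj
      rw [inner_smul_left, horth j hj, mul_zero]
  have h := norm_add_sq (𝕜 := 𝕜) (P - y) (e - P)
  rw [hyP] at h
  have h2 : P - y + (e - P) = e - y := by abel
  rw [h2] at h
  simp only [map_zero, mul_zero, add_zero] at h
  exact le_of_sq_le_sq (by nlinarith [sq_nonneg ‖P - y‖]) (norm_nonneg _)
where
  le_of_sq_le_sq {a b : ℝ} (h : a ^ 2 ≤ b ^ 2) (hb : 0 ≤ b) : a ≤ b :=
    abs_le_of_sq_le_sq' h hb |>.2

/-- Lower bound for the quadratic form of an operator with an eigenbasis in terms of the first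
eigenvalues. -/
lemma le_re_inner_of_eigenbasis {φ : ℕ → W} (hφ : Orthonormal 𝕜 φ) {ev : ℕ → ℝ}
    (hev : Monotone ev) {e Le : W}
    (hd : ∀ ε : ℝ, 0 < ε → ∃ (s : Finset ℕ) (a : ℕ → 𝕜), ‖e - ∑ j ∈ s, a j • φ j‖ < ε)
    (hL : ∀ k, inner 𝕜 (φ k) Le = (ev k : 𝕜) * inner 𝕜 (φ k) e) (m : ℕ) :
    ∑ k ∈ Finset.range m, ev k * ‖inner 𝕜 (φ k) e‖ ^ 2
        + ev m * (‖e‖ ^ 2 - ∑ k ∈ Finset.range m, ‖inner 𝕜 (φ k) e‖ ^ 2)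
      ≤ RCLike.re (inner 𝕜 Le e) := by
  set P : ℕ → W := fun K ↦ ∑ k ∈ Finset.range K, inner 𝕜 (φ k) e • φ k with hP
  set c : ℕ → ℝ := fun k ↦ ‖inner 𝕜 (φ k) e‖ ^ 2 with hc
  have hlim : Tendsto P atTop (nhds e) := by
    rw [tendsto_iff_norm_sub_tendsto_zero]
    simpa only [norm_sub_rev] using tendsto_norm_sub_partialSum hφ hd
  -- Pairing the fixed vector `Le` with the partial sums of `e` means that neither boundedness of
  -- the operator nor convergence of a series for `Le` is needed.
  have hinner (K : ℕ) : RCLike.re (inner 𝕜 Le (P K)) = ∑ k ∈ Finset.range K, ev k * c k := by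
    simp only [hP, inner_sum, map_sum, inner_smul_right]
    refine Finset.sum_congr rfl fun k _ ↦ ?_
    rw [← inner_conj_symm Le, hL, map_mul (starRingEnd 𝕜), RCLike.conj_ofReal, mul_comm (ev k : 𝕜), ← mul_assoc,
      RCLike.mul_conj, hc]
    norm_cast
    ring
  have hnorm (K : ℕ) : ‖P K‖ ^ 2 = ∑ k ∈ Finset.range K, c k := by
    have h : inner 𝕜 (P K) (P K) = ∑ k ∈ Finset.range K, (c k : 𝕜) := by
      rw [hP, hφ.inner_sum]
      refine Finset.sum_congr rfl fun k _ ↦ ?_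
      rw [RCLike.conj_mul, hc]
      norm_cast
    rw [inner_self_eq_norm_sq_to_K] at h
    exact_mod_cast h
  have hlim1 : Tendsto (fun K ↦ RCLike.re (inner 𝕜 Le (P K))) atTop
      (nhds (RCLike.re (inner 𝕜 Le e))) :=
    (RCLike.continuous_re.tendsto _).comp (tendsto_const_nhds.inner hlim)
  have hlim2 : Tendsto (fun K ↦ ∑ k ∈ Finset.range m, ev k * c k
      + ev m * (‖P K‖ ^ 2 - ∑ k ∈ Finset.range m, c k)) atTop
      (nhds (∑ k ∈ Finset.range m, ev k * c k
      + ev m * (‖e‖ ^ 2 - ∑ k ∈ Finset.range m, c k))) :=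
    tendsto_const_nhds.add ((((hlim.norm).pow 2).sub_const _).const_mul _)
  refine le_of_tendsto_of_tendsto hlim2 hlim1 ?_
  -- The tail from `m` on is bounded below by `ev m` times its mass while the sum is still finite.
  filter_upwards [eventually_ge_atTop m] with K hK
  rw [hinner, hnorm, ← Finset.sum_range_add_sum_Ico (fun k ↦ ev k * c k) hK,
    ← Finset.sum_range_add_sum_Ico c hK,
    add_sub_cancel_left, Finset.mul_sum]
  gcongr with k hk
  · exact hev (Finset.mem_Ico.1 hk).1

/-- Ky Fan's inequality for the eigenvalues above the lowest one. -/
lemma sum_sub_le_sum_re_inner {φ : ℕ → W} (hφ : Orthonormal 𝕜 φ) {ev : ℕ → ℝ}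
    (hev : Monotone ev) (L : W →ₗ[𝕜] W)
    (hd : ∀ (e : W) (ε : ℝ), 0 < ε → ∃ (s : Finset ℕ) (a : ℕ → 𝕜), ‖e - ∑ j ∈ s, a j • φ j‖ < ε)
    (hL : ∀ k e, inner 𝕜 (φ k) (L e) = (ev k : 𝕜) * inner 𝕜 (φ k) e)
    {ι : Type*} [Fintype ι] {e : ι → W} (he : Orthonormal 𝕜 e)
    (he0 : ∀ i, inner 𝕜 (φ 0) (e i) = 0) :
    ∑ i ∈ Finset.range (Fintype.card ι), (ev (i + 1) - ev 0)
      ≤ ∑ i, RCLike.re (inner 𝕜 (L (e i) - (ev 0 : 𝕜) • e i) (e i)) := by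
  set n := Fintype.card ι with hn
  set w : ℕ → ℝ := fun k ↦ ∑ i, ‖inner 𝕜 (φ k) (e i)‖ ^ 2 with hw
  have hw0 : w 0 = 0 := by simp [hw, he0]
  -- Bessel's inequality for the unit vector `φ k` against the orthonormal family `e`.
  have hw1 (k : ℕ) : w k ≤ 1 := by
    have h := he.sum_inner_products_le (φ k) (s := Finset.univ)
    rw [hφ.1 k, one_pow] at h
    refine le_trans (le_of_eq ?_) h
    exact Finset.sum_congr rfl fun i _ ↦ by rw [norm_inner_symm]
  -- The cut is at `n + 1` because index 0 carries no weight: the indices `1, …, n` remain, and the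
  -- tail is bounded by `ev (n + 1)`.
  have h1 (i : ι) := le_re_inner_of_eigenbasis (Le := L (e i)) hφ hev (hd (e i))
    (fun k ↦ hL k (e i)) (n + 1)
  have h2 := Finset.sum_le_sum fun i (_ : i ∈ Finset.univ) ↦ h1 i
  have h3 (i : ι) : RCLike.re (inner 𝕜 (L (e i) - (ev 0 : 𝕜) • e i) (e i))
      = RCLike.re (inner 𝕜 (L (e i)) (e i)) - ev 0 := by
    rw [inner_sub_left, inner_smul_left, inner_self_eq_norm_sq_to_K, he.1 i]
    simp
  simp only [h3, Finset.sum_sub_distrib]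
  rw [Finset.sum_add_distrib, Finset.sum_comm, ← Finset.mul_sum, Finset.sum_sub_distrib,
    Finset.sum_comm (s := Finset.univ)] at h2
  simp only [he.1, one_pow, ← Finset.mul_sum] at h2
  change ∑ k ∈ Finset.range (n + 1), ev k * w k
    + ev (n + 1) * (_ - ∑ k ∈ Finset.range (n + 1), w k) ≤ _ at h2
  rw [Finset.sum_range_succ', Finset.sum_range_succ' w, hw0] at h2
  simp only [mul_zero, add_zero, Finset.sum_const, Finset.card_univ, ← hn, nsmul_eq_mul, mul_one,
    Finset.card_range] at h2 ⊢
  -- The missing mass splits into the deficits `1 - w (k + 1) ≥ 0`, each charged at the rate `ev (n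
  -- + 1) ≥ ev (k + 1)`.
  have h4 : ∑ i ∈ Finset.range n, ev (i + 1) ≤ ∑ k ∈ Finset.range n, ev (k + 1) * w (k + 1)
      + ev (n + 1) * (n - ∑ k ∈ Finset.range n, w (k + 1)) := by
    have : (n : ℝ) - ∑ k ∈ Finset.range n, w (k + 1) = ∑ k ∈ Finset.range n, (1 - w (k + 1)) := by
      simp
    rw [this, Finset.mul_sum, ← Finset.sum_add_distrib]
    refine Finset.sum_le_sum fun k hk ↦ ?_
    have := hev (show k + 1 ≤ n + 1 by have := Finset.mem_range.1 hk; omega)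
    nlinarith [hw1 (k + 1)]
  linarith

/-- The abstract form of the inequality: `ψ α` are mutually orthogonal trial vectors orthogonal to
the ground state, whose energies are weights in `[0, 1]` with sum `n`. -/
theorem sum_sub_le_sum_norm_sq {φ : ℕ → W} (hφ : Orthonormal 𝕜 φ) {ev : ℕ → ℝ}
    (hev : Monotone ev) (L : W →ₗ[𝕜] W)
    (hd : ∀ (e : W) (ε : ℝ), 0 < ε → ∃ (s : Finset ℕ) (a : ℕ → 𝕜), ‖e - ∑ j ∈ s, a j • φ j‖ < ε)
    (hL : ∀ k e, inner 𝕜 (φ k) (L e) = (ev k : 𝕜) * inner 𝕜 (φ k) e)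
    {ι : Type*} [Fintype ι] {ψ : ι → W} (hψ : ∀ i j, i ≠ j → inner 𝕜 (ψ i) (ψ j) = 0)
    (hψ0 : ∀ i, inner 𝕜 (φ 0) (ψ i) = 0) {a : ι → ℝ} {n : ℕ}
    (ha : ∀ i, RCLike.re (inner 𝕜 (L (ψ i) - (ev 0 : 𝕜) • ψ i) (ψ i)) = a i)
    (ha0 : ∀ i, 0 ≤ a i) (ha1 : ∀ i, a i ≤ 1) (hsum : ∑ i, a i = n) :
    ∑ i ∈ Finset.range n, (ev (i + 1) - ev 0) ≤ ∑ i, ‖L (ψ i) - (ev 0 : 𝕜) • ψ i‖ ^ 2 := by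
  classical
  set u : ι → W := fun i ↦ L (ψ i) - (ev 0 : 𝕜) • ψ i with hu
  have hcs (i : ι) : a i ≤ ‖u i‖ * ‖ψ i‖ := (ha i).symm.le.trans (re_inner_le_norm _ _)
  -- Trial vectors of norm zero cannot be normalised; by Cauchy–Schwarz they have `a i = 0`, so
  -- dropping them leaves the total mass `n`.
  set I : Finset ι := Finset.univ.filter fun i ↦ ‖ψ i‖ ≠ 0 with hI
  have haI : ∀ i, i ∉ I → a i = 0 := by
    intro i hi
    have h0 : ‖ψ i‖ = 0 := by simpa [hI] using hi
    have := hcs i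
    rw [h0, mul_zero] at this
    exact le_antisymm this (ha0 i)
  -- The Rayleigh quotient of `ψ i` minus the lowest eigenvalue.
  set r : ι → ℝ := fun i ↦ a i / ‖ψ i‖ ^ 2 with hr
  obtain ⟨T, hTI, hTc, hT⟩ := exists_subset_card_eq_sum_le I a r n (fun i _ ↦ ha0 i)
    (fun i _ ↦ ha1 i) (by
      rw [← hsum]
      exact Finset.sum_subset (Finset.subset_univ _) fun i _ hi ↦ haI i hi)
  have hpos : ∀ i ∈ I, 0 < ‖ψ i‖ := fun i hi ↦
    lt_of_le_of_ne (norm_nonneg _) (Ne.symm (by simpa [hI] using hi))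
  set e : T → W := fun i ↦ ((‖ψ i‖⁻¹ : ℝ) : 𝕜) • ψ i with he
  have heo : Orthonormal 𝕜 e := by
    refine ⟨fun i ↦ ?_, fun i j hij ↦ ?_⟩
    · have := hpos i (hTI i.2)
      rw [he, norm_smul, RCLike.norm_ofReal, abs_of_pos (inv_pos.2 this), inv_mul_cancel₀ this.ne']
    · simp only [he, inner_smul_left, inner_smul_right]
      rw [hψ i j fun h ↦ hij (Subtype.ext h), mul_zero, mul_zero]
  have hmain := sum_sub_le_sum_re_inner hφ hev L hd hL heo (fun i ↦ by
    simp only [he, inner_smul_right, hψ0, mul_zero])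
  have hterm (i : T) : RCLike.re (inner 𝕜 (L (e i) - (ev 0 : 𝕜) • e i) (e i)) = r i := by
    have h1 : L (e i) - (ev 0 : 𝕜) • e i = ((‖ψ i‖⁻¹ : ℝ) : 𝕜) • u i := by
      simp only [he, hu, map_smul, smul_sub, smul_comm (ev 0 : 𝕜)]
    rw [h1, he, inner_smul_left, inner_smul_right, RCLike.conj_ofReal, RCLike.re_ofReal_mul,
      RCLike.re_ofReal_mul, ha]
    simp only [hr]
    have := (hpos i (hTI i.2)).ne'
    field_simp
  simp only [hterm] at hmain
  rw [Fintype.card_coe, hTc, Finset.sum_coe_sort T r] at hmain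
  refine hmain.trans (hT.trans ?_)
  refine le_trans (Finset.sum_le_sum fun i hi ↦ ?_)
    (Finset.sum_le_sum_of_subset_of_nonneg (Finset.subset_univ I) fun i _ _ ↦ sq_nonneg _)
  have h1 := hpos i hi
  rw [hr, ← mul_div_assoc, div_le_iff₀ (by positivity)]
  -- This is Cauchy–Schwarz squared, `a i ^ 2 ≤ ‖u i‖ ^ 2 * ‖ψ i‖ ^ 2`.
  nlinarith [hcs i, ha0 i, mul_nonneg (norm_nonneg (u i)) h1.le]

end Abstract

end DiracEigenvalues

namespace DiracEigenvalues

/-! ### Gram matrices of parametrized submanifolds of Euclidean space -/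

section Parametrized

open Matrix

/-- Jacobi's formula for the derivative of a determinant. -/
lemma hasFDerivAt_det {E ι : Type*} [NormedAddCommGroup E] [NormedSpace ℝ E] [Fintype ι]
    [DecidableEq ι] {A : E → Matrix ι ι ℝ} {A' : ι → ι → E →L[ℝ] ℝ} {y : E}
    (hA : ∀ i j, HasFDerivAt (fun y ↦ A y i j) (A' i j) y) :
    HasFDerivAt (fun y ↦ (A y).det) (∑ i, ∑ k, (A y).adjugate i k • A' k i) y := by
  simp only [det_apply']
  have h := HasFDerivAt.fun_sum (u := Finset.univ) fun (σ : Equiv.Perm ι) _ ↦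
    (HasFDerivAt.finsetProd (u := Finset.univ)
      fun (i : ι) (_ : i ∈ Finset.univ) ↦ hA (σ i) i).const_mul
        (((Equiv.Perm.sign σ : ℤ) : ℝ))
  refine h.congr_fderiv ?_
  ext u
  have h1 (i : ι) : ∑ k, (A y).adjugate i k * A' k i u
      = ∑ σ : Equiv.Perm ι, ((Equiv.Perm.sign σ : ℤ) : ℝ)
        * ((∏ j ∈ Finset.univ.erase i, A y (σ j) j) * A' (σ i) i u) := by
    -- By Cramer's rule this is the determinant with column `i` differentiated, which matches the
    -- product rule term by term.
    have h2 : ∑ k, (A y).adjugate i k * A' k i u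
        = ((A y).updateCol i fun k ↦ A' k i u).det := by
      rw [← cramer_apply, cramer_eq_adjugate_mulVec]
      rfl
    rw [h2, det_apply']
    refine Finset.sum_congr rfl fun σ _ ↦ ?_
    congr 1
    rw [← Finset.mul_prod_erase _ _ (Finset.mem_univ i), mul_comm]
    congr 1
    · exact Finset.prod_congr rfl fun j hj ↦ by
        rw [updateCol_ne (Finset.ne_of_mem_erase hj)]
    · rw [updateCol_self]
  simp only [_root_.sum_apply, _root_.smul_apply, smul_eq_mul]
  rw [Finset.sum_congr rfl fun i _ ↦ h1 i, Finset.sum_comm]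
  exact Finset.sum_congr rfl fun σ _ ↦ Finset.mul_sum _ _ _

lemma contDiffAt_det {E ι : Type*} [NormedAddCommGroup E] [NormedSpace ℝ E] [Fintype ι]
    [DecidableEq ι] {A : E → Matrix ι ι ℝ} {y : E} {k : ℕ∞ω}
    (hA : ∀ i j, ContDiffAt ℝ k (fun y ↦ A y i j) y) : ContDiffAt ℝ k (fun y ↦ (A y).det) y := by
  simp only [det_apply']
  exact ContDiffAt.sum fun σ _ ↦ contDiffAt_const.mul (contDiffAt_prod fun i _ ↦ hA _ _)

lemma contDiffAt_matrix_inv {E ι : Type*} [NormedAddCommGroup E] [NormedSpace ℝ E] [Fintype ι]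
    [DecidableEq ι] {A : E → Matrix ι ι ℝ} {y : E} {k : ℕ∞ω}
    (hA : ∀ i j, ContDiffAt ℝ k (fun y ↦ A y i j) y) (h0 : (A y).det ≠ 0) (i j : ι) :
    ContDiffAt ℝ k (fun y ↦ (A y)⁻¹ i j) y := by
  simp only [inv_def, Matrix.smul_apply, smul_eq_mul, Ring.inverse_eq_inv', adjugate_apply]
  refine (ContDiffAt.inv (contDiffAt_det hA) h0).mul (contDiffAt_det fun i' j' ↦ ?_)
  simp only [updateRow_apply]
  split_ifs
  · exact contDiffAt_const
  · exact hA _ _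

variable {n : ℕ} {Y : Type*} [NormedAddCommGroup Y] [InnerProductSpace ℝ Y]

/-- The standard basis vectors of Euclidean space. -/
abbrev stdVec (i : Fin n) : EuclideanSpace ℝ (Fin n) := EuclideanSpace.single i (1 : ℝ)

lemma sum_smul_stdVec (u : EuclideanSpace ℝ (Fin n)) : ∑ i, u i • stdVec i = u := by
  have := (EuclideanSpace.basisFun (Fin n) ℝ).sum_repr u
  simpa [stdVec] using this

/-- The first fundamental form of a map from Euclidean space. -/
def firstForm (f : EuclideanSpace ℝ (Fin n) → Y) (y : EuclideanSpace ℝ (Fin n)) :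
    Matrix (Fin n) (Fin n) ℝ :=
  Matrix.gram ℝ fun i ↦ fderiv ℝ f y (stdVec i)

/-- The coordinates of the tangential part of `v`. -/
def tangentCoord (f : EuclideanSpace ℝ (Fin n) → Y) (v : Y) (y : EuclideanSpace ℝ (Fin n)) :
    EuclideanSpace ℝ (Fin n) :=
  WithLp.toLp 2 ((firstForm f y)⁻¹ *ᵥ fun j ↦ inner ℝ (fderiv ℝ f y (stdVec j)) v)

lemma firstForm_posDef {f : EuclideanSpace ℝ (Fin n) → Y} {y : EuclideanSpace ℝ (Fin n)}
    (hinj : Function.Injective (fderiv ℝ f y)) : (firstForm f y).PosDef := by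
  rw [firstForm, posDef_gram_iff_linearIndependent]
  have h : LinearIndependent ℝ (stdVec : Fin n → EuclideanSpace ℝ (Fin n)) := by
    have := (EuclideanSpace.basisFun (Fin n) ℝ).toBasis.linearIndependent
    have h2 : (stdVec : Fin n → EuclideanSpace ℝ (Fin n)) = (EuclideanSpace.basisFun (Fin n) ℝ).toBasis := by
      ext i; simp [stdVec]
    rwa [h2]
  exact h.map' (fderiv ℝ f y).toLinearMap (LinearMap.ker_eq_bot.2 hinj)

lemma firstForm_det_pos {f : EuclideanSpace ℝ (Fin n) → Y} {y : EuclideanSpace ℝ (Fin n)}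
    (hinj : Function.Injective (fderiv ℝ f y)) : 0 < (firstForm f y).det :=
  (firstForm_posDef hinj).det_pos

lemma contDiffAt_firstForm {f : EuclideanSpace ℝ (Fin n) → Y} {y : EuclideanSpace ℝ (Fin n)}
    {k m : ℕ∞ω} (hf : ContDiffAt ℝ k f y) (hm : m + 1 ≤ k) (i j : Fin n) :
    ContDiffAt ℝ m (fun y ↦ firstForm f y i j) y :=
  ((hf.fderiv_right hm).clm_apply contDiffAt_const).inner ℝ
    ((hf.fderiv_right hm).clm_apply contDiffAt_const)

lemma contDiffAt_sqrt_det_firstForm {f : EuclideanSpace ℝ (Fin n) → Y}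
    {y : EuclideanSpace ℝ (Fin n)} {k m : ℕ∞ω} (hf : ContDiffAt ℝ k f y) (hm : m + 1 ≤ k)
    (hinj : Function.Injective (fderiv ℝ f y)) :
    ContDiffAt ℝ m (fun y ↦ √(firstForm f y).det) y :=
  (contDiffAt_det (contDiffAt_firstForm hf hm)).sqrt (firstForm_det_pos hinj).ne'

lemma contDiffAt_tangentCoord {f : EuclideanSpace ℝ (Fin n) → Y} {y : EuclideanSpace ℝ (Fin n)}
    {k m : ℕ∞ω} (hf : ContDiffAt ℝ k f y) (hm : m + 1 ≤ k)
    (hinj : Function.Injective (fderiv ℝ f y)) (v : Y) :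
    ContDiffAt ℝ m (tangentCoord f v) y := by
  rw [contDiffAt_euclidean]
  intro i
  simp only [tangentCoord, mulVec, dotProduct]
  exact ContDiffAt.sum fun j _ ↦ (contDiffAt_matrix_inv (contDiffAt_firstForm hf hm)
    (firstForm_det_pos hinj).ne' i j).mul
      (((hf.fderiv_right hm).clm_apply contDiffAt_const).inner ℝ contDiffAt_const)

lemma inner_fderiv_tangentCoord {f : EuclideanSpace ℝ (Fin n) → Y}
    {y : EuclideanSpace ℝ (Fin n)} (hinj : Function.Injective (fderiv ℝ f y)) (v : Y)
    (u : EuclideanSpace ℝ (Fin n)) :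
    inner ℝ (fderiv ℝ f y (tangentCoord f v y)) (fderiv ℝ f y u) = inner ℝ v (fderiv ℝ f y u) := by
  have hk (k : Fin n) : inner ℝ (fderiv ℝ f y (tangentCoord f v y)) (fderiv ℝ f y (stdVec k))
      = inner ℝ v (fderiv ℝ f y (stdVec k)) := by
    set b : Fin n → ℝ := fun j ↦ inner ℝ (fderiv ℝ f y (stdVec j)) v with hb
    have h1 : firstForm f y *ᵥ ((firstForm f y)⁻¹ *ᵥ b) = b := by
      rw [mulVec_mulVec, mul_nonsing_inv _ (firstForm_det_pos hinj).ne'.isUnit, one_mulVec]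
    have h2 := congrFun h1 k
    rw [real_inner_comm _ v]
    change _ = b k
    rw [← h2]
    conv_lhs => rw [← sum_smul_stdVec (tangentCoord f v y)]
    simp only [map_sum, map_smul, sum_inner, inner_smul_left, RCLike.conj_to_real]
    refine Finset.sum_congr rfl fun j _ ↦ ?_
    rw [mul_comm, real_inner_comm]
    rfl
  rw [← sum_smul_stdVec u]
  simp only [map_sum, map_smul, inner_sum, inner_smul_right, hk]

/-- The divergence with respect to the Riemannian density in coordinates. -/
lemma sum_fderiv_sqrt_det_mul {f : EuclideanSpace ℝ (Fin n) → Y} {y : EuclideanSpace ℝ (Fin n)}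
    (hf : ContDiffAt ℝ 2 f y) (hinj : Function.Injective (fderiv ℝ f y))
    {z : EuclideanSpace ℝ (Fin n) → EuclideanSpace ℝ (Fin n)} (hz : DifferentiableAt ℝ z y) :
    ∑ i, fderiv ℝ (fun y ↦ √(firstForm f y).det * z y i) y (stdVec i)
      = √(firstForm f y).det * ∑ i, ∑ j, (firstForm f y)⁻¹ i j
        * inner ℝ (fderiv ℝ (fun y ↦ fderiv ℝ f y (z y)) y (stdVec i))
            (fderiv ℝ f y (stdVec j)) := by
  set G := firstForm f y with hG
  set A := fderiv ℝ f y with hA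
  set A' := fderiv ℝ (fderiv ℝ f) y with hA'
  set z' := fderiv ℝ z y with hz'
  have hdet : 0 < G.det := firstForm_det_pos hinj
  have hfd : HasFDerivAt (fderiv ℝ f) A' y :=
    ((hf.fderiv_right (m := 1) (by norm_num)).differentiableAt one_ne_zero).hasFDerivAt
  have hsymm (u w : EuclideanSpace ℝ (Fin n)) : A' u w = A' w u :=
    (hf.isSymmSndFDerivAt (by simp)).eq u w
  have hentry (i j : Fin n) := ((hfd.clm_apply (hasFDerivAt_const (stdVec i) y)).inner ℝ
    (hfd.clm_apply (hasFDerivAt_const (stdVec j) y)))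
  have hdetd := hasFDerivAt_det (A := firstForm f) hentry
  have hsqrt := hdetd.sqrt hdet.ne'
  have hzd := hz.hasFDerivAt
  have hzi (i : Fin n) : HasFDerivAt (fun y ↦ z y i)
      ((EuclideanSpace.proj i : EuclideanSpace ℝ (Fin n) →L[ℝ] ℝ).comp z') y :=
    (EuclideanSpace.proj i : EuclideanSpace ℝ (Fin n) →L[ℝ] ℝ).hasFDerivAt.comp y hzd
  have hξ := hfd.clm_apply hzd
  have hprod (i : Fin n) := hsqrt.fun_mul (hzi i)
  have hGinv : G⁻¹ = G.det⁻¹ • G.adjugate := by rw [inv_def, Ring.inverse_eq_inv']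
  have hGsymm (i j : Fin n) : G i j = G j i := real_inner_comm _ _
  have hGT : Gᵀ = G := by ext i j; exact hGsymm j i
  have hIsymm (i j : Fin n) : G⁻¹ i j = G⁻¹ j i := by
    conv_lhs => rw [← hGT, ← transpose_nonsing_inv, transpose_apply]
  have hGG (i k : Fin n) : ∑ j, G⁻¹ i j * G j k = if i = k then 1 else 0 := by
    have := congrFun (congrFun (nonsing_inv_mul G hdet.ne'.isUnit) i) k
    rw [mul_apply, one_apply] at this
    exact this
  -- the derivative of the density in the direction `z y`
  have hL : ∑ i, fderiv ℝ (fun y ↦ √(firstForm f y).det * z y i) y (stdVec i)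
      = √G.det * ∑ i, z' (stdVec i) i
        + (1 / (2 * √G.det)) * ∑ i, ∑ k, G.adjugate i k *
          (inner ℝ (A (stdVec k)) (A' (z y) (stdVec i))
            + inner ℝ (A' (z y) (stdVec k)) (A (stdVec i))) := by
    have h1 (i : Fin n) : fderiv ℝ (fun y ↦ √(firstForm f y).det * z y i) y (stdVec i)
        = √G.det * z' (stdVec i) i + z y i * ((1 / (2 * √G.det)) *
          (∑ i, ∑ k, G.adjugate i k • ((fderivInnerCLM ℝ (A (stdVec k), A (stdVec i))).comp
            ((A'.flip (stdVec k)).prod (A'.flip (stdVec i))))) (stdVec i)) := by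
      rw [(hprod i).fderiv]
      simp [hG, hA]
    rw [Finset.sum_congr rfl fun i _ ↦ h1 i, Finset.sum_add_distrib, ← Finset.mul_sum]
    congr 1
    have h2 (Λ : EuclideanSpace ℝ (Fin n) →L[ℝ] ℝ) (c : ℝ) :
        ∑ i, z y i * (c * Λ (stdVec i)) = c * Λ (z y) := by
      conv_rhs => rw [← sum_smul_stdVec (z y)]
      simp only [map_sum, map_smul, smul_eq_mul, Finset.mul_sum]
      exact Finset.sum_congr rfl fun i _ ↦ by ring
    rw [h2]
    simp [fderivInnerCLM_apply]
  rw [hL]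
  have hR (i : Fin n) : fderiv ℝ (fun y ↦ fderiv ℝ f y (z y)) y (stdVec i)
      = A (z' (stdVec i)) + A' (stdVec i) (z y) := by
    rw [hξ.fderiv]
    rfl
  simp only [hR, inner_add_left, mul_add, Finset.sum_add_distrib]
  congr 1
  · congr 1
    have h3 (i : Fin n) : ∑ j, G⁻¹ i j * inner ℝ (A (z' (stdVec i))) (A (stdVec j))
        = z' (stdVec i) i := by
      conv_lhs =>
        enter [2, j]
        rw [← sum_smul_stdVec (z' (stdVec i))]
      simp only [map_sum, map_smul, sum_inner, inner_smul_left, RCLike.conj_to_real]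
      have h4 (k j : Fin n) : inner ℝ (A (stdVec k)) (A (stdVec j)) = G j k := by
        rw [hGsymm]; rfl
      simp only [h4, Finset.mul_sum]
      rw [Finset.sum_comm]
      have h5 (k : Fin n) : ∑ j, G⁻¹ i j * (z' (stdVec i) k * G j k)
          = z' (stdVec i) k * ∑ j, G⁻¹ i j * G j k := by
        rw [Finset.mul_sum]
        exact Finset.sum_congr rfl fun j _ ↦ by ring
      simp only [h5, hGG, mul_ite, mul_one, mul_zero, Finset.sum_ite_eq, Finset.mem_univ, if_true]
    exact Finset.sum_congr rfl fun i _ ↦ (h3 i).symm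
  · have hadj (i k : Fin n) : G.adjugate i k = G.det * G⁻¹ i k := by
      rw [hGinv, Matrix.smul_apply, smul_eq_mul, mul_inv_cancel_left₀ hdet.ne']
    have hs : √G.det * √G.det = G.det := Real.mul_self_sqrt hdet.le
    have hs0 : 0 < √G.det := Real.sqrt_pos.2 hdet
    simp only [hadj, mul_assoc, ← Finset.mul_sum]
    -- Symmetry of the second derivative and of `G⁻¹` identifies both halves of the derivative of
    -- `G` with the same sum; their factor 2 cancels the 1/2 from the square root.
    have h6 : ∑ i, ∑ k, G⁻¹ i k * inner ℝ (A (stdVec k)) (A' (z y) (stdVec i))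
        = ∑ i, ∑ k, G⁻¹ i k * inner ℝ (A' (stdVec i) (z y)) (A (stdVec k)) := by
      refine Finset.sum_congr rfl fun i _ ↦ Finset.sum_congr rfl fun k _ ↦ ?_
      rw [real_inner_comm, hsymm]
    have h7 : ∑ i, ∑ k, G⁻¹ i k * inner ℝ (A' (z y) (stdVec k)) (A (stdVec i))
        = ∑ i, ∑ k, G⁻¹ i k * inner ℝ (A' (stdVec i) (z y)) (A (stdVec k)) := by
      rw [Finset.sum_comm]
      refine Finset.sum_congr rfl fun i _ ↦ Finset.sum_congr rfl fun k _ ↦ ?_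
      rw [hIsymm, hsymm]
    rw [h6, h7]
    have : G.det = √G.det ^ 2 := by rw [sq, hs]
    field_simp
    rw [← this]
    ring

end Parametrized

end DiracEigenvalues

namespace DiracEigenvalues

/-! ### Parseval families -/

section Parseval

variable {E W ι κ : Type*} [NormedAddCommGroup E] [InnerProductSpace ℝ E] [AddCommGroup W]
  [Module ℝ W] [Fintype ι] [Fintype κ]

/-- Traces may be computed with the help of a Parseval family. -/
lemma sum_bilin_parseval {z : ι → E} (hz : ∀ u, ∑ α, inner ℝ (z α) u • z α = u)
    (e : OrthonormalBasis κ ℝ E) (T : E →ₗ[ℝ] E →ₗ[ℝ] W) :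
    ∑ α, T (z α) (z α) = ∑ i, T (e i) (e i) := by
  have h1 (α : ι) : T (z α) (z α) = ∑ i, T (inner ℝ (z α) (e i) • z α) (e i) := by
    have h2 : z α = ∑ i, inner ℝ (z α) (e i) • e i := by
      conv_lhs => rw [← e.sum_repr' (z α)]
      simp only [real_inner_comm]
    calc T (z α) (z α) = T (z α) (∑ i, inner ℝ (z α) (e i) • e i) := by rw [← h2]
      _ = _ := by simp only [map_sum, map_smul, LinearMap.smul_apply]
  rw [Finset.sum_congr rfl fun α _ ↦ h1 α, Finset.sum_comm]
  refine Finset.sum_congr rfl fun i _ ↦ ?_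
  rw [← LinearMap.sum_apply, ← map_sum, hz]

end Parseval

/-! ### Smooth vector fields, charts, Lie brackets and gradients of linear coordinates. -/

section Fields

variable {n N : ℕ} {M : Type*} [TopologicalSpace M] [ChartedSpace (EuclideanSpace ℝ (Fin n)) M]
  [IsManifold (𝓡 n) ∞ M]

variable (n) in
/-- Smooth sections of a vector bundle. -/
abbrev IsSmooth (F : Type*) [NormedAddCommGroup F] [NormedSpace ℝ F] {S : M → Type*}
    [TopologicalSpace (TotalSpace F S)] [∀ x, TopologicalSpace (S x)] [FiberBundle F S]
    (σ : ∀ p, S p) : Prop :=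
  ContMDiff (𝓡 n) ((𝓡 n).prod 𝓘(ℝ, F)) ∞ (fun p ↦ TotalSpace.mk' F p (σ p))

/-- Smooth vector fields. -/
abbrev IsSmoothField (U : ∀ p : M, TangentSpace (𝓡 n) p) : Prop :=
  IsSmooth n (EuclideanSpace ℝ (Fin n)) U

section Chart

/-- The differential of the inverse of the chart at `p`. -/
abbrev chartSymmDeriv (p : M) (y : EuclideanSpace ℝ (Fin n)) :
    EuclideanSpace ℝ (Fin n) →L[ℝ] TangentSpace (𝓡 n) ((extChartAt (𝓡 n) p).symm y) :=
  mfderiv 𝓘(ℝ, EuclideanSpace ℝ (Fin n)) (𝓡 n) (extChartAt (𝓡 n) p).symm y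

lemma contMDiffAt_chart_symm (p : M) {y : EuclideanSpace ℝ (Fin n)}
    (hy : y ∈ (extChartAt (𝓡 n) p).target) :
    ContMDiffAt 𝓘(ℝ, EuclideanSpace ℝ (Fin n)) (𝓡 n) ∞ (extChartAt (𝓡 n) p).symm y :=
  (contMDiffOn_extChartAt_symm p).contMDiffAt ((isOpen_extChartAt_target p).mem_nhds hy)

lemma mdifferentiableAt_chart_symm (p : M) {y : EuclideanSpace ℝ (Fin n)}
    (hy : y ∈ (extChartAt (𝓡 n) p).target) :
    MDifferentiableAt 𝓘(ℝ, EuclideanSpace ℝ (Fin n)) (𝓡 n) (extChartAt (𝓡 n) p).symm y :=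
  (contMDiffAt_chart_symm p hy).mdifferentiableAt (by simp)

lemma bijective_chartSymmDeriv (p : M) {y : EuclideanSpace ℝ (Fin n)}
    (hy : y ∈ (extChartAt (𝓡 n) p).target) : Function.Bijective (chartSymmDeriv p y) := by
  have h := isInvertible_mfderivWithin_extChartAt_symm (I := 𝓡 n) hy
  simp only [modelWithCornersSelf_coe, Set.range_id, mfderivWithin_univ] at h
  obtain ⟨e, he⟩ := h
  rw [chartSymmDeriv, ← he]
  exact e.bijective

lemma fderiv_comp_chart_symm {Y : Type*} [NormedAddCommGroup Y] [NormedSpace ℝ Y] (p : M)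
    {y : EuclideanSpace ℝ (Fin n)} (hy : y ∈ (extChartAt (𝓡 n) p).target) {h : M → Y}
    (hh : MDifferentiableAt (𝓡 n) 𝓘(ℝ, Y) h ((extChartAt (𝓡 n) p).symm y))
    (u : EuclideanSpace ℝ (Fin n)) :
    fderiv ℝ (h ∘ (extChartAt (𝓡 n) p).symm) y u
      = mvfderiv (𝓡 n) h ((extChartAt (𝓡 n) p).symm y) (chartSymmDeriv p y u) := by
  have := mfderiv_comp_apply y hh (mdifferentiableAt_chart_symm p hy) u
  rw [← mfderiv_eq_fderiv]
  exact this

lemma contDiffAt_comp_chart_symm {Y : Type*} [NormedAddCommGroup Y] [NormedSpace ℝ Y] (p : M)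
    {y : EuclideanSpace ℝ (Fin n)} (hy : y ∈ (extChartAt (𝓡 n) p).target) {h : M → Y}
    (hh : ContMDiffAt (𝓡 n) 𝓘(ℝ, Y) ∞ h ((extChartAt (𝓡 n) p).symm y)) :
    ContDiffAt ℝ ∞ (h ∘ (extChartAt (𝓡 n) p).symm) y :=
  (hh.comp y (contMDiffAt_chart_symm p hy)).contDiffAt

end Chart

section Derivatives

lemma contMDiffAt_mvfderiv_apply {Y : Type*} [NormedAddCommGroup Y] [NormedSpace ℝ Y] {h : M → Y}
    (hh : ContMDiff (𝓡 n) 𝓘(ℝ, Y) ∞ h) {U : ∀ p : M, TangentSpace (𝓡 n) p} {p : M}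
    (hU : ContMDiffAt (𝓡 n) ((𝓡 n).prod 𝓘(ℝ, EuclideanSpace ℝ (Fin n))) ∞
      (fun x ↦ TotalSpace.mk' (EuclideanSpace ℝ (Fin n)) x (U x)) p) :
    ContMDiffAt (𝓡 n) 𝓘(ℝ, Y) ∞ (fun q ↦ mvfderiv (𝓡 n) h q (U q)) p := by
  have h1 : ContMDiff (𝓡 n).tangent 𝓘(ℝ, Y).tangent ∞ (tangentMap (𝓡 n) 𝓘(ℝ, Y) h) :=
    hh.contMDiff_tangentMap (by simp)
  have h2 := (contMDiff_snd_tangentBundle_modelSpace Y 𝓘(ℝ, Y) (n := ∞)).comp h1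
  exact h2.contMDiffAt.comp p hU

lemma contMDiff_mvfderiv_apply {Y : Type*} [NormedAddCommGroup Y] [NormedSpace ℝ Y] {h : M → Y}
    (hh : ContMDiff (𝓡 n) 𝓘(ℝ, Y) ∞ h) {U : ∀ p : M, TangentSpace (𝓡 n) p}
    (hU : IsSmoothField U) :
    ContMDiff (𝓡 n) 𝓘(ℝ, Y) ∞ (fun q ↦ mvfderiv (𝓡 n) h q (U q)) :=
  fun p ↦ contMDiffAt_mvfderiv_apply hh (hU p)

lemma mvfderiv_clm_comp {Y Y' : Type*} [NormedAddCommGroup Y] [NormedSpace ℝ Y]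
    [NormedAddCommGroup Y'] [NormedSpace ℝ Y'] (L : Y →L[ℝ] Y') {h : M → Y} {p : M}
    (hh : MDifferentiableAt (𝓡 n) 𝓘(ℝ, Y) h p) (u : TangentSpace (𝓡 n) p) :
    mvfderiv (𝓡 n) (fun q ↦ L (h q)) p u = L (mvfderiv (𝓡 n) h p u) := by
  have h1 := mfderiv_comp_apply p (L.mdifferentiableAt (x := h p)) hh u
  rw [ContinuousLinearMap.mfderiv_eq] at h1
  exact h1

lemma mvfderiv_fun_sum {Y ι : Type*} [NormedAddCommGroup Y] [NormedSpace ℝ Y] (s : Finset ι)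
    {h : ι → M → Y} {p : M} (hh : ∀ i, MDifferentiableAt (𝓡 n) 𝓘(ℝ, Y) (h i) p)
    (u : TangentSpace (𝓡 n) p) :
    mvfderiv (𝓡 n) (fun q ↦ ∑ i ∈ s, h i q) p u = ∑ i ∈ s, mvfderiv (𝓡 n) (h i) p u := by
  classical
  suffices H : MDifferentiableAt (𝓡 n) 𝓘(ℝ, Y) (fun q ↦ ∑ i ∈ s, h i q) p ∧
      mvfderiv (𝓡 n) (fun q ↦ ∑ i ∈ s, h i q) p u = ∑ i ∈ s, mvfderiv (𝓡 n) (h i) p u from H.2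
  induction s using Finset.induction_on with
  | empty => simpa using ⟨mdifferentiableAt_const, by rw [mvfderiv_const]; rfl⟩
  | insert i s hi ih =>
    simp only [Finset.sum_insert hi]
    exact ⟨(hh i).add ih.1, by rw [mvfderiv_fun_add (hh i) ih.1, _root_.add_apply, ih.2]⟩

/-- Vector fields act on functions as a Lie algebra, at points where some vector field does not
vanish. -/
lemma mvfderiv_mlieBracket {h : M → ℝ} (hh : ContMDiff (𝓡 n) 𝓘(ℝ, ℝ) ∞ h)
    {U V W : ∀ p : M, TangentSpace (𝓡 n) p} (hU : IsSmoothField U) (hV : IsSmoothField V)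
    (hW : IsSmoothField W) {p : M} (hp : W p ≠ 0) :
    mvfderiv (𝓡 n) h p (VectorField.mlieBracket (𝓡 n) U V p)
      = mvfderiv (𝓡 n) (fun q ↦ mvfderiv (𝓡 n) h q (V q)) p (U p)
        - mvfderiv (𝓡 n) (fun q ↦ mvfderiv (𝓡 n) h q (U q)) p (V p) := by
  have h3 : IsManifold (𝓡 n) (minSmoothness ℝ 3) M :=
    IsManifold.of_le (n := (∞ : ℕ∞ω)) (by
      rw [minSmoothness_of_isRCLikeNormedField]
      exact ENat.LEInfty.out)
  have h2 : IsManifold (𝓡 n) (minSmoothness ℝ 2) M :=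
    IsManifold.of_le (n := (∞ : ℕ∞ω)) (by
      rw [minSmoothness_of_isRCLikeNormedField]
      exact ENat.LEInfty.out)
  have htop : IsManifold (𝓡 n) (((⊤ : ℕ∞) : ℕ∞ω) + 1) M :=
    inferInstanceAs (IsManifold (𝓡 n) (∞ : ℕ∞ω) M)
  have hd {g : M → ℝ} (hg : ContMDiff (𝓡 n) 𝓘(ℝ, ℝ) ∞ g) (q : M) :
      MDifferentiableAt (𝓡 n) 𝓘(ℝ, ℝ) g q := (hg q).mdifferentiableAt (by simp)
  have hdf {X : ∀ p : M, TangentSpace (𝓡 n) p} (hX : IsSmoothField X) (q : M) :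
      MDifferentiableAt (𝓡 n) ((𝓡 n).prod 𝓘(ℝ, EuclideanSpace ℝ (Fin n)))
        (fun x ↦ TotalSpace.mk' (EuclideanSpace ℝ (Fin n)) x (X x)) q :=
    (hX q).mdifferentiableAt (by simp)
  have hbr {X X' : ∀ p : M, TangentSpace (𝓡 n) p} (hX : IsSmoothField X)
      (hX' : IsSmoothField X') : IsSmoothField (VectorField.mlieBracket (𝓡 n) X X') := fun q ↦
    ContMDiffAt.mlieBracket_vectorField (m := ⊤) (n := ⊤) (hX q) (hX' q) (by simp)
  have hle : minSmoothness ℝ 2 ≤ (∞ : ℕ∞ω) := by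
    rw [minSmoothness_of_isRCLikeNormedField]
    exact ENat.LEInfty.out
  have hhW : IsSmoothField (h • W) := hh.smul_section hW
  have hU2 := contMDiff_mvfderiv_apply hh hU
  have hV2 := contMDiff_mvfderiv_apply hh hV
  have hprod {X : ∀ p : M, TangentSpace (𝓡 n) p} :
      VectorField.mlieBracket (𝓡 n) X (h • W)
        = (fun q ↦ mvfderiv (𝓡 n) h q (X q)) • W + h • VectorField.mlieBracket (𝓡 n) X W :=
    funext fun q ↦ VectorField.mlieBracket_smul_right (hd hh q) (hdf hW q)
  -- The Jacobi identity for `U`, `V`, `h • W`, minus `h` times the one for `U`, `V`, `W`, leaves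
  -- the desired scalar identity multiplied by `W p`; hence the need for `W p ≠ 0`.
  have key := VectorField.leibniz_identity_mlieBracket_apply (U := U) (V := V) (W := h • W)
    ((hU p).of_le hle) ((hV p).of_le hle) ((hhW p).of_le hle)
  have key2 := VectorField.leibniz_identity_mlieBracket_apply (U := U) (V := V) (W := W)
    ((hU p).of_le hle) ((hV p).of_le hle) ((hW p).of_le hle)
  have hexp {X X' : ∀ p : M, TangentSpace (𝓡 n) p} (hX : IsSmoothField X)
      (hX' : IsSmoothField X') :
      VectorField.mlieBracket (𝓡 n) X (VectorField.mlieBracket (𝓡 n) X' (h • W)) p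
      = mvfderiv (𝓡 n) (fun q ↦ mvfderiv (𝓡 n) h q (X' q)) p (X p) • W p
        + mvfderiv (𝓡 n) h p (X' p) • VectorField.mlieBracket (𝓡 n) X W p
        + (mvfderiv (𝓡 n) h p (X p) • VectorField.mlieBracket (𝓡 n) X' W p
        + h p • VectorField.mlieBracket (𝓡 n) X (VectorField.mlieBracket (𝓡 n) X' W) p) := by
    have hX2 := contMDiff_mvfderiv_apply hh hX'
    rw [hprod, VectorField.mlieBracket_add_right, VectorField.mlieBracket_smul_right,
      VectorField.mlieBracket_smul_right]
    · exact hd hh p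
    · exact hdf (hbr hX' hW) p
    · exact hd hX2 p
    · exact hdf hW p
    · exact hdf (hX2.smul_section hW) p
    · exact hdf (hh.smul_section (hbr hX' hW)) p
  rw [hexp hU hV, hexp hV hU, hprod, key2] at key
  simp only [Pi.add_apply, Pi.smul_apply'] at key
  have h1 : (mvfderiv (𝓡 n) h p (VectorField.mlieBracket (𝓡 n) U V p)
      - (mvfderiv (𝓡 n) (fun q ↦ mvfderiv (𝓡 n) h q (V q)) p (U p)
        - mvfderiv (𝓡 n) (fun q ↦ mvfderiv (𝓡 n) h q (U q)) p (V p))) • W p = 0 := by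
    linear_combination (norm := module) (-1 : ℝ) • key
  exact sub_eq_zero.1 ((smul_eq_zero.1 h1).resolve_right hp)

end Derivatives

variable [RiemannianBundle (fun x : M ↦ TangentSpace (𝓡 n) x)]

/-- The gradient of the linear coordinate `⟨v, x⟩`, that is, the tangential part of `v`. -/
def gradField (x : M → EuclideanSpace ℝ (Fin N)) (v : EuclideanSpace ℝ (Fin N)) (p : M) :
    TangentSpace (𝓡 n) p :=
  LinearMap.adjoint (mvfderiv (𝓡 n) x p).toLinearMap v

lemma inner_gradField (x : M → EuclideanSpace ℝ (Fin N)) (v : EuclideanSpace ℝ (Fin N)) (p : M)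
    (u : TangentSpace (𝓡 n) p) :
    inner ℝ (gradField x v p) u = inner ℝ v (mvfderiv (𝓡 n) x p u) :=
  LinearMap.adjoint_inner_left _ _ _

section Embedding

variable {x : M → EuclideanSpace ℝ (Fin N)} (hx : IsIsometricEmbedding (n := n) x)

include hx

/-- The adjoint of an isometric embedding of `T_p M` sends an orthonormal basis of the ambient space
to a Parseval family. This is what lets smooth global fields replace orthonormal frames. -/
lemma sum_inner_smul_gradField {ι : Type*} [Fintype ι]
    (b : OrthonormalBasis ι ℝ (EuclideanSpace ℝ (Fin N))) (p : M) (u : TangentSpace (𝓡 n) p) :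
    ∑ α, inner ℝ (gradField x (b α) p) u • gradField x (b α) p = u := by
  refine ext_inner_right ℝ fun w ↦ ?_
  rw [sum_inner]
  simp only [inner_smul_left, inner_gradField, RCLike.conj_to_real]
  rw [← hx.inner_mvfderiv p u w, ← b.sum_inner_mul_inner]
  exact Finset.sum_congr rfl fun α _ ↦ by rw [real_inner_comm]

lemma injective_mvfderiv (p : M) : Function.Injective (mvfderiv (𝓡 n) x p) := by
  rw [injective_iff_map_eq_zero]
  intro u hu
  have := hx.inner_mvfderiv p u u
  rw [hu, inner_zero_left] at this
  exact inner_self_eq_zero.1 this.symm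

lemma gradField_mvfderiv (p : M) (u : TangentSpace (𝓡 n) p) :
    gradField x (mvfderiv (𝓡 n) x p u) p = u :=
  ext_inner_right ℝ fun w ↦ by rw [inner_gradField, hx.inner_mvfderiv]

lemma mdifferentiableAt_embedding (p : M) :
    MDifferentiableAt (𝓡 n) 𝓘(ℝ, EuclideanSpace ℝ (Fin N)) x p :=
  (hx.smooth p).mdifferentiableAt (by simp)

lemma fderiv_embedding_chart (p : M) {y : EuclideanSpace ℝ (Fin n)}
    (hy : y ∈ (extChartAt (𝓡 n) p).target) (u : EuclideanSpace ℝ (Fin n)) :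
    fderiv ℝ (x ∘ (extChartAt (𝓡 n) p).symm) y u
      = mvfderiv (𝓡 n) x ((extChartAt (𝓡 n) p).symm y) (chartSymmDeriv p y u) :=
  fderiv_comp_chart_symm p hy (mdifferentiableAt_embedding hx _) u

lemma injective_fderiv_chart (p : M) {y : EuclideanSpace ℝ (Fin n)}
    (hy : y ∈ (extChartAt (𝓡 n) p).target) :
    Function.Injective (fderiv ℝ (x ∘ (extChartAt (𝓡 n) p).symm) y) := by
  have h : (fderiv ℝ (x ∘ (extChartAt (𝓡 n) p).symm) y : EuclideanSpace ℝ (Fin n) → _)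
      = mvfderiv (𝓡 n) x ((extChartAt (𝓡 n) p).symm y) ∘ chartSymmDeriv p y :=
    funext fun u ↦ fderiv_embedding_chart hx p hy u
  rw [h]
  exact (injective_mvfderiv hx _).comp (bijective_chartSymmDeriv p hy).1

lemma contDiffAt_embedding_chart (p : M) {y : EuclideanSpace ℝ (Fin n)}
    (hy : y ∈ (extChartAt (𝓡 n) p).target) :
    ContDiffAt ℝ ∞ (x ∘ (extChartAt (𝓡 n) p).symm) y :=
  contDiffAt_comp_chart_symm p hy (hx.smooth _)

lemma gradField_chart (v : EuclideanSpace ℝ (Fin N)) (p : M) {y : EuclideanSpace ℝ (Fin n)}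
    (hy : y ∈ (extChartAt (𝓡 n) p).target) :
    gradField x v ((extChartAt (𝓡 n) p).symm y)
      = chartSymmDeriv p y (tangentCoord (x ∘ (extChartAt (𝓡 n) p).symm) v y) := by
  refine ext_inner_right ℝ fun w ↦ ?_
  obtain ⟨u, rfl⟩ := (bijective_chartSymmDeriv p hy).2 w
  rw [inner_gradField, ← hx.inner_mvfderiv, ← fderiv_embedding_chart hx p hy,
    ← fderiv_embedding_chart hx p hy,
    inner_fderiv_tangentCoord (injective_fderiv_chart hx p hy)]

/-- In a chart the field has the coordinates `tangentCoord`, which are smooth by Cramer's rule; near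
`p` the field is therefore the pullback of a smooth field under the chart. -/
lemma contMDiff_gradField (v : EuclideanSpace ℝ (Fin N)) :
    IsSmoothField (gradField (n := n) x v) := by
  intro p
  set f := x ∘ (extChartAt (𝓡 n) p).symm with hf
  have hp : extChartAt (𝓡 n) p p ∈ (extChartAt (𝓡 n) p).target := mem_extChartAt_target p
  have h1 : ContDiffAt ℝ ∞ (tangentCoord f v) (extChartAt (𝓡 n) p p) :=
    contDiffAt_tangentCoord (contDiffAt_embedding_chart hx p hp) (by simp)
      (injective_fderiv_chart hx p hp) v
  have h2 := ContMDiffAt.mpullback_vectorField_preimage (I := 𝓡 n)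
    (f := extChartAt (𝓡 n) p) (n := ∞) (m := ∞) (x₀ := p)
    (V := (tangentCoord f v : ∀ y, TangentSpace 𝓘(ℝ, EuclideanSpace ℝ (Fin n)) y))
    (contMDiffAt_vectorSpace_iff_contDiffAt.2 h1) contMDiffAt_extChartAt
    (isInvertible_mfderiv_extChartAt (mem_extChartAt_source p)) (by simp)
  refine h2.congr_of_eventuallyEq ?_
  filter_upwards [extChartAt_source_mem_nhds (I := 𝓡 n) p] with q hq
  obtain ⟨y, hy, rfl⟩ : ∃ y ∈ (extChartAt (𝓡 n) p).target, (extChartAt (𝓡 n) p).symm y = q :=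
    ⟨_, (extChartAt (𝓡 n) p).map_source hq, (extChartAt (𝓡 n) p).left_inv hq⟩
  have hinv := isInvertible_mfderiv_extChartAt (I := 𝓡 n) hq
  have hcomp := mfderiv_extChartAt_comp_mfderivWithin_extChartAt_symm (I := 𝓡 n) hy
  simp only [modelWithCornersSelf_coe, Set.range_id, mfderivWithin_univ] at hcomp
  have h3 : mfderiv (𝓡 n) 𝓘(ℝ, EuclideanSpace ℝ (Fin n)) (extChartAt (𝓡 n) p)
      ((extChartAt (𝓡 n) p).symm y) (gradField x v ((extChartAt (𝓡 n) p).symm y))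
      = tangentCoord f v (extChartAt (𝓡 n) p ((extChartAt (𝓡 n) p).symm y)) := by
    rw [gradField_chart hx v p hy, (extChartAt (𝓡 n) p).right_inv hy]
    exact congrArg (fun L : EuclideanSpace ℝ (Fin n) →L[ℝ] EuclideanSpace ℝ (Fin n) ↦
      L (tangentCoord f v y)) hcomp
  congr 1
  exact ((congrArg (mfderiv (𝓡 n) 𝓘(ℝ, EuclideanSpace ℝ (Fin n)) (extChartAt (𝓡 n) p)
    ((extChartAt (𝓡 n) p).symm y)).inverse h3.symm).trans (hinv.inverse_apply_self _)).symm

end Embedding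
end Fields
end DiracEigenvalues

namespace DiracEigenvalues

/-! ### Hessians of the linear coordinates. -/

section LeviCivita

variable {n N : ℕ} {M : Type*} [TopologicalSpace M] [ChartedSpace (EuclideanSpace ℝ (Fin n)) M]
  [IsManifold (𝓡 n) ∞ M]

/-- Covariant derivatives of smooth sections along smooth vector fields are smooth. -/
lemma isSmooth_conn_apply {F : Type*} [NormedAddCommGroup F] [NormedSpace ℝ F] {S : M → Type*}
    [TopologicalSpace (TotalSpace F S)] [∀ x, NormedAddCommGroup (S x)]
    [∀ x, InnerProductSpace ℝ (S x)] [FiberBundle F S] [VectorBundle ℝ F S]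
    [ContMDiffVectorBundle ∞ F S (𝓡 n)]
    {cov : CovariantDerivative (𝓡 n) F S}
    (hcov : CovariantDerivative.ContMDiffCovariantDerivative cov ∞)
    {σ : ∀ p, S p} (hσ : IsSmooth n F σ) {p : M} {U : ∀ p : M, TangentSpace (𝓡 n) p}
    (hU : ContMDiffAt (𝓡 n) ((𝓡 n).prod 𝓘(ℝ, EuclideanSpace ℝ (Fin n))) ∞
      (fun x ↦ TotalSpace.mk' (EuclideanSpace ℝ (Fin n)) x (U x)) p) :
    ContMDiffAt (𝓡 n) ((𝓡 n).prod 𝓘(ℝ, F)) ∞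
      (fun q ↦ TotalSpace.mk' F q (cov σ q (U q))) p := by
  have h1 := hcov.contMDiff.contMDiff (σ := σ) (by
    rw [contMDiffOn_univ]
    exact hσ)
  rw [contMDiffOn_univ] at h1
  exact (h1 p).clm_bundle_apply hU

variable [RiemannianBundle (fun x : M ↦ TangentSpace (𝓡 n) x)]
  [IsContMDiffRiemannianBundle (𝓡 n) ∞ (EuclideanSpace ℝ (Fin n))
    (fun x : M ↦ TangentSpace (𝓡 n) x)]
  {lc : CovariantDerivative (𝓡 n) (EuclideanSpace ℝ (Fin n)) (TangentSpace (𝓡 n) : M → Type _)}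
  {x : M → EuclideanSpace ℝ (Fin N)}

instance : IsContMDiffRiemannianBundle (𝓡 n) 1 (EuclideanSpace ℝ (Fin n))
    (fun x : M ↦ TangentSpace (𝓡 n) x) :=
  IsContMDiffRiemannianBundle.of_le (n := (∞ : ℕ∞ω)) ENat.LEInfty.out

lemma IsSmoothField.mdiffAt {U : ∀ p : M, TangentSpace (𝓡 n) p} (hU : IsSmoothField U) (p : M) :
    MDifferentiableAt (𝓡 n) ((𝓡 n).prod 𝓘(ℝ, EuclideanSpace ℝ (Fin n)))
      (fun x ↦ TotalSpace.mk' (EuclideanSpace ℝ (Fin n)) x (U x)) p :=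
  (hU p).mdifferentiableAt (by simp)

/-- Metric compatibility of the Levi-Civita connection. -/
lemma mvfderiv_inner_field (hm : lc.IsMetricCompatible) {U V : ∀ p : M, TangentSpace (𝓡 n) p}
    {p : M}
    (hU : MDifferentiableAt (𝓡 n) ((𝓡 n).prod 𝓘(ℝ, EuclideanSpace ℝ (Fin n)))
      (fun x ↦ TotalSpace.mk' (EuclideanSpace ℝ (Fin n)) x (U x)) p)
    (hV : MDifferentiableAt (𝓡 n) ((𝓡 n).prod 𝓘(ℝ, EuclideanSpace ℝ (Fin n)))
      (fun x ↦ TotalSpace.mk' (EuclideanSpace ℝ (Fin n)) x (V x)) p)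
    (u : TangentSpace (𝓡 n) p) :
    mvfderiv (𝓡 n) (fun q ↦ inner ℝ (U q) (V q)) p u
      = inner ℝ (lc U p u) (V p) + inner ℝ (U p) (lc V p u) := by
  have := hm.mvfderiv_inner_eq (FiberBundle.extend (EuclideanSpace ℝ (Fin n)) u) hU hV
  simpa using this

section Embedding

variable (hx : IsIsometricEmbedding (n := n) x)

include hx

lemma mvfderiv_inner_const (v : EuclideanSpace ℝ (Fin N)) (p : M) (u : TangentSpace (𝓡 n) p) :
    mvfderiv (𝓡 n) (fun q ↦ inner ℝ v (x q)) p u = inner ℝ (gradField x v p) u := by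
  rw [inner_gradField]
  exact mvfderiv_clm_comp (innerSL ℝ v) (mdifferentiableAt_embedding hx p) u

lemma contMDiff_inner_const (v : EuclideanSpace ℝ (Fin N)) :
    ContMDiff (𝓡 n) 𝓘(ℝ, ℝ) ∞ (fun q ↦ inner ℝ v (x q)) :=
  (innerSL ℝ v).contMDiff.comp hx.smooth

/-- The Hessian of a linear coordinate is symmetric. -/
lemma inner_conn_gradField_comm (ht : lc.torsion = 0) (hm : lc.IsMetricCompatible)
    (v : EuclideanSpace ℝ (Fin N)) (p : M) (u w : TangentSpace (𝓡 n) p) :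
    inner ℝ (lc (gradField x v) p u) w = inner ℝ (lc (gradField x v) p w) u := by
  -- The bracket formula needs a field that does not vanish at `p`; for `u ≠ 0` the extension `U` of
  -- `u` serves.
  by_cases hu : u = 0
  · simp [hu]
  set U := gradField (n := n) x (mvfderiv (𝓡 n) x p u) with hU
  set W := gradField (n := n) x (mvfderiv (𝓡 n) x p w) with hW
  have hUp : U p = u := gradField_mvfderiv hx p u
  have hWp : W p = w := gradField_mvfderiv hx p w
  have hUs : IsSmoothField U := contMDiff_gradField hx _
  have hWs : IsSmoothField W := contMDiff_gradField hx _
  have hZs : IsSmoothField (gradField (n := n) x v) := contMDiff_gradField hx _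
  have h1 := mvfderiv_mlieBracket (contMDiff_inner_const hx v) hUs hWs hUs (p := p)
    (by rwa [hUp])
  simp only [mvfderiv_inner_const hx] at h1
  rw [mvfderiv_inner_field hm (hZs.mdiffAt p) (hWs.mdiffAt p),
    mvfderiv_inner_field hm (hZs.mdiffAt p) (hUs.mdiffAt p),
    ← (lc.torsion_eq_zero_iff.1 ht) (hUs.mdiffAt p) (hWs.mdiffAt p), inner_sub_right, hUp, hWp]
    at h1
  linarith

variable {ι : Type*} [Fintype ι] (b : OrthonormalBasis ι ℝ (EuclideanSpace ℝ (Fin N)))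

lemma sum_inner_mul_inner_gradField (p : M) (u w : TangentSpace (𝓡 n) p) :
    ∑ α, inner ℝ (gradField x (b α) p) u * inner ℝ (gradField x (b α) p) w = inner ℝ u w := by
  conv_rhs => rw [← sum_inner_smul_gradField hx b p u, sum_inner]
  simp only [inner_smul_left, RCLike.conj_to_real]

/-- The Hessians of the linear coordinates are normal to the submanifold. -/
lemma sum_inner_conn_gradField_mul (ht : lc.torsion = 0) (hm : lc.IsMetricCompatible)
    (p : M) (u w z : TangentSpace (𝓡 n) p) :
    ∑ α, inner ℝ (lc (gradField x (b α)) p u) w * inner ℝ (gradField x (b α) p) z = 0 := by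
  set c : TangentSpace (𝓡 n) p → TangentSpace (𝓡 n) p → TangentSpace (𝓡 n) p → ℝ := fun u w z ↦
    ∑ α, inner ℝ (lc (gradField x (b α)) p u) w * inner ℝ (gradField x (b α) p) z with hc
  have hsymm (u w z) : c u w z = c w u z := Finset.sum_congr rfl fun α _ ↦ by
    rw [inner_conn_gradField_comm hx ht hm]
  have hanti (u w z) : c u w z = - c u z w := by
    set W := gradField (n := n) x (mvfderiv (𝓡 n) x p w) with hW
    set Z := gradField (n := n) x (mvfderiv (𝓡 n) x p z) with hZ
    have hWp : W p = w := gradField_mvfderiv hx p w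
    have hZp : Z p = z := gradField_mvfderiv hx p z
    have hWs : IsSmoothField W := contMDiff_gradField hx _
    have hZs : IsSmoothField Z := contMDiff_gradField hx _
    have hb (α : ι) : IsSmoothField (gradField (n := n) x (b α)) := contMDiff_gradField hx _
    have hin {X : ∀ p : M, TangentSpace (𝓡 n) p} (hX : IsSmoothField X) (α : ι) :
        MDifferentiableAt (𝓡 n) 𝓘(ℝ, ℝ) (fun q ↦ inner ℝ (gradField x (b α) q) (X q)) p :=
      ((hb α).mdiffAt p).inner_bundle (hX.mdiffAt p)
    -- Differentiating the Parseval identity for `⟨W, Z⟩` along `u`: the terms with derivatives of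
    -- `W` and `Z` cancel by metric compatibility, leaving `c u w z + c u z w = 0`.
    have h1 : (fun q ↦ inner ℝ (W q) (Z q)) = fun q ↦ ∑ α,
        inner ℝ (gradField x (b α) q) (W q) * inner ℝ (gradField x (b α) q) (Z q) :=
      funext fun q ↦ (sum_inner_mul_inner_gradField hx b q _ _).symm
    have h2 := mvfderiv_inner_field hm (hWs.mdiffAt p) (hZs.mdiffAt p) u
    have h3 : mvfderiv (𝓡 n) (fun q ↦ ∑ α,
        inner ℝ (gradField x (b α) q) (W q) * inner ℝ (gradField x (b α) q) (Z q)) p u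
        = ∑ α, mvfderiv (𝓡 n) (fun q ↦
        inner ℝ (gradField x (b α) q) (W q) * inner ℝ (gradField x (b α) q) (Z q)) p u :=
      mvfderiv_fun_sum _ (fun α ↦ (hin hWs α).mul (hin hZs α)) u
    rw [h1, h3] at h2
    have h4 (α : ι) : mvfderiv (𝓡 n) (fun q ↦
        inner ℝ (gradField x (b α) q) (W q) * inner ℝ (gradField x (b α) q) (Z q)) p u
        = inner ℝ (gradField x (b α) p) w *
          (inner ℝ (lc (gradField x (b α)) p u) z + inner ℝ (gradField x (b α) p) (lc Z p u))
        + inner ℝ (gradField x (b α) p) z *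
          (inner ℝ (lc (gradField x (b α)) p u) w + inner ℝ (gradField x (b α) p) (lc W p u)) := by
      rw [mvfderiv_fun_mul (hin hWs α) (hin hZs α)]
      simp only [_root_.add_apply, _root_.smul_apply, smul_eq_mul]
      rw [mvfderiv_inner_field hm ((hb α).mdiffAt p) (hZs.mdiffAt p),
        mvfderiv_inner_field hm ((hb α).mdiffAt p) (hWs.mdiffAt p), hWp, hZp]
    rw [Finset.sum_congr rfl fun α _ ↦ h4 α] at h2
    simp only [mul_add, Finset.sum_add_distrib] at h2
    rw [sum_inner_mul_inner_gradField hx b, sum_inner_mul_inner_gradField hx b, hWp, hZp,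
      real_inner_comm z] at h2
    have h5 : c u w z = ∑ α, inner ℝ (gradField x (b α) p) z *
        inner ℝ (lc (gradField x (b α)) p u) w := Finset.sum_congr rfl fun α _ ↦ mul_comm _ _
    have h6 : c u z w = ∑ α, inner ℝ (gradField x (b α) p) w *
        inner ℝ (lc (gradField x (b α)) p u) z := Finset.sum_congr rfl fun α _ ↦ mul_comm _ _
    rw [real_inner_comm] at h2
    linarith
  change c u w z = 0
  -- A trilinear form symmetric in the first two slots and antisymmetric in the last two vanishes,
  -- as in the uniqueness of the Levi-Civita connection.
  have h1 := hanti u w z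
  have h2 := hsymm u z w
  have h3 := hanti z u w
  have h4 := hsymm z w u
  have h5 := hanti w z u
  have h6 := hsymm w u z
  linarith

end Embedding

end LeviCivita

end DiracEigenvalues

/-! ### Coordinate Laplacians, mean curvature and divergence. -/

namespace DiracEigenvalues

lemma bilin_eq_sum {E W κ : Type*} [NormedAddCommGroup E] [InnerProductSpace ℝ E]
    [AddCommGroup W] [Module ℝ W] [Fintype κ] (e : OrthonormalBasis κ ℝ E)
    (T : E →ₗ[ℝ] E →ₗ[ℝ] W) (u w : E) :
    T u w = ∑ i, ∑ j, (inner ℝ u (e i) * inner ℝ w (e j)) • T (e i) (e j) := by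
  have h2 (w : E) : w = ∑ i, inner ℝ w (e i) • e i := by
    conv_lhs => rw [← e.sum_repr' w]
    simp only [real_inner_comm]
  conv_lhs => rw [h2 u, h2 w]
  simp only [map_sum, map_smul, LinearMap.smul_apply, LinearMap.sum_apply, Finset.smul_sum,
    smul_smul]
  rw [Finset.sum_comm]
  exact Finset.sum_congr rfl fun i _ ↦ Finset.sum_congr rfl fun j _ ↦ by rw [mul_comm]

section MeanCurvature

variable {n N : ℕ} {M : Type*} [TopologicalSpace M] [ChartedSpace (EuclideanSpace ℝ (Fin n)) M]
  [IsManifold (𝓡 n) ∞ M] [RiemannianBundle (fun x : M ↦ TangentSpace (𝓡 n) x)]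

/-- The Laplacian of the linear coordinate `⟨v, x⟩`: the divergence of its gradient. -/
def coordLaplacian (lc : CovariantDerivative (𝓡 n) (EuclideanSpace ℝ (Fin n))
    (TangentSpace (𝓡 n) : M → Type _)) (x : M → EuclideanSpace ℝ (Fin N))
    (v : EuclideanSpace ℝ (Fin N)) (p : M) : ℝ :=
  ∑ i, inner ℝ (lc (gradField x v) p (frame p i)) (frame p i)

variable [IsContMDiffRiemannianBundle (𝓡 n) ∞ (EuclideanSpace ℝ (Fin n))
    (fun x : M ↦ TangentSpace (𝓡 n) x)]
  {lc : CovariantDerivative (𝓡 n) (EuclideanSpace ℝ (Fin n)) (TangentSpace (𝓡 n) : M → Type _)}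
  {x : M → EuclideanSpace ℝ (Fin N)} (hx : IsIsometricEmbedding (n := n) x)
  {ι : Type*} [Fintype ι] (b : OrthonormalBasis ι ℝ (EuclideanSpace ℝ (Fin N)))

include hx

/-- Traces over the tangent space in terms of the gradients of the linear coordinates. -/
lemma sum_bilin_gradField {W : Type*} [AddCommGroup W] [Module ℝ W] (p : M)
    (T : TangentSpace (𝓡 n) p →ₗ[ℝ] TangentSpace (𝓡 n) p →ₗ[ℝ] W) :
    ∑ α, T (gradField x (b α) p) (gradField x (b α) p) = ∑ i, T (frame p i) (frame p i) :=
  sum_bilin_parseval (sum_inner_smul_gradField hx b p) _ T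

lemma coordLaplacian_eq_sum (v : EuclideanSpace ℝ (Fin N)) (p : M) :
    coordLaplacian lc x v p
      = ∑ α, inner ℝ (lc (gradField x v) p (gradField x (b α) p)) (gradField x (b α) p) :=
  (sum_bilin_gradField hx b p ((innerₗ (TangentSpace (𝓡 n) p)).comp
    (lc (gradField x v) p).toLinearMap)).symm

/-- `frame` is chosen point by point and need not be continuous, so smoothness is read off from the
trace over the smooth gradient fields. -/
lemma contMDiff_coordLaplacian
    (hs : CovariantDerivative.ContMDiffCovariantDerivative lc ∞) (v : EuclideanSpace ℝ (Fin N)) :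
    ContMDiff (𝓡 n) 𝓘(ℝ, ℝ) ∞ (coordLaplacian lc x v) := by
  have h : coordLaplacian lc x v = fun p ↦ ∑ α, inner ℝ (lc (gradField x v) p
      (gradField x (EuclideanSpace.basisFun (Fin N) ℝ α) p))
      (gradField x (EuclideanSpace.basisFun (Fin N) ℝ α) p) :=
    funext fun p ↦ coordLaplacian_eq_sum hx _ v p
  rw [h]
  refine contMDiff_finsetSum fun α _ p ↦ ContMDiffAt.inner_bundle
    (isSmooth_conn_apply hs (contMDiff_gradField hx v) ((contMDiff_gradField hx _) p))
    ((contMDiff_gradField hx _) p)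

/-- The form in which Σ ∇_u Z_α ⊗ Z_α = 0 is applied: when an expansion in the fields Z_α is
differentiated, their own derivatives contribute nothing. -/
lemma sum_bilin_conn_gradField (ht : lc.torsion = 0) (hm : lc.IsMetricCompatible)
    {W : Type*} [AddCommGroup W] [Module ℝ W] (p : M) (u : TangentSpace (𝓡 n) p)
    (T : TangentSpace (𝓡 n) p →ₗ[ℝ] TangentSpace (𝓡 n) p →ₗ[ℝ] W) :
    ∑ α, T (lc (gradField x (b α)) p u) (gradField x (b α) p) = 0 := by
  have h1 (α : ι) : T (lc (gradField x (b α)) p u) (gradField x (b α) p)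
      = ∑ i, ∑ j, (inner ℝ (lc (gradField x (b α)) p u) (frame p i)
        * inner ℝ (gradField x (b α) p) (frame p j)) • T (frame p i) (frame p j) :=
    bilin_eq_sum (frame p) T _ _
  rw [Finset.sum_congr rfl fun α _ ↦ h1 α, Finset.sum_comm]
  refine Finset.sum_eq_zero fun i _ ↦ ?_
  rw [Finset.sum_comm]
  refine Finset.sum_eq_zero fun j _ ↦ ?_
  rw [← Finset.sum_smul, sum_inner_conn_gradField_mul hx b ht hm, zero_smul]

/-- Symmetry of the Hessian moves the test vector `w` into the direction of differentiation, and the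
sum becomes a trace of Σ ∇_w Z_α ⊗ Z_α = 0. -/
lemma sum_conn_gradField (ht : lc.torsion = 0) (hm : lc.IsMetricCompatible) (p : M) :
    ∑ α, lc (gradField x (b α)) p (gradField x (b α) p) = 0 := by
  refine ext_inner_right ℝ fun w ↦ ?_
  rw [sum_inner, inner_zero_left, ← sum_bilin_conn_gradField hx b ht hm p w
    (innerₗ (TangentSpace (𝓡 n) p))]
  exact Finset.sum_congr rfl fun α _ ↦ inner_conn_gradField_comm hx ht hm _ p _ _

/-- The mean curvature vector is normal: the left side is its tangential part. -/
lemma sum_coordLaplacian_smul (ht : lc.torsion = 0) (hm : lc.IsMetricCompatible) (p : M) :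
    ∑ α, coordLaplacian lc x (b α) p • gradField (n := n) x (b α) p = 0 := by
  refine ext_inner_right ℝ fun w ↦ ?_
  rw [sum_inner, inner_zero_left]
  simp only [inner_smul_left, RCLike.conj_to_real, coordLaplacian, Finset.sum_mul]
  rw [Finset.sum_comm]
  exact Finset.sum_eq_zero fun i _ ↦ sum_inner_conn_gradField_mul hx b ht hm p _ _ _

/-- Gauss formula. The vector `k = D_u(dx W) - dx(∇_u W)` pairs with `v` to the Hessian of `⟨v, x⟩`;
as Hessians are normal, `k` is the normal component of `D_u(dx W)`. -/
lemma inner_secondFundamentalForm (ht : lc.torsion = 0) (hm : lc.IsMetricCompatible)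
    (v : EuclideanSpace ℝ (Fin N)) (p : M) (u w : TangentSpace (𝓡 n) p) :
    inner ℝ v (secondFundamentalForm x p u w) = inner ℝ (lc (gradField x v) p u) w := by
  set W : ∀ q : M, TangentSpace (𝓡 n) q := FiberBundle.extend (EuclideanSpace ℝ (Fin n)) w with hW
  have hWs : ContMDiffAt (𝓡 n) ((𝓡 n).prod 𝓘(ℝ, EuclideanSpace ℝ (Fin n))) ∞
      (fun q ↦ TotalSpace.mk' (EuclideanSpace ℝ (Fin n)) q (W q)) p :=
    FiberBundle.contMDiffAt_extend (𝓡 n) (EuclideanSpace ℝ (Fin n)) w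
  have hWp : W p = w := by simp [hW]
  set g : M → EuclideanSpace ℝ (Fin N) := fun q ↦ mvfderiv (𝓡 n) x q (W q) with hg
  have hgs : ContMDiffAt (𝓡 n) 𝓘(ℝ, EuclideanSpace ℝ (Fin N)) ∞ g p :=
    contMDiffAt_mvfderiv_apply hx.smooth hWs
  set k := mvfderiv (𝓡 n) g p u - mvfderiv (𝓡 n) x p (lc W p u) with hk
  have h1 (v : EuclideanSpace ℝ (Fin N)) :
      inner ℝ v k = inner ℝ (lc (gradField x v) p u) w := by
    have h2 := mvfderiv_clm_comp (innerSL ℝ v) (hgs.mdifferentiableAt (by simp)) u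
    have h3 := mvfderiv_inner_field hm ((contMDiff_gradField hx v).mdiffAt p)
      (hWs.mdifferentiableAt (by simp)) u
    have h4 : (fun q ↦ innerSL ℝ v (g q)) = fun q ↦ inner ℝ (gradField x v q) (W q) :=
      funext fun q ↦ (inner_gradField x v q _).symm
    rw [h4, h3, hWp, inner_gradField] at h2
    rw [hk, inner_sub_right]
    simp only [innerSL_apply_apply] at h2
    linarith
  have hkp : k ∈ (LinearMap.range (mvfderiv (𝓡 n) x p).toLinearMap)ᗮ := by
    rw [Submodule.mem_orthogonal]
    rintro _ ⟨z, rfl⟩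
    set b := EuclideanSpace.basisFun (Fin N) ℝ
    change inner ℝ (mvfderiv (𝓡 n) x p z) k = 0
    rw [← b.sum_inner_mul_inner, ← sum_inner_conn_gradField_mul hx b ht hm p u w z]
    refine Finset.sum_congr rfl fun α _ ↦ ?_
    rw [h1, inner_gradField, real_inner_comm, mul_comm]
  rw [← h1]
  congr 1
  have h5 : mvfderiv (𝓡 n) g p u = k + mvfderiv (𝓡 n) x p (lc W p u) := by rw [hk]; abel
  change Submodule.starProjection _ (mvfderiv (𝓡 n) g p u) = k
  rw [h5, map_add, Submodule.starProjection_eq_self_iff.2 hkp, add_eq_left,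
    Submodule.starProjection_apply_eq_zero_iff, Submodule.orthogonal_orthogonal]
  exact ⟨_, rfl⟩

lemma inner_meanCurvatureVector (ht : lc.torsion = 0) (hm : lc.IsMetricCompatible)
    (v : EuclideanSpace ℝ (Fin N)) (p : M) :
    inner ℝ v (meanCurvatureVector (n := n) x p) = coordLaplacian lc x v p := by
  rw [meanCurvatureVector, inner_sum]
  exact Finset.sum_congr rfl fun i _ ↦ inner_secondFundamentalForm hx ht hm v p _ _

lemma sum_coordLaplacian_sq (ht : lc.torsion = 0) (hm : lc.IsMetricCompatible) (p : M) :
    ∑ α, coordLaplacian lc x (b α) p ^ 2 = (n : ℝ) ^ 2 * meanCurvature (n := n) x p ^ 2 := by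
  have h1 : ∑ α, coordLaplacian lc x (b α) p ^ 2 = ‖meanCurvatureVector (n := n) x p‖ ^ 2 := by
    rw [← b.sum_sq_norm_inner_right]
    refine Finset.sum_congr rfl fun α _ ↦ ?_
    rw [← inner_meanCurvatureVector hx ht hm, Real.norm_eq_abs, sq_abs]
  rw [h1, meanCurvature]
  rcases Nat.eq_zero_or_pos n with hn | hn
  · subst hn
    have h2 : Module.finrank ℝ (TangentSpace (𝓡 0) p) = 0 :=
      finrank_euclideanSpace_fin (𝕜 := ℝ) (n := 0)
    have h3 : meanCurvatureVector (n := 0) x p = 0 := by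
      rw [meanCurvatureVector]
      refine Finset.sum_eq_zero fun i _ ↦ ?_
      rw [h2] at i
      exact i.elim0
    rw [h3]
    simp
  · field_simp

lemma bddAbove_meanCurvature_sq [CompactSpace M]
    (hs : CovariantDerivative.ContMDiffCovariantDerivative lc ∞) (ht : lc.torsion = 0)
    (hm : lc.IsMetricCompatible) :
    BddAbove (Set.range fun p ↦ (n : ℝ) ^ 2 * meanCurvature (n := n) x p ^ 2) := by
  simp only [← sum_coordLaplacian_sq hx (EuclideanSpace.basisFun (Fin N) ℝ) ht hm]
  refine (isCompact_range (continuous_finsetSum _ fun α _ ↦ ?_)).bddAbove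
  exact (contMDiff_coordLaplacian hx hs _).continuous.pow 2

/-- The divergence of the vector field `h ∇⟨v, x⟩`. -/
lemma mvfderiv_gradField_add_eq_sum (ht : lc.torsion = 0) (hm : lc.IsMetricCompatible)
    {h : M → ℝ} (v : EuclideanSpace ℝ (Fin N)) {p : M}
    (hh : MDifferentiableAt (𝓡 n) 𝓘(ℝ, ℝ) h p) :
    mvfderiv (𝓡 n) h p (gradField x v p) + h p * coordLaplacian lc x v p
      = ∑ α, mvfderiv (𝓡 n) (fun q ↦ h q * inner ℝ (gradField (n := n) x (b α) q) (gradField x v q)) p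
        (gradField x (b α) p) := by
  have hv : IsSmoothField (gradField (n := n) x v) := contMDiff_gradField hx _
  have hb (α : ι) : IsSmoothField (gradField (n := n) x (b α)) := contMDiff_gradField hx _
  have h1 (α : ι) : mvfderiv (𝓡 n)
      (fun q ↦ h q * inner ℝ (gradField (n := n) x (b α) q) (gradField x v q)) p (gradField x (b α) p)
      = h p * (inner ℝ (lc (gradField x (b α)) p (gradField x (b α) p)) (gradField (n := n) x v p)
        + inner ℝ (lc (gradField x v) p (gradField x (b α) p)) (gradField x (b α) p))
        + inner ℝ (gradField (n := n) x (b α) p) (gradField x v p) *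
          mvfderiv (𝓡 n) h p (gradField x (b α) p) := by
    rw [mvfderiv_fun_mul hh (((hb α).mdiffAt p).inner_bundle (hv.mdiffAt p))]
    simp only [_root_.add_apply, _root_.smul_apply, smul_eq_mul]
    rw [mvfderiv_inner_field hm ((hb α).mdiffAt p) (hv.mdiffAt p),
      real_inner_comm (gradField x (b α) p) (lc _ _ _)]
  -- The terms with ∇_{Z_α} Z_α add up to zero; what remains are the trace giving the Laplacian and
  -- the Parseval expansion of the gradient.
  rw [Finset.sum_congr rfl fun α _ ↦ h1 α, Finset.sum_add_distrib, ← Finset.mul_sum,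
    Finset.sum_add_distrib, ← sum_inner, sum_conn_gradField hx b ht hm, inner_zero_left, zero_add,
    ← coordLaplacian_eq_sum hx b, add_comm]
  congr 1
  conv_lhs => rw [← sum_inner_smul_gradField hx b p (gradField x v p)]
  simp only [map_sum, map_smul, smul_eq_mul]

/-- The divergence of `h ∇⟨v, x⟩` in the coordinates of a chart. -/
lemma sum_fderiv_chart_eq (ht : lc.torsion = 0) (hm : lc.IsMetricCompatible)
    {h : M → ℝ} (hh : ContMDiff (𝓡 n) 𝓘(ℝ, ℝ) ∞ h) (v : EuclideanSpace ℝ (Fin N)) (p : M)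
    {y : EuclideanSpace ℝ (Fin n)} (hy : y ∈ (extChartAt (𝓡 n) p).target) :
    ∑ i, fderiv ℝ (fun y ↦ √(firstForm (x ∘ (extChartAt (𝓡 n) p).symm) y).det *
        (h ((extChartAt (𝓡 n) p).symm y) *
          tangentCoord (x ∘ (extChartAt (𝓡 n) p).symm) v y i)) y (stdVec i)
      = √(firstForm (x ∘ (extChartAt (𝓡 n) p).symm) y).det *
        (mvfderiv (𝓡 n) h ((extChartAt (𝓡 n) p).symm y)
          (gradField x v ((extChartAt (𝓡 n) p).symm y))
        + h ((extChartAt (𝓡 n) p).symm y) *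
          coordLaplacian lc x v ((extChartAt (𝓡 n) p).symm y)) := by
  set ψ := (extChartAt (𝓡 n) p).symm with hψ
  set f := x ∘ ψ with hf
  set b := EuclideanSpace.basisFun (Fin N) ℝ
  set z : EuclideanSpace ℝ (Fin n) → EuclideanSpace ℝ (Fin n) :=
    fun y ↦ h (ψ y) • tangentCoord f v y with hz
  have hinj : Function.Injective (fderiv ℝ f y) := injective_fderiv_chart hx p hy
  have hfs : ContDiffAt ℝ ∞ f y := contDiffAt_embedding_chart hx p hy
  have hzd : DifferentiableAt ℝ z y := by
    have h1 : ContDiffAt ℝ ∞ (h ∘ ψ) y := contDiffAt_comp_chart_symm p hy (hh _)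
    have h2 : ContDiffAt ℝ ∞ (tangentCoord f v) y := contDiffAt_tangentCoord hfs (by simp) hinj v
    exact (h1.differentiableAt (by simp)).smul (h2.differentiableAt (by simp))
  have h1 := sum_fderiv_sqrt_det_mul (hfs.of_le (by exact ENat.LEInfty.out)) hinj hzd
  set g : M → EuclideanSpace ℝ (Fin N) := fun q ↦ h q • mvfderiv (𝓡 n) x q (gradField x v q) with hg
  have hgs : ContMDiff (𝓡 n) 𝓘(ℝ, EuclideanSpace ℝ (Fin N)) ∞ g :=
    hh.smul (contMDiff_mvfderiv_apply hx.smooth (contMDiff_gradField hx v))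
  have hgd (q : M) : MDifferentiableAt (𝓡 n) 𝓘(ℝ, EuclideanSpace ℝ (Fin N)) g q :=
    (hgs q).mdifferentiableAt (by simp)
  -- Pushed into the ambient space, the coordinate field `z` is `g`, so the coordinate divergence
  -- becomes the trace of the derivative of `g` against that of `x`.
  have h2 : fderiv ℝ (fun y ↦ fderiv ℝ f y (z y)) y = fderiv ℝ (g ∘ ψ) y := by
    refine Filter.EventuallyEq.fderiv_eq ?_
    filter_upwards [(isOpen_extChartAt_target p).mem_nhds hy] with y' hy'
    rw [hz, hg]
    simp only [map_smul, Function.comp_apply]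
    rw [gradField_chart hx v p hy', fderiv_embedding_chart hx p hy']
  rw [h2] at h1
  refine h1.trans ?_
  congr 1
  rw [mvfderiv_gradField_add_eq_sum hx b ht hm v ((hh _).mdifferentiableAt (by simp))]
  have h3 (α : Fin N) : mvfderiv (𝓡 n)
      (fun q ↦ h q * inner ℝ (gradField (n := n) x (b α) q) (gradField x v q)) (ψ y)
        (gradField x (b α) (ψ y))
      = ∑ i, ∑ j, (firstForm f y)⁻¹ i j * (inner ℝ (fderiv ℝ (g ∘ ψ) y (stdVec i)) (b α) *
        inner ℝ (b α) (fderiv ℝ f y (stdVec j))) := by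
    have h4 : (fun q ↦ h q * inner ℝ (gradField (n := n) x (b α) q) (gradField x v q))
        = fun q ↦ innerSL ℝ (b α) (g q) := funext fun q ↦ by
      rw [inner_gradField]
      simp [hg]
    rw [h4, mvfderiv_clm_comp _ (hgd _), gradField_chart hx _ p hy,
      ← fderiv_comp_chart_symm p hy (hgd _)]
    conv_lhs => rw [← sum_smul_stdVec (tangentCoord (x ∘ (extChartAt (𝓡 n) p).symm) (b α) y)]
    simp only [map_sum, map_smul, smul_eq_mul, innerSL_apply_apply, tangentCoord, Matrix.mulVec,
      dotProduct, Finset.sum_mul]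
    refine Finset.sum_congr rfl fun i _ ↦ Finset.sum_congr rfl fun j _ ↦ ?_
    rw [real_inner_comm (b α) (fderiv ℝ _ y (stdVec j)), real_inner_comm (b α)]
    exact (mul_assoc _ _ _).trans (congrArg _ (mul_comm _ _))
  rw [Finset.sum_congr rfl fun α _ ↦ h3 α]
  symm
  rw [Finset.sum_comm]
  refine Finset.sum_congr rfl fun i _ ↦ ?_
  rw [Finset.sum_comm]
  refine Finset.sum_congr rfl fun j _ ↦ ?_
  rw [← Finset.mul_sum, b.sum_inner_mul_inner]

end MeanCurvature

end DiracEigenvalues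

namespace DiracEigenvalues

open scoped Topology

/-! ### The Riemannian volume measure. -/

section Volume

/-- Expresses the density as the volume factor of a linear map; its multiplicativity then yields the
transformation rule under a change of charts. -/
lemma sqrt_det_firstForm {n : ℕ} {Y : Type*} [NormedAddCommGroup Y] [InnerProductSpace ℝ Y]
    (f : EuclideanSpace ℝ (Fin n) → Y) (y : EuclideanSpace ℝ (Fin n)) :
    √(firstForm f y).det = (fderiv ℝ f y).toLinearMap.normDet := by
  have h := (fderiv ℝ f y).toLinearMap.normDet_sq_eq_det_gram (EuclideanSpace.basisFun (Fin n) ℝ)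
  rw [← Real.sqrt_sq (LinearMap.normDet_nonneg _)]
  congr 1
  refine Eq.trans ?_ h.symm
  simp [firstForm]

variable {n N : ℕ} {M : Type*} [TopologicalSpace M] [ChartedSpace (EuclideanSpace ℝ (Fin n)) M]
  [IsManifold (𝓡 n) ∞ M] [RiemannianBundle (fun x : M ↦ TangentSpace (𝓡 n) x)]
  {x : M → EuclideanSpace ℝ (Fin N)} (hx : IsIsometricEmbedding (n := n) x)

include hx

lemma gramMatrix_eq_firstForm (p : M) {y : EuclideanSpace ℝ (Fin n)}
    (hy : y ∈ (extChartAt (𝓡 n) p).target) :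
    gramMatrix p y = firstForm (x ∘ (extChartAt (𝓡 n) p).symm) y := by
  ext i j
  rw [firstForm, Matrix.gram_apply, fderiv_embedding_chart hx p hy, fderiv_embedding_chart hx p hy,
    hx.inner_mvfderiv]
  rfl

lemma continuousOn_sqrt_det_gramMatrix (p : M) :
    ContinuousOn (fun y ↦ √(gramMatrix p y).det) (extChartAt (𝓡 n) p).target := by
  have h : ContinuousOn (fun y ↦ √(firstForm (x ∘ (extChartAt (𝓡 n) p).symm) y).det)
      (extChartAt (𝓡 n) p).target := fun y hy ↦ ContDiffAt.continuousAt (𝕜 := ℝ) (n := ∞)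
    (contDiffAt_sqrt_det_firstForm (contDiffAt_embedding_chart hx p hy) (by simp)
      (injective_fderiv_chart hx p hy)) |>.continuousWithinAt
  exact h.congr fun y hy ↦ by rw [gramMatrix_eq_firstForm hx p hy]

/-- Transformation of the volume density under a change of charts. -/
lemma sqrt_det_gramMatrix_eq (p q : M) {y : EuclideanSpace ℝ (Fin n)}
    (hy : y ∈ (extChartAt (𝓡 n) p).target)
    (hyq : (extChartAt (𝓡 n) p).symm y ∈ (extChartAt (𝓡 n) q).source) :
    √(gramMatrix p y).det
      = |(fderiv ℝ (extChartAt (𝓡 n) q ∘ (extChartAt (𝓡 n) p).symm) y).det| *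
        √(gramMatrix q (extChartAt (𝓡 n) q ((extChartAt (𝓡 n) p).symm y))).det := by
  set T := extChartAt (𝓡 n) q ∘ (extChartAt (𝓡 n) p).symm with hT
  have hTy : T y ∈ (extChartAt (𝓡 n) q).target := (extChartAt (𝓡 n) q).map_source hyq
  have hTd : DifferentiableAt ℝ T y :=
    ((contDiffAt_comp_chart_symm p hy (contMDiffAt_extChartAt' (by
      rwa [extChartAt_source] at hyq))).differentiableAt (by simp))
  change _ = |(fderiv ℝ T y).det| * √(gramMatrix q (T y)).det
  rw [gramMatrix_eq_firstForm hx p hy, gramMatrix_eq_firstForm hx q hTy, sqrt_det_firstForm,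
    sqrt_det_firstForm]
  have h1 : fderiv ℝ (x ∘ (extChartAt (𝓡 n) p).symm) y
      = (fderiv ℝ (x ∘ (extChartAt (𝓡 n) q).symm) (T y)).comp (fderiv ℝ T y) := by
    rw [← fderiv_comp y ((contDiffAt_embedding_chart hx q hTy).differentiableAt (by simp)) hTd]
    refine Filter.EventuallyEq.fderiv_eq ?_
    have h2 : (extChartAt (𝓡 n) p).symm ⁻¹' (extChartAt (𝓡 n) q).source ∈ 𝓝 y :=
      (continuousAt_extChartAt_symm'' hy).preimage_mem_nhds
        ((isOpen_extChartAt_source q).mem_nhds hyq)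
    filter_upwards [h2] with y' hy'
    simp only [hT, Function.comp_apply]
    rw [(extChartAt (𝓡 n) q).left_inv hy']
  have h3 := LinearMap.normDet_comp_of_finrank_eq (fderiv ℝ T y).toLinearMap
    (fderiv ℝ (x ∘ (extChartAt (𝓡 n) q).symm) (T y)).toLinearMap rfl
  rw [h1]
  refine h3.trans ?_
  rw [LinearMap.normDet_eq_norm_det, mul_comm]
  rfl

variable [MeasurableSpace M] [BorelSpace M]

lemma aemeasurable_chart_symm (p : M) :
    AEMeasurable (extChartAt (𝓡 n) p).symm (volume.restrict (extChartAt (𝓡 n) p).target) :=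
  (continuousOn_extChartAt_symm p).aemeasurable (isOpen_extChartAt_target p).measurableSet

lemma aemeasurable_density (p : M) :
    AEMeasurable (fun y ↦ ENNReal.ofReal (√(gramMatrix p y).det))
      (volume.restrict (extChartAt (𝓡 n) p).target) :=
  ((continuousOn_sqrt_det_gramMatrix hx p).aemeasurable
    (isOpen_extChartAt_target p).measurableSet).ennreal_ofReal

lemma chartVolume_apply (p : M) {A : Set M} (hA : MeasurableSet A) :
    chartVolume (n := n) p A
      = ∫⁻ y in (extChartAt (𝓡 n) p).target ∩ (extChartAt (𝓡 n) p).symm ⁻¹' A,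
        ENNReal.ofReal (√(gramMatrix p y).det) := by
  have h1 : AEMeasurable (extChartAt (𝓡 n) p).symm ((volume.restrict
      (extChartAt (𝓡 n) p).target).withDensity fun y ↦ ENNReal.ofReal (√(gramMatrix p y).det)) :=
    (aemeasurable_chart_symm hx p).mono_ac (withDensity_absolutelyContinuous _ _)
  have h2 : NullMeasurableSet ((extChartAt (𝓡 n) p).symm ⁻¹' A)
      (volume.restrict (extChartAt (𝓡 n) p).target) :=
    (aemeasurable_chart_symm hx p).nullMeasurable hA
  rw [chartVolume, Measure.map_apply_of_aemeasurable h1 hA, withDensity_apply₀ _ h2,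
    Measure.restrict_restrict₀ h2, Set.inter_comm]

lemma measurableSet_target_inter (p : M) {A : Set M} (hA : MeasurableSet A) :
    MeasurableSet ((extChartAt (𝓡 n) p).target ∩ (extChartAt (𝓡 n) p).symm ⁻¹' A) := by
  have ho := (isOpen_extChartAt_target (I := 𝓡 n) p).measurableSet
  have hc : Continuous fun y : (extChartAt (𝓡 n) p).target ↦ (extChartAt (𝓡 n) p).symm y :=
    continuousOn_iff_continuous_domRestrict.1 (continuousOn_extChartAt_symm p)
  convert ho.subtype_image (hc.measurable hA) using 1
  ext y
  simp [and_comm]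

lemma chartVolume_compl_source (p : M) :
    chartVolume (n := n) p (extChartAt (𝓡 n) p).sourceᶜ = 0 := by
  rw [chartVolume_apply hx p (isOpen_extChartAt_source p).measurableSet.compl]
  have : (extChartAt (𝓡 n) p).target ∩ (extChartAt (𝓡 n) p).symm ⁻¹' (extChartAt (𝓡 n) p).sourceᶜ
      = ∅ := by
    ext y
    simp only [Set.mem_inter_iff, Set.mem_preimage, Set.mem_compl_iff, Set.mem_empty_iff_false,
      iff_false, not_and, not_not]
    exact fun hy ↦ (extChartAt (𝓡 n) p).map_target hy
  rw [this]
  simp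

/-- Change of variables along the transition map, whose Jacobian is the ratio of the two densities.
-/
lemma chartVolume_eq_of_subset (p q : M) {A : Set M} (hA : MeasurableSet A)
    (hp : A ⊆ (extChartAt (𝓡 n) p).source) (hq : A ⊆ (extChartAt (𝓡 n) q).source) :
    chartVolume (n := n) p A = chartVolume (n := n) q A := by
  rw [chartVolume_apply hx p hA, chartVolume_apply hx q hA]
  set s := (extChartAt (𝓡 n) p).target ∩ (extChartAt (𝓡 n) p).symm ⁻¹' A with hs
  set T := extChartAt (𝓡 n) q ∘ (extChartAt (𝓡 n) p).symm with hT
  have himg : (extChartAt (𝓡 n) q).target ∩ (extChartAt (𝓡 n) q).symm ⁻¹' A = T '' s := by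
    ext z
    constructor
    · rintro ⟨hz, hzA⟩
      refine ⟨extChartAt (𝓡 n) p ((extChartAt (𝓡 n) q).symm z),
        ⟨(extChartAt (𝓡 n) p).map_source (hp hzA), ?_⟩, ?_⟩
      · rw [Set.mem_preimage, (extChartAt (𝓡 n) p).left_inv (hp hzA)]
        exact hzA
      · rw [hT, Function.comp_apply, (extChartAt (𝓡 n) p).left_inv (hp hzA),
          (extChartAt (𝓡 n) q).right_inv hz]
    · rintro ⟨y, ⟨hy, hyA⟩, rfl⟩
      refine ⟨(extChartAt (𝓡 n) q).map_source (hq hyA), ?_⟩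
      rw [Set.mem_preimage, hT, Function.comp_apply, (extChartAt (𝓡 n) q).left_inv (hq hyA)]
      exact hyA
  have hTd : ∀ y ∈ s, HasFDerivWithinAt T (fderiv ℝ T y) s y := fun y hy ↦
    ((contDiffAt_comp_chart_symm p hy.1 (contMDiffAt_extChartAt' (by
      rw [← extChartAt_source (𝓡 n)]
      exact hq hy.2))).differentiableAt (by simp)).hasFDerivAt.hasFDerivWithinAt
  have hinj : Set.InjOn T s := by
    intro y hy z hz h
    exact (extChartAt (𝓡 n) p).symm.injOn hy.1 hz.1
      ((extChartAt (𝓡 n) q).injOn (hq hy.2) (hq hz.2) h)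
  rw [himg, lintegral_image_eq_lintegral_abs_det_fderiv_mul volume
    (measurableSet_target_inter hx p hA) hTd hinj]
  refine setLIntegral_congr_fun (measurableSet_target_inter hx p hA) fun y hy ↦ ?_
  rw [← ENNReal.ofReal_mul (abs_nonneg _), sqrt_det_gramMatrix_eq hx p q hy.1 (hq hy.2)]
  rfl

lemma chartVolume_le_riemannianVolume (p : M) :
    chartVolume (n := n) p ≤ riemannianVolume (n := n) M :=
  le_iSup (fun p : M ↦ chartVolume (n := n) p) p

lemma riemannianVolume_apply_of_subset (p : M) {A : Set M} (hA : MeasurableSet A)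
    (hp : A ⊆ (extChartAt (𝓡 n) p).source) :
    riemannianVolume (n := n) M A = chartVolume (n := n) p A := by
  have hop (q : M) : MeasurableSet (extChartAt (𝓡 n) q).source :=
    (isOpen_extChartAt_source q).measurableSet
  -- The supremum is bounded by exhibiting one measure above all chart volumes: inside the chart at
  -- `p` they are dominated by `chartVolume p`, outside by the supremum itself. The second summand
  -- vanishes on `A`.
  have h1 : riemannianVolume (n := n) M ≤ chartVolume (n := n) p
      + (riemannianVolume (n := n) M).restrict (extChartAt (𝓡 n) p).sourceᶜ := by
    refine iSup_le fun q ↦ Measure.le_iff.2 fun C hC ↦ ?_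
    rw [← measure_inter_add_sdiff C (hop p), Measure.add_apply,
      Measure.restrict_apply hC]
    refine add_le_add ?_ (chartVolume_le_riemannianVolume hx q _)
    have h2 : chartVolume (n := n) q (C ∩ (extChartAt (𝓡 n) p).source)
        = chartVolume (n := n) q
          (C ∩ (extChartAt (𝓡 n) p).source ∩ (extChartAt (𝓡 n) q).source) := by
      rw [← measure_inter_add_sdiff (C ∩ _) (hop q),
        measure_mono_null (Set.sdiff_subset_compl _ _) (chartVolume_compl_source hx q), add_zero]
    rw [h2, chartVolume_eq_of_subset hx q p ((hC.inter (hop p)).inter (hop q))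
      Set.inter_subset_right (Set.inter_subset_left.trans Set.inter_subset_right)]
    exact measure_mono (Set.inter_subset_left.trans Set.inter_subset_left)
  refine le_antisymm ?_ (chartVolume_le_riemannianVolume hx p A)
  refine (h1 A).trans ?_
  rw [Measure.add_apply, Measure.restrict_apply hA, ← Set.sdiff_eq, Set.sdiff_eq_empty.2 hp]
  simp

lemma restrict_riemannianVolume (p : M) :
    (riemannianVolume (n := n) M).restrict (extChartAt (𝓡 n) p).source
      = chartVolume (n := n) p := by
  have hop : MeasurableSet (extChartAt (𝓡 n) p).source :=
    (isOpen_extChartAt_source p).measurableSet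
  ext A hA
  rw [Measure.restrict_apply hA, riemannianVolume_apply_of_subset hx p (hA.inter hop)
    Set.inter_subset_right, ← measure_inter_add_sdiff A hop,
    measure_mono_null (Set.sdiff_subset_compl _ _) (chartVolume_compl_source hx p), add_zero]

/-- The density is bounded on a compact neighbourhood in each chart, so the measure is locally
finite, hence finite on a compact space. -/
lemma isFiniteMeasure_riemannianVolume [CompactSpace M] :
    IsFiniteMeasure (riemannianVolume (n := n) M) := by
  have h : IsLocallyFiniteMeasure (riemannianVolume (n := n) M) := by
    refine ⟨fun p ↦ ?_⟩
    obtain ⟨K, hK, hKn, hKc⟩ := local_compact_nhds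
      ((isOpen_extChartAt_target (I := 𝓡 n) p).mem_nhds (mem_extChartAt_target p))
    obtain ⟨C, hC⟩ := hKc.exists_bound_of_continuousOn
      ((continuousOn_sqrt_det_gramMatrix hx p).mono hKn)
    set U := (extChartAt (𝓡 n) p).source ∩ extChartAt (𝓡 n) p ⁻¹' interior K with hU
    have hUo : IsOpen U :=
      (continuousOn_extChartAt p).isOpen_inter_preimage (isOpen_extChartAt_source p) isOpen_interior
    refine ⟨U, hUo.mem_nhds ⟨mem_extChartAt_source p, mem_interior_iff_mem_nhds.2 hK⟩, ?_⟩
    rw [riemannianVolume_apply_of_subset hx p hUo.measurableSet Set.inter_subset_left,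
      chartVolume_apply hx p hUo.measurableSet]
    have hsub : (extChartAt (𝓡 n) p).target ∩ (extChartAt (𝓡 n) p).symm ⁻¹' U ⊆ K := by
      rintro y ⟨hy, hyU⟩
      have := hyU.2
      rw [Set.mem_preimage, (extChartAt (𝓡 n) p).right_inv hy] at this
      exact interior_subset this
    refine (setLIntegral_lt_top_of_le_nnreal (ne_top_of_le_ne_top hKc.measure_lt_top.ne
      (measure_mono hsub)) ⟨C.toNNReal, fun y hy ↦ ?_⟩)
    exact ENNReal.ofReal_le_ofReal ((Real.le_norm_self _).trans (hC y (hsub hy)))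
  exact CompactSpace.isFiniteMeasure

lemma integral_riemannianVolume_eq [CompactSpace M] (p : M) {g : M → ℝ} (hg : Continuous g)
    (hgs : Function.support g ⊆ (extChartAt (𝓡 n) p).source) :
    ∫ q, g q ∂(riemannianVolume (n := n) M)
      = ∫ y in (extChartAt (𝓡 n) p).target,
        √(gramMatrix p y).det * g ((extChartAt (𝓡 n) p).symm y) := by
  have h1 : AEMeasurable (extChartAt (𝓡 n) p).symm ((volume.restrict
      (extChartAt (𝓡 n) p).target).withDensity fun y ↦ ENNReal.ofReal (√(gramMatrix p y).det)) :=
    (aemeasurable_chart_symm hx p).mono_ac (withDensity_absolutelyContinuous _ _)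
  rw [← setIntegral_eq_integral_of_forall_compl_eq_zero (s := (extChartAt (𝓡 n) p).source),
    restrict_riemannianVolume hx p, chartVolume, integral_map h1 hg.aestronglyMeasurable,
    integral_withDensity_eq_integral_toReal_smul₀ (aemeasurable_density hx p) (by simp)]
  · simp only [smul_eq_mul, ENNReal.toReal_ofReal (Real.sqrt_nonneg _)]
  · intro q hq
    by_contra h
    exact hq (hgs h)

end Volume

end DiracEigenvalues

namespace DiracEigenvalues

open scoped Topology

/-! ### The divergence theorem. -/

lemma integral_fderiv_eq_zero {E : Type*} [NormedAddCommGroup E] [InnerProductSpace ℝ E]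
    [FiniteDimensional ℝ E] [MeasurableSpace E] [BorelSpace E] {f : E → ℝ}
    (hf : ContDiff ℝ 1 f) (hc : HasCompactSupport f) (v : E) : ∫ y, fderiv ℝ f y v = 0 := by
  have hf' : Continuous fun y ↦ fderiv ℝ f y v := by fun_prop
  have h1 : Integrable fun y ↦ fderiv ℝ f y v :=
    hf'.integrable_of_hasCompactSupport (hc.fderiv_apply ℝ v)
  have h2 : Integrable f := hf.continuous.integrable_of_hasCompactSupport hc
  -- Integration by parts against the constant 1.
  have h3 := integral_mul_fderiv_eq_neg_fderiv_mul_of_integrable (μ := volume) (f := f)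
    (g := fun _ ↦ (1 : ℝ)) (v := v) (by simpa using h1) (by simp) (by simpa using h2)
    (fun y _ ↦ hf.differentiable one_ne_zero y) (fun y _ ↦ differentiableAt_const _)
  simpa using h3

section Divergence

variable {n N : ℕ} {M : Type*} [TopologicalSpace M] [T2Space M] [CompactSpace M]
  [ChartedSpace (EuclideanSpace ℝ (Fin n)) M]
  [IsManifold (𝓡 n) ∞ M] [RiemannianBundle (fun x : M ↦ TangentSpace (𝓡 n) x)]
  [IsContMDiffRiemannianBundle (𝓡 n) ∞ (EuclideanSpace ℝ (Fin n))
    (fun x : M ↦ TangentSpace (𝓡 n) x)]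
  [MeasurableSpace M] [BorelSpace M]
  {lc : CovariantDerivative (𝓡 n) (EuclideanSpace ℝ (Fin n)) (TangentSpace (𝓡 n) : M → Type _)}
  {x : M → EuclideanSpace ℝ (Fin N)} (hx : IsIsometricEmbedding (n := n) x)

include hx

lemma integrable_of_continuous {Y : Type*} [NormedAddCommGroup Y] [SecondCountableTopology Y]
    {g : M → Y} (hg : Continuous g) : Integrable g (riemannianVolume (n := n) M) := by
  have := isFiniteMeasure_riemannianVolume hx
  obtain ⟨C, hC⟩ := isCompact_univ.exists_bound_of_continuousOn hg.continuousOn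
  exact Integrable.of_bound hg.aestronglyMeasurable C (.of_forall fun p ↦ hC p trivial)

lemma contMDiff_divergence (hs : CovariantDerivative.ContMDiffCovariantDerivative lc ∞)
    (v : EuclideanSpace ℝ (Fin N)) {h : M → ℝ} (hh : ContMDiff (𝓡 n) 𝓘(ℝ, ℝ) ∞ h) :
    ContMDiff (𝓡 n) 𝓘(ℝ, ℝ) ∞ fun p ↦
      mvfderiv (𝓡 n) h p (gradField x v p) + h p * coordLaplacian lc x v p :=
  (contMDiff_mvfderiv_apply hh (contMDiff_gradField hx v)).add
    (hh.mul (contMDiff_coordLaplacian hx hs v))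

lemma integral_divergence_of_tsupport_subset
    (hs : CovariantDerivative.ContMDiffCovariantDerivative lc ∞) (ht : lc.torsion = 0)
    (hm : lc.IsMetricCompatible) (v : EuclideanSpace ℝ (Fin N)) {h : M → ℝ}
    (hh : ContMDiff (𝓡 n) 𝓘(ℝ, ℝ) ∞ h) (p : M)
    (hp : tsupport h ⊆ (extChartAt (𝓡 n) p).source) :
    ∫ q, (mvfderiv (𝓡 n) h q (gradField x v q) + h q * coordLaplacian lc x v q)
      ∂(riemannianVolume (n := n) M) = 0 := by
  have hzero (q : M) (hq : q ∉ tsupport h) :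
      mvfderiv (𝓡 n) h q (gradField x v q) + h q * coordLaplacian lc x v q = 0 := by
    have h0 : h =ᶠ[𝓝 q] fun _ ↦ 0 := notMem_tsupport_iff_eventuallyEq.1 hq
    have h1 : mvfderiv (𝓡 n) h q = 0 := by
      have := h0.mfderiv_eq (I := 𝓡 n) (I' := 𝓘(ℝ, ℝ))
      rw [mfderiv_const] at this
      exact this
    rw [h1, image_eq_zero_of_notMem_tsupport hq, zero_mul, add_zero]
    rfl
  rw [integral_riemannianVolume_eq hx p (contMDiff_divergence hx hs v hh).continuous
    (fun q hq ↦ hp (by_contra fun h ↦ hq (hzero q h)))]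
  set ψ := (extChartAt (𝓡 n) p).symm with hψ
  set f := x ∘ ψ with hf
  set K := extChartAt (𝓡 n) p '' tsupport h with hK
  have hKc : IsCompact K :=
    (isClosed_tsupport h).isCompact.image_of_continuousOn ((continuousOn_extChartAt p).mono hp)
  have hKt : K ⊆ (extChartAt (𝓡 n) p).target := by
    rintro _ ⟨q, hq, rfl⟩
    exact (extChartAt (𝓡 n) p).map_source (hp hq)
  have hψK {y : EuclideanSpace ℝ (Fin n)} (hy : y ∈ (extChartAt (𝓡 n) p).target) (hyK : y ∉ K) :
      ψ y ∉ tsupport h := fun hy' ↦ hyK ⟨ψ y, hy', (extChartAt (𝓡 n) p).right_inv hy⟩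
  set w : Fin n → EuclideanSpace ℝ (Fin n) → ℝ := fun i y ↦
    √(firstForm f y).det * (h (ψ y) * tangentCoord f v y i) with hw
  -- Extension by zero to all of Euclidean space. It remains C¹ because `w i` vanishes on the chart
  -- target outside the compact set `K`, which lies inside that open target.
  set W : Fin n → EuclideanSpace ℝ (Fin n) → ℝ := fun i ↦
    (extChartAt (𝓡 n) p).target.indicator (w i) with hW
  have hWw (i : Fin n) {y : EuclideanSpace ℝ (Fin n)} (hy : y ∈ (extChartAt (𝓡 n) p).target) :
      W i =ᶠ[𝓝 y] w i := by
    filter_upwards [(isOpen_extChartAt_target (I := 𝓡 n) p).mem_nhds hy] with z hz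
    exact Set.indicator_of_mem hz _
  have hW0 (i : Fin n) (y : EuclideanSpace ℝ (Fin n)) (hy : y ∉ K) : W i y = 0 := by
    by_cases hyt : y ∈ (extChartAt (𝓡 n) p).target
    · refine (Set.indicator_of_mem hyt _).trans ?_
      simp [hw, image_eq_zero_of_notMem_tsupport (hψK hyt hy)]
    · exact Set.indicator_of_notMem hyt _
  have hWs (i : Fin n) : HasCompactSupport (W i) := HasCompactSupport.intro hKc (hW0 i)
  have hW0' (i : Fin n) {y : EuclideanSpace ℝ (Fin n)} (hy : y ∉ K) : W i =ᶠ[𝓝 y] fun _ ↦ 0 := by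
    filter_upwards [hKc.isClosed.isOpen_compl.mem_nhds hy] with z hz
    exact hW0 i z hz
  have hWd (i : Fin n) : ContDiff ℝ 1 (W i) := by
    rw [contDiff_iff_contDiffAt]
    intro y
    by_cases hyt : y ∈ (extChartAt (𝓡 n) p).target
    · refine ContDiffAt.congr_of_eventuallyEq ?_ (hWw i hyt)
      have hinj : Function.Injective (fderiv ℝ f y) := injective_fderiv_chart hx p hyt
      have hfs : ContDiffAt ℝ ∞ f y := contDiffAt_embedding_chart hx p hyt
      have h1 : ContDiffAt ℝ ∞ (fun y ↦ √(firstForm f y).det) y :=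
        contDiffAt_sqrt_det_firstForm hfs (by simp) hinj
      have h2 : ContDiffAt ℝ ∞ (h ∘ ψ) y := contDiffAt_comp_chart_symm p hyt (hh _)
      have h3 : ContDiffAt ℝ ∞ (tangentCoord f v) y := contDiffAt_tangentCoord hfs (by simp) hinj v
      have h4 : ContDiffAt ℝ ∞ (fun y ↦ tangentCoord f v y i) y :=
        (contDiffAt_euclidean.1 h3) i
      exact (h1.mul (h2.mul h4)).of_le (by exact ENat.LEInfty.out)
    · exact contDiffAt_const.congr_of_eventuallyEq (hW0' i fun hy ↦ hyt (hKt hy))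
  have h1 : ∫ y, ∑ i, fderiv ℝ (W i) y (stdVec i) = 0 := by
    rw [integral_finsetSum]
    · exact Finset.sum_eq_zero fun i _ ↦ integral_fderiv_eq_zero (hWd i) (hWs i) _
    · intro i _
      have hc : Continuous fun y ↦ fderiv ℝ (W i) y (stdVec i) := by
        have := hWd i
        fun_prop
      exact hc.integrable_of_hasCompactSupport
        ((hWs i).fderiv_apply ℝ (stdVec i))
  rw [← h1, ← setIntegral_eq_integral_of_forall_compl_eq_zero (s := (extChartAt (𝓡 n) p).target)
    (f := fun y ↦ ∑ i, fderiv ℝ (W i) y (stdVec i))]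
  · refine setIntegral_congr_fun (isOpen_extChartAt_target p).measurableSet fun y hy ↦ ?_
    rw [gramMatrix_eq_firstForm hx p hy, ← sum_fderiv_chart_eq hx ht hm hh v p hy]
    exact Finset.sum_congr rfl fun i _ ↦ by rw [(hWw i hy).fderiv_eq]
  · intro y hy
    refine Finset.sum_eq_zero fun i _ ↦ ?_
    rw [(hW0' i fun hyK ↦ hy (hKt hyK)).fderiv_eq]
    simp

/-- The divergence theorem for the vector field `h ∇⟨v, x⟩`. -/
theorem integral_divergence
    (hs : CovariantDerivative.ContMDiffCovariantDerivative lc ∞) (ht : lc.torsion = 0)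
    (hm : lc.IsMetricCompatible) (v : EuclideanSpace ℝ (Fin N)) {h : M → ℝ}
    (hh : ContMDiff (𝓡 n) 𝓘(ℝ, ℝ) ∞ h) :
    ∫ q, (mvfderiv (𝓡 n) h q (gradField x v q) + h q * coordLaplacian lc x v q)
      ∂(riemannianVolume (n := n) M) = 0 := by
  obtain ⟨t, ht'⟩ := isCompact_univ.elim_finite_subcover (fun p : M ↦ (extChartAt (𝓡 n) p).source)
    (fun p ↦ isOpen_extChartAt_source p)
    (fun p _ ↦ Set.mem_iUnion.2 ⟨p, mem_extChartAt_source p⟩)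
  obtain ⟨ρ, hρ⟩ := SmoothPartitionOfUnity.exists_isSubordinate (𝓡 n) (s := (Set.univ : Set M))
    isClosed_univ (fun p : t ↦ (extChartAt (𝓡 n) p.1).source)
    (fun p ↦ isOpen_extChartAt_source p.1) (by simpa [Set.iUnion_subtype] using ht')
  have hρs (i : t) : ContMDiff (𝓡 n) 𝓘(ℝ, ℝ) ∞ (fun q ↦ ρ i q * h q) := (ρ i).contMDiff.mul hh
  -- The integrand is linear in `h`, so a partition of unity reduces to functions supported in one
  -- chart.
  have hsum : h = fun q ↦ ∑ i, ρ i q * h q := funext fun q ↦ by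
    rw [← Finset.sum_mul, ← finsum_eq_sum_of_fintype, ρ.sum_eq_one (Set.mem_univ q), one_mul]
  have h1 (q : M) : mvfderiv (𝓡 n) h q (gradField x v q) + h q * coordLaplacian lc x v q
      = ∑ i, (mvfderiv (𝓡 n) (fun q ↦ ρ i q * h q) q (gradField x v q)
        + (ρ i q * h q) * coordLaplacian lc x v q) := by
    rw [Finset.sum_add_distrib, ← Finset.sum_mul, ← mvfderiv_fun_sum _
      (fun i ↦ (hρs i q).mdifferentiableAt (by simp)), ← hsum, ← congrFun hsum q]
  simp only [h1]
  rw [integral_finsetSum _ fun i _ ↦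
    integrable_of_continuous hx (contMDiff_divergence hx hs v (hρs i)).continuous]
  refine Finset.sum_eq_zero fun i _ ↦ integral_divergence_of_tsupport_subset hx hs ht hm v (hρs i)
    i.1 ((tsupport_mul_subset_left).trans (hρ i))

end Divergence

end DiracEigenvalues

namespace DiracEigenvalues

/-! ### Clifford algebra in a single fiber -/

section Clifford

variable {V A : Type*} [NormedAddCommGroup V] [InnerProductSpace ℝ V] [AddCommGroup A] [Module ℝ A]
  {c : V →ₗ[ℝ] A →ₗ[ℝ] A} (hc : ∀ v s, c v (c v s) = -(‖v‖ ^ 2 • s))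

include hc

/-- Polarisation of the Clifford relation. -/
lemma clifford_anticomm (u w : V) (s : A) :
    c u (c w s) + c w (c u s) = -((2 * inner ℝ u w) • s) := by
  have h := hc (u + w) s
  simp only [map_add, LinearMap.add_apply, hc u s, hc w s, norm_add_sq_real] at h
  linear_combination (norm := module) h

/-- Splitting of a Clifford trace into its symmetric and antisymmetric part. -/
lemma sum_clifford_clifford {m : ℕ} (e : OrthonormalBasis (Fin m) ℝ V) (H : Fin m → Fin m → A) :
    ∑ i, ∑ j, c (e i) (c (e j) (H i j))
      = -∑ i, H i i + ∑ i, ∑ j ∈ Finset.Ioi i, c (e i) (c (e j) (H i j - H j i)) := by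
  have h1 (i : Fin m) : ∑ j, c (e i) (c (e j) (H i j))
      = -H i i + (∑ j ∈ Finset.Ioi i, c (e i) (c (e j) (H i j))
        + ∑ j ∈ Finset.Iio i, c (e i) (c (e j) (H i j))) := by
    have h2 : (Finset.univ : Finset (Fin m)) = insert i (Finset.Ioi i ∪ Finset.Iio i) := by
      ext j
      simp only [Finset.mem_univ, Finset.mem_insert, Finset.mem_union, Finset.mem_Ioi,
        Finset.mem_Iio, true_iff]
      omega
    rw [h2, Finset.sum_insert (by simp), Finset.sum_union, hc]
    · simp
    · rw [Finset.disjoint_left]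
      intro j hj
      simp only [Finset.mem_Ioi, Finset.mem_Iio] at hj ⊢
      omega
  have h3 : ∑ i, ∑ j ∈ Finset.Iio i, c (e i) (c (e j) (H i j))
      = ∑ i, ∑ j ∈ Finset.Ioi i, c (e j) (c (e i) (H j i)) :=
    Finset.sum_comm' (by simp)
  rw [Finset.sum_congr rfl fun i _ ↦ h1 i, Finset.sum_add_distrib, Finset.sum_neg_distrib,
    Finset.sum_add_distrib, h3, ← Finset.sum_add_distrib]
  congr 1
  refine Finset.sum_congr rfl fun i _ ↦ ?_
  rw [← Finset.sum_add_distrib]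
  refine Finset.sum_congr rfl fun j hj ↦ ?_
  have h4 := clifford_anticomm hc (e i) (e j) (H j i)
  rw [e.inner_eq_zero (ne_of_lt (Finset.mem_Ioi.1 hj)), mul_zero, zero_smul, neg_zero] at h4
  rw [map_sub, map_sub]
  linear_combination (norm := module) h4

/-- For a symmetric map the antisymmetric part of the Clifford trace disappears and only the trace
is left. Applied to Hessians, this produces the Laplacian. -/
lemma sum_clifford_clifford_symm {m : ℕ} (e : OrthonormalBasis (Fin m) ℝ V) (L : V →ₗ[ℝ] V)
    (hL : ∀ u w, inner ℝ (L u) w = inner ℝ (L w) u) (s : A) :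
    ∑ i, c (e i) (c (L (e i)) s) = -((∑ i, inner ℝ (L (e i)) (e i)) • s) := by
  have h1 (i : Fin m) : c (e i) (c (L (e i)) s)
      = ∑ j, c (e i) (c (e j) (inner ℝ (L (e i)) (e j) • s)) := by
    conv_lhs => rw [← e.sum_repr' (L (e i))]
    simp only [map_sum, map_smul, LinearMap.sum_apply, LinearMap.smul_apply, real_inner_comm]
  rw [Finset.sum_congr rfl fun i _ ↦ h1 i, sum_clifford_clifford hc, Finset.sum_smul,
    add_eq_left]
  refine Finset.sum_eq_zero fun i _ ↦ Finset.sum_eq_zero fun j _ ↦ ?_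
  rw [hL (e i) (e j), sub_self, map_zero, map_zero]

end Clifford

/-! ### Connections and second covariant derivatives. -/

section Connection

variable {n N : ℕ} {M : Type*} [TopologicalSpace M] [ChartedSpace (EuclideanSpace ℝ (Fin n)) M]
  [IsManifold (𝓡 n) ∞ M]
  {F : Type*} [NormedAddCommGroup F] [NormedSpace ℝ F] [FiniteDimensional ℝ F]
  {S : M → Type*} [TopologicalSpace (TotalSpace F S)] [∀ x, NormedAddCommGroup (S x)]
  [∀ x, InnerProductSpace ℝ (S x)] [FiberBundle F S] [VectorBundle ℝ F S]
  [ContMDiffVectorBundle ∞ F S (𝓡 n)]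
  {cov : CovariantDerivative (𝓡 n) F S}

variable (n F) in
/-- Sections that are differentiable at `p`. -/
abbrev DiffAt (σ : ∀ p, S p) (p : M) : Prop :=
  MDifferentiableAt (𝓡 n) ((𝓡 n).prod 𝓘(ℝ, F)) (fun q ↦ TotalSpace.mk' F q (σ q)) p

lemma IsSmooth.diffAt {σ : ∀ p, S p} (hσ : IsSmooth n F σ) (p : M) : DiffAt n F σ p :=
  (hσ p).mdifferentiableAt (by simp)

lemma conn_fun_smul {σ : ∀ p, S p} {f : M → ℝ} {p : M} (hσ : DiffAt n F σ p)
    (hf : MDifferentiableAt (𝓡 n) 𝓘(ℝ, ℝ) f p) (u : TangentSpace (𝓡 n) p) :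
    cov (fun q ↦ f q • σ q) p u = f p • cov σ p u + mvfderiv (𝓡 n) f p u • σ p := by
  have h := cov.isCovariantDerivativeOn.leibniz (x := p) hσ hf
  exact congrArg (fun L : TangentSpace (𝓡 n) p →L[ℝ] S p ↦ L u) h

lemma conn_fun_add {σ τ : ∀ p, S p} {p : M} (hσ : DiffAt n F σ p) (hτ : DiffAt n F τ p)
    (u : TangentSpace (𝓡 n) p) :
    cov (fun q ↦ σ q + τ q) p u = cov σ p u + cov τ p u := by
  have h := cov.isCovariantDerivativeOn.add (x := p) hσ hτ
  exact congrArg (fun L : TangentSpace (𝓡 n) p →L[ℝ] S p ↦ L u) h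

lemma conn_fun_sum {ι : Type*} (s : Finset ι) {σ : ι → ∀ p, S p} {p : M}
    (hσ : ∀ i, DiffAt n F (σ i) p) (u : TangentSpace (𝓡 n) p) :
    cov (fun q ↦ ∑ i ∈ s, σ i q) p u = ∑ i ∈ s, cov (σ i) p u := by
  classical
  induction s using Finset.induction_on with
  | empty =>
    simp only [Finset.sum_empty]
    have h := congrFun cov.zero p
    exact congrArg (fun L : TangentSpace (𝓡 n) p →L[ℝ] S p ↦ L u) h
  | insert i s hi ih =>
    simp only [Finset.sum_insert hi]
    have h : DiffAt n F (fun q ↦ ∑ i ∈ s, σ i q) p :=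
      MDifferentiableAt.sum_section fun i _ ↦ hσ i
    rw [conn_fun_add (hσ i) h, ih]

lemma IsSmooth.smul {σ : ∀ p, S p} {f : M → ℝ} (hσ : IsSmooth n F σ)
    (hf : ContMDiff (𝓡 n) 𝓘(ℝ, ℝ) ∞ f) : IsSmooth n F (fun q ↦ f q • σ q) :=
  hf.smul_section hσ

lemma IsSmooth.add {σ τ : ∀ p, S p} (hσ : IsSmooth n F σ) (hτ : IsSmooth n F τ) :
    IsSmooth n F (fun q ↦ σ q + τ q) := hσ.add_section hτ

lemma IsSmooth.sum {ι : Type*} {s : Finset ι} {σ : ι → ∀ p, S p} (hσ : ∀ i, IsSmooth n F (σ i)) :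
    IsSmooth n F (fun q ↦ ∑ i ∈ s, σ i q) := ContMDiff.sum_section fun i _ ↦ hσ i

lemma IsSmooth.conn {σ : ∀ p, S p} (hσ : IsSmooth n F σ)
    (hcov : CovariantDerivative.ContMDiffCovariantDerivative cov ∞)
    {U : ∀ p : M, TangentSpace (𝓡 n) p} (hU : IsSmoothField U) :
    IsSmooth n F (fun q ↦ cov σ q (U q)) := fun p ↦ isSmooth_conn_apply hcov hσ (hU p)

section Metric

variable [IsContMDiffRiemannianBundle (𝓡 n) ∞ F S]

instance instIsContMDiffRiemannianBundleOne : IsContMDiffRiemannianBundle (𝓡 n) 1 F S :=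
  IsContMDiffRiemannianBundle.of_le (n := (∞ : ℕ∞ω)) ENat.LEInfty.out

lemma mvfderiv_inner_section (hm : cov.IsMetricCompatible) {σ τ : ∀ p, S p} {p : M}
    (hσ : DiffAt n F σ p) (hτ : DiffAt n F τ p) (u : TangentSpace (𝓡 n) p) :
    mvfderiv (𝓡 n) (fun q ↦ inner ℝ (σ q) (τ q)) p u
      = inner ℝ (cov σ p u) (τ p) + inner ℝ (σ p) (cov τ p u) := by
  have := hm.mvfderiv_inner_eq (FiberBundle.extend (EuclideanSpace ℝ (Fin n)) u) hσ hτ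
  simpa using this

lemma IsSmooth.inner {σ τ : ∀ p, S p} (hσ : IsSmooth n F σ) (hτ : IsSmooth n F τ) :
    ContMDiff (𝓡 n) 𝓘(ℝ, ℝ) ∞ (fun q ↦ inner ℝ (σ q) (τ q)) :=
  ContMDiff.inner_bundle hσ hτ

end Metric

variable [RiemannianBundle (fun x : M ↦ TangentSpace (𝓡 n) x)]
  [IsContMDiffRiemannianBundle (𝓡 n) ∞ (EuclideanSpace ℝ (Fin n))
    (fun x : M ↦ TangentSpace (𝓡 n) x)]
  {lc : CovariantDerivative (𝓡 n) (EuclideanSpace ℝ (Fin n)) (TangentSpace (𝓡 n) : M → Type _)}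
  {x : M → EuclideanSpace ℝ (Fin N)} (hx : IsIsometricEmbedding (n := n) x)
  {ι : Type*} [Fintype ι] (b : OrthonormalBasis ι ℝ (EuclideanSpace ℝ (Fin N)))

/-- The second covariant derivative of a section. -/
def secondDeriv (cov : CovariantDerivative (𝓡 n) F S) (x : M → EuclideanSpace ℝ (Fin N))
    (b : OrthonormalBasis ι ℝ (EuclideanSpace ℝ (Fin N)))
    (σ : ∀ p, S p) (p : M) (u w : TangentSpace (𝓡 n) p) : S p :=
  ∑ β, inner ℝ (gradField x (b β) p) w •
    cov (fun q ↦ cov σ q (gradField x (b β) q)) p u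

include hx

/-- Expand `V` in the fields Z_β and apply the product rule; the contribution of ∇_u Z_β drops out.
This identifies `secondDeriv` with the usual second covariant derivative, which depends on `V` only
through its value at `p`. -/
lemma conn_conn_apply (ht : lc.torsion = 0) (hm : lc.IsMetricCompatible)
    (hcov : CovariantDerivative.ContMDiffCovariantDerivative cov ∞)
    {σ : ∀ p, S p} (hσ : IsSmooth n F σ) {V : ∀ p : M, TangentSpace (𝓡 n) p} {p : M}
    (hV : DiffAt n (EuclideanSpace ℝ (Fin n)) V p) (u : TangentSpace (𝓡 n) p) :
    cov (fun q ↦ cov σ q (V q)) p u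
      = secondDeriv cov x b σ p u (V p) + cov σ p (lc V p u) := by
  have hZ (β : ι) : IsSmoothField (gradField (n := n) x (b β)) := contMDiff_gradField hx _
  have h1 : (fun q ↦ cov σ q (V q)) = fun q ↦ ∑ β,
      inner ℝ (gradField x (b β) q) (V q) • cov σ q (gradField x (b β) q) := funext fun q ↦ by
    conv_lhs => rw [← sum_inner_smul_gradField hx b q (V q)]
    simp only [map_sum, map_smul]
  have hin (β : ι) : MDifferentiableAt (𝓡 n) 𝓘(ℝ, ℝ)
      (fun q ↦ inner ℝ (gradField x (b β) q) (V q)) p := ((hZ β).mdiffAt p).inner_bundle hV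
  have hd (β : ι) : DiffAt n F (fun q ↦ cov σ q (gradField x (b β) q)) p :=
    (hσ.conn hcov (hZ β)).diffAt p
  have hd' (β : ι) : DiffAt n F (fun q ↦ inner ℝ (gradField x (b β) q) (V q) •
      cov σ q (gradField x (b β) q)) p := (hin β).smul_section (hd β)
  rw [h1, conn_fun_sum _ hd', secondDeriv]
  have h2 (β : ι) := conn_fun_smul (cov := cov) (hd β) (hin β) u
  rw [Finset.sum_congr rfl fun β _ ↦ h2 β, Finset.sum_add_distrib]
  congr 1
  have h3 (β : ι) := mvfderiv_inner_field hm ((hZ β).mdiffAt p) hV u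
  have h4 : ∑ β, inner ℝ (lc (gradField x (b β)) p u) (V p) • cov σ p (gradField x (b β) p)
      = 0 :=
    sum_bilin_conn_gradField hx b ht hm p u
      (((LinearMap.lsmul ℝ (S p)).comp ((innerₗ (TangentSpace (𝓡 n) p)).flip (V p))).compl₂
        (cov σ p).toLinearMap)
  have h5 := congrArg (cov σ p) (sum_inner_smul_gradField hx b p (lc V p u))
  simp only [map_sum, map_smul] at h5
  rw [Finset.sum_congr rfl fun β _ ↦ congrArg (· • cov σ p (gradField x (b β) p)) (h3 β)]
  simp only [add_smul, Finset.sum_add_distrib]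
  rw [h4, h5, zero_add]

end Connection

end DiracEigenvalues

namespace DiracEigenvalues

lemma real_inner_eq_re {𝕜 A : Type*} [RCLike 𝕜] [NormedAddCommGroup A] [InnerProductSpace ℝ A]
    [InnerProductSpace 𝕜 A] (s t : A) : inner ℝ s t = RCLike.re (inner 𝕜 s t) := by
  rw [real_inner_eq_norm_add_mul_self_sub_norm_mul_self_sub_norm_mul_self_div_two,
    re_inner_eq_norm_add_mul_self_sub_norm_mul_self_sub_norm_mul_self_div_two]

/-! ### Weitzenböck formula and commutators of the Dirac operator. -/

section Dirac

variable {n N : ℕ} {𝕜 : Type*} [RCLike 𝕜]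
  {M : Type*} [TopologicalSpace M] [ChartedSpace (EuclideanSpace ℝ (Fin n)) M]
  [IsManifold (𝓡 n) ∞ M]
  [RiemannianBundle (fun x : M ↦ TangentSpace (𝓡 n) x)]
  [IsContMDiffRiemannianBundle (𝓡 n) ∞ (EuclideanSpace ℝ (Fin n))
    (fun x : M ↦ TangentSpace (𝓡 n) x)]
  {F : Type*} [NormedAddCommGroup F] [NormedSpace ℝ F] [FiniteDimensional ℝ F]
  {S : M → Type*} [TopologicalSpace (TotalSpace F S)] [∀ x, NormedAddCommGroup (S x)]
  [∀ x, InnerProductSpace ℝ (S x)] [FiberBundle F S] [VectorBundle ℝ F S]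
  [ContMDiffVectorBundle ∞ F S (𝓡 n)] [IsContMDiffRiemannianBundle (𝓡 n) ∞ F S]
  [∀ x, InnerProductSpace 𝕜 (S x)]
  (B : DiracBundle (n := n) 𝕜 M F S)
  {x : M → EuclideanSpace ℝ (Fin N)} (hx : IsIsometricEmbedding (n := n) x)
  {ι : Type*} [Fintype ι] (b : OrthonormalBasis ι ℝ (EuclideanSpace ℝ (Fin N)))

namespace DiracBundle

lemma real_inner_clifford (p : M) (v : TangentSpace (𝓡 n) p) (s t : S p) :
    inner ℝ (B.clifford p v s) t = - inner ℝ s (B.clifford p v t) := by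
  have h := congrArg RCLike.re (B.clifford_skew p v s t)
  rw [map_add, map_zero] at h
  rw [real_inner_eq_re (𝕜 := 𝕜), real_inner_eq_re (𝕜 := 𝕜)]
  linarith

lemma isSmooth_clifford {Y : ∀ p : M, TangentSpace (𝓡 n) p} {σ : ∀ p, S p} (hY : IsSmoothField Y)
    (hσ : IsSmooth n F σ) : IsSmooth n F (fun q ↦ B.clifford q (Y q) (σ q)) :=
  fun p ↦ B.clifford_smooth Y σ p (hY p) (hσ p)

include hx

lemma dirac_eq_sum (σ : ∀ p, S p) (p : M) :
    B.dirac σ p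
      = ∑ α, B.clifford p (gradField x (b α) p) (B.conn σ p (gradField x (b α) p)) :=
  (sum_bilin_gradField hx b p ((B.clifford p).compl₂ (B.conn σ p).toLinearMap)).symm

lemma isSmooth_dirac {σ : ∀ p, S p} (hσ : IsSmooth n F σ) : IsSmooth n F (B.dirac σ) := by
  have h : B.dirac σ = fun p ↦ ∑ α, B.clifford p
      (gradField x (EuclideanSpace.basisFun (Fin N) ℝ α) p)
      (B.conn σ p (gradField x (EuclideanSpace.basisFun (Fin N) ℝ α) p)) :=
    funext fun p ↦ B.dirac_eq_sum hx _ σ p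
  rw [h]
  exact IsSmooth.sum fun α ↦ B.isSmooth_clifford (contMDiff_gradField hx _)
    (hσ.conn B.conn_smooth (contMDiff_gradField hx _))

/-- Vanishing torsion writes the bracket as `∇_U W - ∇_W U`, which cancels the first order terms of
the two second derivatives. In particular the chosen extensions do not matter. -/
lemma curvature_eq {σ : ∀ p, S p} (hσ : IsSmooth n F σ) (p : M) (u w : TangentSpace (𝓡 n) p) :
    B.curvature σ p u w
      = secondDeriv B.conn x b σ p u w - secondDeriv B.conn x b σ p w u := by
  set U : ∀ q : M, TangentSpace (𝓡 n) q := FiberBundle.extend (EuclideanSpace ℝ (Fin n)) u with hU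
  set W : ∀ q : M, TangentSpace (𝓡 n) q := FiberBundle.extend (EuclideanSpace ℝ (Fin n)) w with hW
  have hd (u : TangentSpace (𝓡 n) p) : DiffAt n (EuclideanSpace ℝ (Fin n))
      (FiberBundle.extend (EuclideanSpace ℝ (Fin n)) u : ∀ q : M, TangentSpace (𝓡 n) q) p :=
    (FiberBundle.contMDiffAt_extend (𝓡 n) (EuclideanSpace ℝ (Fin n)) u).mdifferentiableAt
      (n := ∞) (by simp)
  have hUp : U p = u := by simp [hU]
  have hWp : W p = w := by simp [hW]
  have h1 := conn_conn_apply hx b B.leviCivita_torsion B.leviCivita_metric B.conn_smooth hσ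
    (hd w) u
  have h2 := conn_conn_apply hx b B.leviCivita_torsion B.leviCivita_metric B.conn_smooth hσ
    (hd u) w
  have h3 := (B.leviCivita.torsion_eq_zero_iff.1 B.leviCivita_torsion) (hd u) (hd w)
  change B.conn (fun q ↦ B.conn σ q (W q)) p u - B.conn (fun q ↦ B.conn σ q (U q)) p w
    - B.conn σ p (VectorField.mlieBracket (𝓡 n) U W p) = _
  change B.conn (fun q ↦ B.conn σ q (W q)) p u
    = secondDeriv B.conn x b σ p u (W p) + B.conn σ p (B.leviCivita W p u) at h1
  change B.conn (fun q ↦ B.conn σ q (U q)) p w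
    = secondDeriv B.conn x b σ p w (U p) + B.conn σ p (B.leviCivita U p w) at h2
  change B.leviCivita W p (U p) - B.leviCivita U p (W p)
    = VectorField.mlieBracket (𝓡 n) U W p at h3
  rw [h1, h2, ← h3, map_sub, hUp, hWp]
  abel

/-- The Weitzenböck formula. -/
lemma dirac_dirac {σ : ∀ p, S p} (hσ : IsSmooth n F σ) (p : M) :
    B.dirac (B.dirac σ) p
      = -∑ β, B.conn (fun q ↦ B.conn σ q (gradField x (b β) q)) p (gradField x (b β) p)
        + B.curvatureMorphism σ p := by
  have hZ (β : ι) : IsSmoothField (gradField (n := n) x (b β)) := contMDiff_gradField hx _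
  have hC (β : ι) : IsSmooth n F fun q ↦ B.conn σ q (gradField x (b β) q) :=
    hσ.conn B.conn_smooth (hZ β)
  have h1 (u : TangentSpace (𝓡 n) p) : B.conn (B.dirac σ) p u
      = ∑ β, B.clifford p (gradField x (b β) p)
        (B.conn (fun q ↦ B.conn σ q (gradField x (b β) q)) p u) := by
    have h2 : B.dirac σ = fun p ↦ ∑ β, B.clifford p (gradField x (b β) p)
        (B.conn σ p (gradField x (b β) p)) := funext fun p ↦ B.dirac_eq_sum hx _ σ p
    rw [h2, conn_fun_sum _ fun β ↦ (B.isSmooth_clifford (hZ β) (hC β)).diffAt p]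
    rw [Finset.sum_congr rfl fun β _ ↦ B.conn_clifford _ _ p u (hZ β p) (hC β p),
      Finset.sum_add_distrib, add_eq_right]
    -- The terms in which the Clifford factor is differentiated add up to zero.
    exact sum_bilin_conn_gradField hx b B.leviCivita_torsion B.leviCivita_metric p u
      ((B.clifford p).compl₂ (B.conn σ p).toLinearMap)
  have h3 : B.dirac (B.dirac σ) p = ∑ i, ∑ j, B.clifford p (frame p i) (B.clifford p (frame p j)
      (secondDeriv B.conn x b σ p (frame p i) (frame p j))) := by
    refine Finset.sum_congr rfl fun i _ ↦ ?_
    rw [h1, ← map_sum]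
    congr 1
    have h4 (β : ι) : B.clifford p (gradField x (b β) p)
        (B.conn (fun q ↦ B.conn σ q (gradField x (b β) q)) p (frame p i))
        = ∑ j, B.clifford p (frame p j) (inner ℝ (gradField x (b β) p) (frame p j) •
          B.conn (fun q ↦ B.conn σ q (gradField x (b β) q)) p (frame p i)) := by
      conv_lhs => rw [← (frame p).sum_repr' (gradField x (b β) p)]
      simp only [map_sum, map_smul, LinearMap.sum_apply, LinearMap.smul_apply]
      exact Finset.sum_congr rfl fun j _ ↦ by rw [real_inner_comm]
    rw [Finset.sum_congr rfl fun β _ ↦ h4 β, Finset.sum_comm]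
    refine Finset.sum_congr rfl fun j _ ↦ ?_
    rw [← map_sum]
    rfl
  -- The symmetric part of the double Clifford trace is the rough Laplacian, the antisymmetric part
  -- is the curvature morphism.
  rw [h3, sum_clifford_clifford (B.clifford_sq p) (frame p)]
  congr 1
  · congr 1
    simp only [secondDeriv]
    rw [Finset.sum_comm]
    refine Finset.sum_congr rfl fun β _ ↦ ?_
    conv_rhs => rw [← (frame p).sum_repr' (gradField x (b β) p)]
    simp only [map_sum, map_smul]
    exact Finset.sum_congr rfl fun j _ ↦ by rw [real_inner_comm]
  · refine Finset.sum_congr rfl fun i _ ↦ Finset.sum_congr rfl fun j _ ↦ ?_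
    rw [B.curvature_eq hx b hσ]

/-- Moving `e_i` past `∇f` by the Clifford relation costs the derivative term; the Hessian of `f` is
symmetric and contributes only its trace. -/
lemma dirac_clifford_gradField (v : EuclideanSpace ℝ (Fin N)) {σ : ∀ p, S p}
    (hσ : IsSmooth n F σ) (p : M) :
    B.dirac (fun q ↦ B.clifford q (gradField x v q) (σ q)) p
      = -(coordLaplacian B.leviCivita x v p • σ p)
        - B.clifford p (gradField x v p) (B.dirac σ p)
        - (2 : ℝ) • B.conn σ p (gradField x v p) := by
  have hZ : IsSmoothField (gradField (n := n) x v) := contMDiff_gradField hx _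
  have h1 (i) : B.clifford p (frame p i)
      (B.conn (fun q ↦ B.clifford q (gradField x v q) (σ q)) p (frame p i))
      = B.clifford p (frame p i)
          (B.clifford p (B.leviCivita (gradField x v) p (frame p i)) (σ p))
        - B.clifford p (gradField x v p) (B.clifford p (frame p i) (B.conn σ p (frame p i)))
        - (2 : ℝ) • inner ℝ (frame p i) (gradField x v p) • B.conn σ p (frame p i) := by
    rw [B.conn_clifford _ _ p _ (hZ p) (hσ p), map_add]
    have h2 := clifford_anticomm (B.clifford_sq p) (frame p i) (gradField x v p)
      (B.conn σ p (frame p i))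
    linear_combination (norm := module) h2
  have h3 : ∑ i, B.clifford p (frame p i)
      (B.clifford p (B.leviCivita (gradField x v) p (frame p i)) (σ p))
      = -(coordLaplacian B.leviCivita x v p • σ p) :=
    sum_clifford_clifford_symm (B.clifford_sq p) (frame p)
      (B.leviCivita (gradField x v) p).toLinearMap
      (inner_conn_gradField_comm hx B.leviCivita_torsion B.leviCivita_metric v p) (σ p)
  rw [dirac, Finset.sum_congr rfl fun i _ ↦ h1 i, Finset.sum_sub_distrib, Finset.sum_sub_distrib,
    h3, ← map_sum, ← Finset.smul_sum]
  congr 2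
  conv_rhs => rw [← (frame p).sum_repr' (gradField x v p)]
  simp only [map_sum, map_smul]

section Commutator

variable {v : EuclideanSpace ℝ (Fin N)} {f : M → ℝ} (hf : ContMDiff (𝓡 n) 𝓘(ℝ, ℝ) ∞ f)
  (hdf : ∀ p u, mvfderiv (𝓡 n) f p u = inner ℝ (gradField x v p) u)

include hf hdf

/-- The function is given through its differential, so that the result also covers `⟨v, x - c⟩` with
a shifted origin. -/
lemma dirac_smul {σ : ∀ p, S p} (hσ : IsSmooth n F σ) (p : M) :
    B.dirac (fun q ↦ f q • σ q) p
      = B.clifford p (gradField x v p) (σ p) + f p • B.dirac σ p := by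
  have h1 (i) : B.clifford p (frame p i) (B.conn (fun q ↦ f q • σ q) p (frame p i))
      = f p • B.clifford p (frame p i) (B.conn σ p (frame p i))
        + inner ℝ (gradField x v p) (frame p i) • B.clifford p (frame p i) (σ p) := by
    rw [conn_fun_smul (hσ.diffAt p) ((hf p).mdifferentiableAt (by simp)), hdf, map_add, map_smul,
      map_smul]
  rw [dirac, Finset.sum_congr rfl fun i _ ↦ h1 i, Finset.sum_add_distrib, ← Finset.smul_sum,
    add_comm]
  congr 1
  conv_rhs => rw [← (frame p).sum_repr' (gradField x v p)]
  simp only [map_sum, map_smul, LinearMap.sum_apply, LinearMap.smul_apply]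
  exact Finset.sum_congr rfl fun j _ ↦ by rw [real_inner_comm]

/-- The commutator of `D²` with a linear coordinate. -/
lemma dirac_dirac_smul {σ : ∀ p, S p} (hσ : IsSmooth n F σ) (p : M) :
    B.dirac (B.dirac (fun q ↦ f q • σ q)) p
      = f p • B.dirac (B.dirac σ) p - (2 : ℝ) • B.conn σ p (gradField x v p)
        - coordLaplacian B.leviCivita x v p • σ p := by
  have hZ : IsSmoothField (gradField (n := n) x v) := contMDiff_gradField hx _
  have hD := B.isSmooth_dirac hx hσ
  have h1 : B.dirac (fun q ↦ f q • σ q)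
      = fun q ↦ B.clifford q (gradField x v q) (σ q) + f q • B.dirac σ q :=
    funext fun q ↦ B.dirac_smul hx hf hdf hσ q
  have h2 : B.dirac (fun q ↦ B.clifford q (gradField x v q) (σ q) + f q • B.dirac σ q) p
      = B.dirac (fun q ↦ B.clifford q (gradField x v q) (σ q)) p
        + B.dirac (fun q ↦ f q • B.dirac σ q) p := by
    simp only [dirac]
    rw [← Finset.sum_add_distrib]
    refine Finset.sum_congr rfl fun i _ ↦ ?_
    rw [← map_add]
    congr 1
    exact conn_fun_add ((B.isSmooth_clifford hZ hσ).diffAt p) ((hD.smul hf).diffAt p) _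
  -- The two terms `∇f · Dσ` have opposite signs and cancel.
  rw [h1, h2, B.dirac_clifford_gradField hx v hσ, B.dirac_smul hx hf hdf hD]
  module

end Commutator

end DiracBundle

end Dirac

end DiracEigenvalues

namespace DiracEigenvalues

/-! ### Integral identities on the compact manifold. -/

section Integral

variable {n N : ℕ} {𝕜 : Type*} [RCLike 𝕜]
  {M : Type*} [TopologicalSpace M] [T2Space M] [CompactSpace M]
  [ChartedSpace (EuclideanSpace ℝ (Fin n)) M]
  [IsManifold (𝓡 n) ∞ M]
  [RiemannianBundle (fun x : M ↦ TangentSpace (𝓡 n) x)]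
  [IsContMDiffRiemannianBundle (𝓡 n) ∞ (EuclideanSpace ℝ (Fin n))
    (fun x : M ↦ TangentSpace (𝓡 n) x)]
  [MeasurableSpace M] [BorelSpace M]
  {F : Type*} [NormedAddCommGroup F] [NormedSpace ℝ F] [FiniteDimensional ℝ F]
  {S : M → Type*} [TopologicalSpace (TotalSpace F S)] [∀ x, NormedAddCommGroup (S x)]
  [∀ x, InnerProductSpace ℝ (S x)] [FiberBundle F S] [VectorBundle ℝ F S]
  [ContMDiffVectorBundle ∞ F S (𝓡 n)] [IsContMDiffRiemannianBundle (𝓡 n) ∞ F S]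
  [∀ x, InnerProductSpace 𝕜 (S x)]
  {lc : CovariantDerivative (𝓡 n) (EuclideanSpace ℝ (Fin n)) (TangentSpace (𝓡 n) : M → Type _)}
  (B : DiracBundle (n := n) 𝕜 M F S)
  {x : M → EuclideanSpace ℝ (Fin N)} (hx : IsIsometricEmbedding (n := n) x)
  {ι : Type*} [Fintype ι] (b : OrthonormalBasis ι ℝ (EuclideanSpace ℝ (Fin N)))

include hx

/-- The adjoint of an isometry is a contraction. This yields the bound 1 on the weights a_i. -/
lemma norm_gradField_le (v : EuclideanSpace ℝ (Fin N)) (p : M) :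
    ‖gradField (n := n) x v p‖ ≤ ‖v‖ := by
  have h1 : ‖gradField (n := n) x v p‖ ^ 2 ≤ ‖v‖ * ‖gradField (n := n) x v p‖ := by
    rw [← real_inner_self_eq_norm_sq, inner_gradField]
    refine (real_inner_le_norm _ _).trans_eq ?_
    congr 1
    rw [← sq_eq_sq₀ (norm_nonneg _) (norm_nonneg _), ← real_inner_self_eq_norm_sq,
      hx.inner_mvfderiv, real_inner_self_eq_norm_sq]
  rcases (norm_nonneg (gradField (n := n) x v p)).eq_or_lt with h | h
  · rw [← h]
    exact norm_nonneg v
  · nlinarith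

lemma sum_norm_gradField_sq (p : M) : ∑ α, ‖gradField (n := n) x (b α) p‖ ^ 2 = n := by
  have h1 := sum_bilin_gradField hx b p (innerₗ (TangentSpace (𝓡 n) p))
  simp only [innerₗ_apply_apply, real_inner_self_eq_norm_sq, OrthonormalBasis.norm_eq_one, one_pow,
    Finset.sum_const, Finset.card_univ, Fintype.card_fin, nsmul_eq_mul, mul_one] at h1
  rw [h1]
  exact congrArg Nat.cast (finrank_euclideanSpace_fin (𝕜 := ℝ) (n := n))

/-- The divergence theorem for Σ h_α Z_α. The side condition holds whenever `h α` depends linearly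
on Z_α, since the mean curvature vector has no tangential part. -/
lemma integral_sum_mvfderiv_gradField
    (hs : CovariantDerivative.ContMDiffCovariantDerivative lc ∞) (ht : lc.torsion = 0)
    (hm : lc.IsMetricCompatible) {h : ι → M → ℝ} (hh : ∀ α, ContMDiff (𝓡 n) 𝓘(ℝ, ℝ) ∞ (h α))
    (h0 : ∀ p, ∑ α, h α p * coordLaplacian lc x (b α) p = 0) :
    ∫ p, ∑ α, mvfderiv (𝓡 n) (h α) p (gradField x (b α) p) ∂(riemannianVolume (n := n) M)
      = 0 := by
  have h1 (p : M) : ∑ α, mvfderiv (𝓡 n) (h α) p (gradField x (b α) p)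
      = ∑ α, (mvfderiv (𝓡 n) (h α) p (gradField x (b α) p)
        + h α p * coordLaplacian lc x (b α) p) := by
    rw [Finset.sum_add_distrib, h0, add_zero]
  simp only [h1]
  rw [integral_finsetSum _ fun α _ ↦
    integrable_of_continuous hx (contMDiff_divergence hx hs (b α) (hh α)).continuous]
  exact Finset.sum_eq_zero fun α _ ↦ integral_divergence hx hs ht hm (b α) (hh α)

lemma integrable_inner {σ τ : ∀ p, S p} (hσ : IsSmooth n F σ) (hτ : IsSmooth n F τ) :
    Integrable (fun p ↦ inner ℝ (σ p) (τ p)) (riemannianVolume (n := n) M) :=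
  integrable_of_continuous hx (hσ.inner hτ).continuous

namespace DiracBundle

/-- The Dirac operator is formally self-adjoint. -/
lemma integral_inner_dirac {σ τ : ∀ p, S p} (hσ : IsSmooth n F σ) (hτ : IsSmooth n F τ) :
    ∫ p, inner ℝ (B.dirac σ p) (τ p) ∂(riemannianVolume (n := n) M)
      = ∫ p, inner ℝ (σ p) (B.dirac τ p) ∂(riemannianVolume (n := n) M) := by
  set b := EuclideanSpace.basisFun (Fin N) ℝ
  have hZ (β) : IsSmoothField (gradField (n := n) x (b β)) := contMDiff_gradField hx _
  -- Coefficients of the vector field dual to `v ↦ ⟨σ, v · τ⟩`; up to sign its divergence is the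
  -- difference of the two integrands.
  set h : Fin N → M → ℝ := fun α p ↦ inner ℝ (σ p) (B.clifford p (gradField x (b α) p) (τ p))
  have hc (α) : IsSmooth n F fun q ↦ B.clifford q (gradField x (b α) q) (τ q) :=
    B.isSmooth_clifford (hZ α) hτ
  have hh (α) : ContMDiff (𝓡 n) 𝓘(ℝ, ℝ) ∞ (h α) := hσ.inner (hc α)
  have h0 (p : M) : ∑ α, h α p * coordLaplacian B.leviCivita x (b α) p = 0 := by
    have h1 : ∑ α, h α p * coordLaplacian B.leviCivita x (b α) p
        = inner ℝ (σ p) (B.clifford p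
          (∑ α, coordLaplacian B.leviCivita x (b α) p • gradField x (b α) p) (τ p)) := by
      simp only [map_sum, map_smul, LinearMap.sum_apply, LinearMap.smul_apply, inner_sum,
        inner_smul_right]
      exact Finset.sum_congr rfl fun α _ ↦ mul_comm _ _
    rw [h1, sum_coordLaplacian_smul hx b B.leviCivita_torsion B.leviCivita_metric]
    simp
  have key (p : M) : inner ℝ (B.dirac σ p) (τ p) = inner ℝ (σ p) (B.dirac τ p)
      - ∑ α, mvfderiv (𝓡 n) (h α) p (gradField x (b α) p) := by
    have h1 (α) : mvfderiv (𝓡 n) (h α) p (gradField x (b α) p)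
        = inner ℝ (B.conn σ p (gradField x (b α) p)) (B.clifford p (gradField x (b α) p) (τ p))
          + (inner ℝ (σ p) (B.clifford p
              (B.leviCivita (gradField x (b α)) p (gradField x (b α) p)) (τ p))
          + inner ℝ (σ p) (B.clifford p (gradField x (b α) p)
              (B.conn τ p (gradField x (b α) p)))) := by
      rw [mvfderiv_inner_section B.conn_metric (hσ.diffAt p) ((hc α).diffAt p),
        B.conn_clifford _ _ p _ (hZ α p) (hτ p), inner_add_right]
    have h2 : ∑ α, inner ℝ (σ p) (B.clifford p
        (B.leviCivita (gradField x (b α)) p (gradField x (b α) p)) (τ p)) = 0 := by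
      rw [← inner_sum, ← LinearMap.sum_apply, ← map_sum,
        sum_conn_gradField hx b B.leviCivita_torsion B.leviCivita_metric]
      simp
    rw [Finset.sum_congr rfl fun α _ ↦ h1 α, Finset.sum_add_distrib, Finset.sum_add_distrib, h2,
      zero_add, B.dirac_eq_sum hx b, B.dirac_eq_sum hx b, sum_inner, inner_sum]
    simp only [B.real_inner_clifford, Finset.sum_neg_distrib]
    ring
  simp only [key]
  rw [integral_sub (integrable_inner hx hσ (B.isSmooth_dirac hx hτ)),
    integral_sum_mvfderiv_gradField hx b B.leviCivita_smooth B.leviCivita_torsion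
      B.leviCivita_metric hh h0, sub_zero]
  exact integrable_finsetSum _ fun α _ ↦ integrable_of_continuous hx
    (contMDiff_mvfderiv_apply (hh α) (hZ α)).continuous

/-- The definition uses pointwise frames and local extensions, but the Weitzenböck formula expresses
the result through smooth operations. -/
lemma isSmooth_curvatureMorphism {σ : ∀ p, S p} (hσ : IsSmooth n F σ) :
    IsSmooth n F (B.curvatureMorphism σ) := by
  set b := EuclideanSpace.basisFun (Fin N) ℝ
  have hZ (β) : IsSmoothField (gradField (n := n) x (b β)) := contMDiff_gradField hx _
  have h1 : B.curvatureMorphism σ = fun p ↦ B.dirac (B.dirac σ) p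
      + ∑ β, B.conn (fun q ↦ B.conn σ q (gradField x (b β) q)) p (gradField x (b β) p) :=
    funext fun p ↦ by
      rw [B.dirac_dirac hx b hσ]
      abel
  rw [h1]
  exact (B.isSmooth_dirac hx (B.isSmooth_dirac hx hσ)).add (IsSmooth.sum fun β ↦
    (hσ.conn B.conn_smooth (hZ β)).conn B.conn_smooth (hZ β))

/-- By linearity in the direction this is a derivative along the tangential part of the mean
curvature vector, which is zero. It kills the cross term in the final estimate. -/
lemma sum_coordLaplacian_mul_inner (σ : ∀ p, S p) (p : M) (s : S p) :
    ∑ α, inner ℝ (B.conn σ p (gradField x (b α) p)) s * coordLaplacian B.leviCivita x (b α) p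
      = 0 := by
  have h1 : ∑ α, inner ℝ (B.conn σ p (gradField x (b α) p)) s *
      coordLaplacian B.leviCivita x (b α) p
      = inner ℝ (B.conn σ p
        (∑ α, coordLaplacian B.leviCivita x (b α) p • gradField x (b α) p)) s := by
    simp only [map_sum, map_smul, sum_inner, inner_smul_left, RCLike.conj_to_real]
    exact Finset.sum_congr rfl fun α _ ↦ mul_comm _ _
  rw [h1, sum_coordLaplacian_smul hx b B.leviCivita_torsion B.leviCivita_metric]
  simp

/-- The integrated Weitzenböck formula. -/
lemma integral_sum_norm_conn_sq {σ : ∀ p, S p} (hσ : IsSmooth n F σ) :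
    ∫ p, ∑ α, ‖B.conn σ p (gradField x (b α) p)‖ ^ 2 ∂(riemannianVolume (n := n) M)
      = ∫ p, inner ℝ (B.dirac (B.dirac σ) p) (σ p) ∂(riemannianVolume (n := n) M)
        - ∫ p, inner ℝ (B.curvatureMorphism σ p) (σ p) ∂(riemannianVolume (n := n) M) := by
  have hZ (β) : IsSmoothField (gradField (n := n) x (b β)) := contMDiff_gradField hx _
  have hC (α) : IsSmooth n F fun q ↦ B.conn σ q (gradField x (b α) q) :=
    hσ.conn B.conn_smooth (hZ α)
  -- These are the coefficients of half the gradient of `‖σ‖ ^ 2`.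
  set h : ι → M → ℝ := fun α p ↦ inner ℝ (B.conn σ p (gradField x (b α) p)) (σ p)
  have hh (α) : ContMDiff (𝓡 n) 𝓘(ℝ, ℝ) ∞ (h α) := (hC α).inner hσ
  have h0 (p : M) : ∑ α, h α p * coordLaplacian B.leviCivita x (b α) p = 0 :=
    B.sum_coordLaplacian_mul_inner hx b σ p _
  have key (p : M) : ∑ α, ‖B.conn σ p (gradField x (b α) p)‖ ^ 2
      = inner ℝ (B.dirac (B.dirac σ) p) (σ p) - inner ℝ (B.curvatureMorphism σ p) (σ p)
        + ∑ α, mvfderiv (𝓡 n) (h α) p (gradField x (b α) p) := by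
    have h1 (α) : mvfderiv (𝓡 n) (h α) p (gradField x (b α) p)
        = inner ℝ (B.conn (fun q ↦ B.conn σ q (gradField x (b α) q)) p (gradField x (b α) p)) (σ p)
          + ‖B.conn σ p (gradField x (b α) p)‖ ^ 2 := by
      rw [← real_inner_self_eq_norm_sq]
      exact mvfderiv_inner_section B.conn_metric ((hC α).diffAt p) (hσ.diffAt p) _
    rw [Finset.sum_congr rfl fun α _ ↦ h1 α, Finset.sum_add_distrib, B.dirac_dirac hx b hσ,
      inner_add_left, inner_neg_left, sum_inner]
    ring
  simp only [key]
  have i1 := integrable_inner hx (B.isSmooth_dirac hx (B.isSmooth_dirac hx hσ)) hσ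
  have i2 := integrable_inner hx (B.isSmooth_curvatureMorphism hx hσ) hσ
  rw [integral_add (f := fun p ↦ inner ℝ (B.dirac (B.dirac σ) p) (σ p)
    - inner ℝ (B.curvatureMorphism σ p) (σ p)) (i1.sub i2), integral_sub i1 i2,
    integral_sum_mvfderiv_gradField hx b B.leviCivita_smooth B.leviCivita_torsion
      B.leviCivita_metric hh h0, add_zero]
  exact integrable_finsetSum _ fun α _ ↦ integrable_of_continuous hx
    (contMDiff_mvfderiv_apply (hh α) (hZ α)).continuous

/-- The value of the commutator `[D², f]` in `⟨·, f σ⟩`. -/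
lemma integral_inner_commutator {v : EuclideanSpace ℝ (Fin N)} {f : M → ℝ}
    (hf : ContMDiff (𝓡 n) 𝓘(ℝ, ℝ) ∞ f)
    (hdf : ∀ p u, mvfderiv (𝓡 n) f p u = inner ℝ (gradField x v p) u)
    {σ : ∀ p, S p} (hσ : IsSmooth n F σ) :
    ∫ p, inner ℝ (-((2 : ℝ) • B.conn σ p (gradField x v p))
        - coordLaplacian B.leviCivita x v p • σ p) (f p • σ p) ∂(riemannianVolume (n := n) M)
      = ∫ p, ‖gradField (n := n) x v p‖ ^ 2 * ‖σ p‖ ^ 2 ∂(riemannianVolume (n := n) M) := by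
  have hZ : IsSmoothField (gradField (n := n) x v) := contMDiff_gradField hx _
  have hn : ContMDiff (𝓡 n) 𝓘(ℝ, ℝ) ∞ fun p ↦ inner ℝ (σ p) (σ p) := hσ.inner hσ
  have hh : ContMDiff (𝓡 n) 𝓘(ℝ, ℝ) ∞ fun p ↦ f p * inner ℝ (σ p) (σ p) := hf.mul hn
  -- The integrand differs from |∇f|²|σ|² by the divergence of `f ‖σ‖² ∇f`; the factor 2 matches the
  -- derivative of `‖σ‖²`.
  have key (p : M) : inner ℝ (-((2 : ℝ) • B.conn σ p (gradField x v p))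
        - coordLaplacian B.leviCivita x v p • σ p) (f p • σ p)
      = ‖gradField (n := n) x v p‖ ^ 2 * ‖σ p‖ ^ 2
        - (mvfderiv (𝓡 n) (fun p ↦ f p * inner ℝ (σ p) (σ p)) p (gradField x v p)
          + (f p * inner ℝ (σ p) (σ p)) * coordLaplacian B.leviCivita x v p) := by
    rw [mvfderiv_fun_mul ((hf p).mdifferentiableAt (by simp)) ((hn p).mdifferentiableAt (by simp))]
    simp only [_root_.add_apply, _root_.smul_apply, smul_eq_mul]
    rw [mvfderiv_inner_section B.conn_metric (hσ.diffAt p) (hσ.diffAt p), hdf]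
    simp only [inner_sub_left, inner_neg_left, inner_smul_left, inner_smul_right,
      RCLike.conj_to_real, real_inner_self_eq_norm_sq, real_inner_comm (B.conn σ p _) (σ p)]
    ring
  simp only [key]
  rw [integral_sub, integral_divergence hx B.leviCivita_smooth B.leviCivita_torsion
    B.leviCivita_metric v hh, sub_zero]
  · simp only [← real_inner_self_eq_norm_sq]
    exact integrable_of_continuous hx ((hZ.inner hZ).continuous.mul hn.continuous)
  · exact integrable_of_continuous hx (contMDiff_divergence hx B.leviCivita_smooth v hh).continuous

end DiracBundle

end Integral

end DiracEigenvalues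

namespace DiracEigenvalues

/-! ### The pre-Hilbert space of smooth sections. -/

section Sections

variable {n N : ℕ} {𝕜 : Type*} [RCLike 𝕜]
  {M : Type*} [TopologicalSpace M] [T2Space M] [CompactSpace M]
  [ChartedSpace (EuclideanSpace ℝ (Fin n)) M]
  [IsManifold (𝓡 n) ∞ M]
  [RiemannianBundle (fun x : M ↦ TangentSpace (𝓡 n) x)]
  [IsContMDiffRiemannianBundle (𝓡 n) ∞ (EuclideanSpace ℝ (Fin n))
    (fun x : M ↦ TangentSpace (𝓡 n) x)]
  [MeasurableSpace M] [BorelSpace M]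
  {F : Type*} [NormedAddCommGroup F] [NormedSpace ℝ F] [FiniteDimensional ℝ F]
  {S : M → Type*} [TopologicalSpace (TotalSpace F S)] [∀ x, NormedAddCommGroup (S x)]
  [∀ x, InnerProductSpace ℝ (S x)] [FiberBundle F S] [VectorBundle ℝ F S]
  [ContMDiffVectorBundle ∞ F S (𝓡 n)] [IsContMDiffRiemannianBundle (𝓡 n) ∞ F S]
  [∀ x, InnerProductSpace 𝕜 (S x)]
  (B : DiracBundle (n := n) 𝕜 M F S)
  {x : M → EuclideanSpace ℝ (Fin N)} (hx : IsIsometricEmbedding (n := n) x)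

namespace DiracBundle

/-- The space of smooth sections of a Dirac bundle. -/
def smoothSections : Submodule 𝕜 (∀ p, S p) where
  carrier := {σ | IsSmooth n F σ}
  add_mem' hσ hτ := IsSmooth.add hσ hτ
  zero_mem' := IsSmooth.sum (s := (∅ : Finset ℕ)) (σ := fun _ _ ↦ 0)
    (fun _ ↦ Bundle.contMDiff_zeroSection ℝ S)
  smul_mem' a σ hσ := fun p ↦ B.smul_smooth a σ p (hσ p)

-- Only the real inner product is known to be smooth along sections; the imaginary part is recovered
-- by multiplying one section by `I`.
include B in
lemma continuous_inner {σ τ : ∀ p, S p} (hσ : IsSmooth n F σ) (hτ : IsSmooth n F τ) :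
    Continuous fun p ↦ inner 𝕜 (σ p) (τ p) := by
  have hI : IsSmooth n F fun p ↦ (RCLike.I : 𝕜) • σ p :=
    fun p ↦ B.smul_smooth RCLike.I σ p (hσ p)
  have h1 : (fun p ↦ inner 𝕜 (σ p) (τ p)) = fun p ↦ ((inner ℝ (σ p) (τ p) : ℝ) : 𝕜)
      + ((inner ℝ ((RCLike.I : 𝕜) • σ p) (τ p) : ℝ) : 𝕜) * RCLike.I := funext fun p ↦ by
    rw [real_inner_eq_re (𝕜 := 𝕜), real_inner_eq_re (𝕜 := 𝕜), inner_smul_left]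
    conv_lhs => rw [← RCLike.re_add_im (inner 𝕜 (σ p) (τ p))]
    simp
  rw [h1]
  have := (hσ.inner hτ).continuous
  have := (hI.inner hτ).continuous
  fun_prop

include hx

include B in
lemma integrable_inner {σ τ : ∀ p, S p} (hσ : IsSmooth n F σ) (hτ : IsSmooth n F τ) :
    Integrable (fun p ↦ inner 𝕜 (σ p) (τ p)) (riemannianVolume (n := n) M) :=
  integrable_of_continuous hx (B.continuous_inner hσ hτ)

/-- The `L²` inner product on smooth sections. -/
abbrev sectionCore : PreInnerProductSpace.Core 𝕜 B.smoothSections where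
  inner σ τ := ∫ p, inner 𝕜 (σ.1 p) (τ.1 p) ∂(riemannianVolume (n := n) M)
  conj_inner_symm σ τ := by
    rw [← integral_conj]
    simp only [inner_conj_symm]
  re_inner_nonneg σ := by
    rw [← integral_re (B.integrable_inner hx σ.2 σ.2)]
    exact integral_nonneg fun p ↦ inner_self_nonneg
  add_left σ τ υ := by
    rw [← integral_add (B.integrable_inner hx σ.2 υ.2)
      (B.integrable_inner hx τ.2 υ.2)]
    simp only [← inner_add_left]
    rfl
  smul_left σ τ r := by
    rw [← integral_const_mul]
    simp only [← inner_smul_left]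
    rfl

/-- The Dirac operator on smooth sections. -/
def diracHom : B.smoothSections →ₗ[𝕜] B.smoothSections where
  toFun σ := ⟨B.dirac σ.1, B.isSmooth_dirac hx σ.2⟩
  map_add' σ τ := Subtype.ext <| funext fun p ↦ by
    change B.dirac (fun q ↦ σ.1 q + τ.1 q) p = B.dirac σ.1 p + B.dirac τ.1 p
    simp only [dirac]
    rw [← Finset.sum_add_distrib]
    refine Finset.sum_congr rfl fun i _ ↦ ?_
    rw [conn_fun_add (IsSmooth.diffAt σ.2 p) (IsSmooth.diffAt τ.2 p), map_add]
  map_smul' a σ := Subtype.ext <| funext fun p ↦ by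
    change B.dirac (fun q ↦ a • σ.1 q) p = a • B.dirac σ.1 p
    simp only [dirac]
    rw [Finset.smul_sum]
    refine Finset.sum_congr rfl fun i _ ↦ ?_
    rw [B.conn_smul a σ.1 p _ (σ.2 p), B.clifford_smul]

lemma integral_inner_dirac_dirac {σ τ : ∀ p, S p} (hσ : IsSmooth n F σ) (hτ : IsSmooth n F τ) :
    ∫ p, inner ℝ (B.dirac (B.dirac σ) p) (τ p) ∂(riemannianVolume (n := n) M)
      = ∫ p, inner ℝ (σ p) (B.dirac (B.dirac τ) p) ∂(riemannianVolume (n := n) M) := by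
  rw [B.integral_inner_dirac hx (B.isSmooth_dirac hx hσ) hτ,
    B.integral_inner_dirac hx hσ (B.isSmooth_dirac hx hτ)]

/-- The universal inequality for the eigenvalues of `D²` in terms of trial sections. -/
theorem sum_ev_sub_le [∀ p, IsScalarTower ℝ 𝕜 (S p)] {ev : ℕ → ℝ} {φ : ℕ → ∀ p, S p}
    (hφ : B.IsSpectralResolution ev φ)
    {ι : Type*} [Fintype ι] {ψ : ι → ∀ p, S p} (hψs : ∀ i, IsSmooth n F (ψ i))
    (hψ : ∀ i j, i ≠ j → ∫ p, inner 𝕜 (ψ i p) (ψ j p) ∂(riemannianVolume (n := n) M) = 0)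
    (hψ0 : ∀ i, ∫ p, inner 𝕜 (φ 0 p) (ψ i p) ∂(riemannianVolume (n := n) M) = 0)
    {a : ι → ℝ} (ha : ∀ i, ∫ p, inner ℝ (B.dirac (B.dirac (ψ i)) p - ev 0 • ψ i p) (ψ i p)
      ∂(riemannianVolume (n := n) M) = a i) (ha0 : ∀ i, 0 ≤ a i) (ha1 : ∀ i, a i ≤ 1)
    {m : ℕ} (hsum : ∑ i, a i = m) :
    ∑ i ∈ Finset.range m, (ev (i + 1) - ev 0)
      ≤ ∑ i, ∫ p, ‖B.dirac (B.dirac (ψ i)) p - ev 0 • ψ i p‖ ^ 2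
        ∂(riemannianVolume (n := n) M) := by
  -- A semi-inner product suffices for the abstract inequality, so definiteness of the L² form on
  -- smooth sections need not be shown.
  let core : PreInnerProductSpace.Core 𝕜 B.smoothSections := B.sectionCore hx
  let : SeminormedAddCommGroup B.smoothSections :=
    InnerProductSpace.Core.toSeminormedAddCommGroup (𝕜 := 𝕜)
  let : InnerProductSpace 𝕜 B.smoothSections := InnerProductSpace.ofCore core
  have hin (σ τ : B.smoothSections) : inner 𝕜 σ τ
      = ∫ p, inner 𝕜 (σ.1 p) (τ.1 p) ∂(riemannianVolume (n := n) M) := rfl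
  have hre (σ τ : B.smoothSections) : RCLike.re (inner 𝕜 σ τ)
      = ∫ p, inner ℝ (σ.1 p) (τ.1 p) ∂(riemannianVolume (n := n) M) := by
    rw [hin, ← integral_re (B.integrable_inner hx σ.2 τ.2)]
    exact integral_congr_ae (.of_forall fun p ↦ (real_inner_eq_re _ _).symm)
  have hnorm (σ : B.smoothSections) : ‖σ‖ ^ 2
      = ∫ p, ‖σ.1 p‖ ^ 2 ∂(riemannianVolume (n := n) M) := by
    rw [← inner_self_eq_norm_sq (𝕜 := 𝕜), hre]
    simp only [real_inner_self_eq_norm_sq]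
  have hcont (σ : B.smoothSections) : Continuous fun p ↦ ‖σ.1 p‖ ^ 2 := by
    simp only [← real_inner_self_eq_norm_sq]
    exact (IsSmooth.inner σ.2 σ.2).continuous
  have hlint (σ : B.smoothSections) :
      ∫⁻ p, ‖σ.1 p‖ₑ ^ 2 ∂(riemannianVolume (n := n) M) = ENNReal.ofReal (‖σ‖ ^ 2) := by
    rw [hnorm, ofReal_integral_eq_lintegral_ofReal (integrable_of_continuous hx (hcont σ))
      (.of_forall fun p ↦ sq_nonneg _)]
    refine lintegral_congr fun p ↦ ?_
    rw [ENNReal.ofReal_pow (norm_nonneg _), ofReal_norm]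
  let Φ : ℕ → B.smoothSections := fun j ↦ ⟨φ j, hφ.smooth j⟩
  let Ψ : ι → B.smoothSections := fun i ↦ ⟨ψ i, hψs i⟩
  let L : B.smoothSections →ₗ[𝕜] B.smoothSections := B.diracHom hx ∘ₗ B.diracHom hx
  have hreal (r : ℝ) (p : M) (s : S p) : ((r : 𝕜)) • s = r • s :=
    (RCLike.real_smul_eq_coe_smul (K := 𝕜) r s).symm
  have hLp (i : ι) : L (Ψ i) - (ev 0 : 𝕜) • Ψ i
      = ⟨fun p ↦ B.dirac (B.dirac (ψ i)) p - ev 0 • ψ i p,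
        (L (Ψ i) - (ev 0 : 𝕜) • Ψ i).2.congr fun p ↦ by
          congr 1
          exact congrArg (B.dirac (B.dirac (ψ i)) p - ·) (hreal _ _ _).symm⟩ :=
    Subtype.ext <| funext fun p ↦ congrArg (B.dirac (B.dirac (ψ i)) p - ·) (hreal _ _ _)
  have hortho : Orthonormal 𝕜 Φ := by
    rw [orthonormal_iff_ite]
    exact fun i j ↦ hφ.orthonormal i j
  have hdense (e : B.smoothSections) (ε : ℝ) (hε : 0 < ε) :
      ∃ (s : Finset ℕ) (a : ℕ → 𝕜), ‖e - ∑ j ∈ s, a j • Φ j‖ < ε := by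
    have hmeas : Measurable[inferInstance, borel (TotalSpace F S)]
        (fun p ↦ TotalSpace.mk' F p (e.1 p)) := by
      borelize (TotalSpace F S)
      exact (ContMDiff.continuous e.2).measurable
    obtain ⟨s, a, h⟩ := hφ.dense e.1 hmeas (by rw [hlint]; exact ENNReal.ofReal_lt_top)
      (ENNReal.ofReal (ε ^ 2)) (by positivity)
    refine ⟨s, a, ?_⟩
    have h1 (p : M) : (e - ∑ j ∈ s, a j • Φ j).1 p = e.1 p - ∑ j ∈ s, a j • φ j p := by
      change e.1 p - (∑ j ∈ s, a j • Φ j : B.smoothSections).1 p = _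
      rw [Submodule.coe_sum, Finset.sum_apply]
      rfl
    simp only [← h1] at h
    rw [hlint, ENNReal.ofReal_lt_ofReal_iff (by positivity)] at h
    exact lt_of_pow_lt_pow_left₀ 2 hε.le h
  have hLre (k : ℕ) (e : B.smoothSections) :
      RCLike.re (inner 𝕜 (Φ k) (L e)) = ev k * RCLike.re (inner 𝕜 (Φ k) e) := by
    rw [hre, hre, ← integral_const_mul]
    refine (B.integral_inner_dirac_dirac hx (hφ.smooth k) e.2).symm.trans ?_
    refine integral_congr_ae (.of_forall fun p ↦ ?_)
    dsimp only
    rw [hφ.eigen k p, inner_smul_left, RCLike.conj_to_real]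
  -- Self-adjointness is available for the real inner product only; replacing `e` by `I • e`
  -- supplies the imaginary part.
  have hL (k : ℕ) (e : B.smoothSections) :
      inner 𝕜 (Φ k) (L e) = (ev k : 𝕜) * inner 𝕜 (Φ k) e := by
    apply RCLike.ext
    · rw [hLre, RCLike.re_ofReal_mul]
    · have h1 := hLre k ((RCLike.I : 𝕜) • e)
      rw [map_smul, inner_smul_right, inner_smul_right, RCLike.I_mul_re, RCLike.I_mul_re] at h1
      rw [RCLike.im_ofReal_mul]
      linarith
  have key := sum_sub_le_sum_norm_sq (n := m) (a := a) hortho hφ.monotone L hdense hL (ψ := Ψ) hψ hψ0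
    (fun i ↦ by
      rw [hre, ← ha i, hLp]) ha0 ha1 hsum
  refine key.trans_eq (Finset.sum_congr rfl fun i _ ↦ ?_)
  rw [hnorm, hLp]

end DiracBundle

end Sections

end DiracEigenvalues

namespace DiracEigenvalues

/-- A quadratic form given by an integral can be diagonalised in an orthonormal basis. -/
lemma exists_orthonormalBasis_integral_eq_zero {X : Type*} [MeasurableSpace X] {μ : Measure X}
    {N : ℕ} {w : X → ℝ} {y : X → EuclideanSpace ℝ (Fin N)}
    (hy : ∀ v, Integrable (fun p ↦ (inner ℝ v (y p) * w p) • y p) μ) :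
    ∃ b : OrthonormalBasis (Fin N) ℝ (EuclideanSpace ℝ (Fin N)), ∀ i j, i ≠ j →
      ∫ p, inner ℝ (b i) (y p) * inner ℝ (b j) (y p) * w p ∂μ = 0 := by
  -- The operator of second moments of `y` with weight `w`. It is symmetric, and the required basis
  -- consists of its eigenvectors.
  let T : EuclideanSpace ℝ (Fin N) →ₗ[ℝ] EuclideanSpace ℝ (Fin N) :=
    { toFun := fun v ↦ ∫ p, (inner ℝ v (y p) * w p) • y p ∂μ
      map_add' := fun v v' ↦ by
        rw [← integral_add (hy v) (hy v')]
        simp only [inner_add_left, add_mul, add_smul]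
      map_smul' := fun a v ↦ by
        rw [RingHom.id_apply, ← integral_smul]
        simp only [inner_smul_left, RCLike.conj_to_real, mul_assoc, mul_smul] }
  have hT (v v' : EuclideanSpace ℝ (Fin N)) :
      inner ℝ v (T v') = ∫ p, inner ℝ v (y p) * inner ℝ v' (y p) * w p ∂μ := by
    change inner ℝ v (∫ p, (inner ℝ v' (y p) * w p) • y p ∂μ) = _
    rw [← integral_inner (hy v')]
    refine integral_congr_ae (.of_forall fun p ↦ ?_)
    simp only [inner_smul_right]
    ring
  have hsymm : T.IsSymmetric := fun v v' ↦ by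
    rw [real_inner_comm, hT, hT]
    refine integral_congr_ae (.of_forall fun p ↦ ?_)
    dsimp only
    ring
  have hn : Module.finrank ℝ (EuclideanSpace ℝ (Fin N)) = N := finrank_euclideanSpace_fin
  refine ⟨hsymm.eigenvectorBasis hn, fun i j hij ↦ ?_⟩
  rw [← hT, hsymm.apply_eigenvectorBasis, inner_smul_right,
    (hsymm.eigenvectorBasis hn).inner_eq_zero hij, mul_zero]

end DiracEigenvalues

end

/-! ### The eigenvalue inequality. -/

open DiracEigenvalues

theorem theorem4p1 {𝕜 : Type*} [RCLike 𝕜] {n N : ℕ}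
    {M : Type*} [TopologicalSpace M] [T2Space M] [CompactSpace M]
    [ChartedSpace (EuclideanSpace ℝ (Fin n)) M] [IsManifold (𝓡 n) ∞ M]
    [RiemannianBundle (fun x : M ↦ TangentSpace (𝓡 n) x)]
    [IsContMDiffRiemannianBundle (𝓡 n) ∞ (EuclideanSpace ℝ (Fin n))
      (fun x : M ↦ TangentSpace (𝓡 n) x)]
    [MeasurableSpace M] [BorelSpace M]
    (x : M → EuclideanSpace ℝ (Fin N))
    (hx : DiracEigenvalues.IsIsometricEmbedding (n := n) x)
    {F : Type*} [NormedAddCommGroup F] [NormedSpace ℝ F] [FiniteDimensional ℝ F]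
    {S : M → Type*} [TopologicalSpace (TotalSpace F S)] [∀ p, NormedAddCommGroup (S p)]
    [∀ p, InnerProductSpace ℝ (S p)] [FiberBundle F S] [VectorBundle ℝ F S]
    [ContMDiffVectorBundle ∞ F S (𝓡 n)] [IsContMDiffRiemannianBundle (𝓡 n) ∞ F S]
    [∀ p, InnerProductSpace 𝕜 (S p)] [∀ p, IsScalarTower ℝ 𝕜 (S p)]
    (B : DiracEigenvalues.DiracBundle (n := n) 𝕜 M F S)
    (ev : ℕ → ℝ) (φ : ℕ → ∀ p, S p) (hφ : B.IsSpectralResolution ev φ)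
    (R : ℝ)
    (hR : ∀ i, R ≤ RCLike.re (∫ p, inner 𝕜 (B.curvatureMorphism (φ i) p) (φ i p)
      ∂(DiracEigenvalues.riemannianVolume (n := n) M)))
    (η : ℕ → ℝ)
    (hη : ∀ i, η i = ev i
      + 1 / 4 * (n : ℝ) ^ 2 * (⨆ p, DiracEigenvalues.meanCurvature (n := n) x p ^ 2) - R) :
    ∑ i ∈ Finset.range n, (η (i + 1) - η 0) ≤ 4 * η 0 := by
  set μ := riemannianVolume (n := n) M with hμ
  set σ := φ 0 with hσ0
  have hσ : IsSmooth n F σ := hφ.smooth 0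
  have hw : Continuous fun p ↦ ‖σ p‖ ^ 2 := by
    simp only [← real_inner_self_eq_norm_sq]
    exact (hσ.inner hσ).continuous
  have hself (p : M) : inner 𝕜 (σ p) (σ p) = ((‖σ p‖ ^ 2 : ℝ) : 𝕜) := by
    rw [inner_self_eq_norm_sq_to_K, RCLike.ofReal_pow]
  have hone : ∫ p, ‖σ p‖ ^ 2 ∂μ = 1 := by
    have h := hφ.orthonormal 0 0
    simp only [if_true] at h
    have h1 : ∫ p, inner 𝕜 (φ 0 p) (φ 0 p) ∂μ = ((∫ p, ‖σ p‖ ^ 2 ∂μ : ℝ) : 𝕜) := by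
      rw [← integral_ofReal]
      exact integral_congr_ae (.of_forall hself)
    rw [h1] at h
    exact_mod_cast h
  have hxc : Continuous x := hx.smooth.continuous
  have hinteg {Y : Type} [NormedAddCommGroup Y] [SecondCountableTopology Y] {g : M → Y}
      (hg : Continuous g) : Integrable g μ := integrable_of_continuous hx hg
  -- the centre of mass, and principal axes
  set c : EuclideanSpace ℝ (Fin N) := ∫ p, ‖σ p‖ ^ 2 • x p ∂μ with hc
  obtain ⟨b, hb⟩ := exists_orthonormalBasis_integral_eq_zero (μ := μ) (w := fun p ↦ ‖σ p‖ ^ 2)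
    (y := fun p ↦ x p - c) fun v ↦ hinteg (by fun_prop)
  set f : Fin N → M → ℝ := fun i p ↦ inner ℝ (b i) (x p - c) with hf
  have hfs (i) : ContMDiff (𝓡 n) 𝓘(ℝ, ℝ) ∞ (f i) := by
    simp only [hf, inner_sub_right]
    exact (contMDiff_inner_const hx (b i)).sub contMDiff_const
  have hfc (i) : Continuous (f i) := (hfs i).continuous
  have hfd (i) (p : M) (u : TangentSpace (𝓡 n) p) :
      mvfderiv (𝓡 n) (f i) p u = inner ℝ (gradField x (b i) p) u := by
    have h1 : f i = fun q ↦ inner ℝ (b i) (x q) - inner ℝ (b i) c := by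
      simp only [hf, inner_sub_right]
    rw [h1, mvfderiv_fun_sub (((contMDiff_inner_const hx (b i)) p).mdifferentiableAt (by simp))
      mdifferentiableAt_const, mvfderiv_const, sub_zero, mvfderiv_inner_const hx]
  set ψ : Fin N → ∀ p, S p := fun i p ↦ f i p • σ p with hψ
  have hψs (i) : IsSmooth n F (ψ i) := hσ.smul (hfs i)
  have hsmul (r : ℝ) (p : M) (s : S p) : r • s = (r : 𝕜) • s :=
    RCLike.real_smul_eq_coe_smul (K := 𝕜) r s
  have hψψ (i j) (hij : i ≠ j) : ∫ p, inner 𝕜 (ψ i p) (ψ j p) ∂μ = 0 := by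
    have h1 (p : M) : inner 𝕜 (ψ i p) (ψ j p) = ((f i p * f j p * ‖σ p‖ ^ 2 : ℝ) : 𝕜) := by
      simp only [hψ]
      rw [hsmul, hsmul, inner_smul_left, inner_smul_right, hself, RCLike.conj_ofReal]
      push_cast
      ring
    simp only [h1]
    rw [integral_ofReal, hb i j hij, RCLike.ofReal_zero]
  have hψ0 (i) : ∫ p, inner 𝕜 (φ 0 p) (ψ i p) ∂μ = 0 := by
    have h1 (p : M) : inner 𝕜 (φ 0 p) (ψ i p) = ((f i p * ‖σ p‖ ^ 2 : ℝ) : 𝕜) := by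
      simp only [hψ]
      rw [hsmul, inner_smul_right, hself]
      push_cast
      ring
    have h2 : ∫ p, f i p * ‖σ p‖ ^ 2 ∂μ = inner ℝ (b i) (∫ p, ‖σ p‖ ^ 2 • (x p - c) ∂μ) := by
      rw [← integral_inner (hinteg (by fun_prop))]
      refine integral_congr_ae (.of_forall fun p ↦ ?_)
      simp only [inner_smul_right, hf]
      ring
    -- This is the choice of `c` as centre of mass for the probability density `‖σ‖²`.
    have h3 : ∫ p, ‖σ p‖ ^ 2 • (x p - c) ∂μ = 0 := by
      simp only [smul_sub]
      rw [integral_sub (hinteg (by fun_prop)) (hinteg (by fun_prop)), integral_smul_const, hone,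
        one_smul, ← hc, sub_self]
    simp only [h1]
    rw [integral_ofReal, h2, h3, inner_zero_right, RCLike.ofReal_zero]
  set τ : Fin N → M → ℝ := fun i ↦ coordLaplacian B.leviCivita x (b i) with hτ
  have hτc (i) : Continuous (τ i) :=
    (contMDiff_coordLaplacian hx B.leviCivita_smooth (b i)).continuous
  have hcomm (i) (p : M) : B.dirac (B.dirac (ψ i)) p - ev 0 • ψ i p
      = -((2 : ℝ) • B.conn σ p (gradField x (b i) p)) - τ i p • σ p := by
    have h1 := B.dirac_dirac_smul hx (hfs i) (hfd i) hσ p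
    rw [hφ.eigen 0 p] at h1
    simp only [hψ]
    rw [h1, smul_comm (ev 0)]
    abel
  set a : Fin N → ℝ := fun i ↦ ∫ p, ‖gradField (n := n) x (b i) p‖ ^ 2 * ‖σ p‖ ^ 2 ∂μ with ha
  have hZc (i) : Continuous fun p ↦ ‖gradField (n := n) x (b i) p‖ ^ 2 := by
    simp only [← real_inner_self_eq_norm_sq]
    exact (IsSmooth.inner (contMDiff_gradField hx (b i)) (contMDiff_gradField hx (b i))).continuous
  have haa (i) : ∫ p, inner ℝ (B.dirac (B.dirac (ψ i)) p - ev 0 • ψ i p) (ψ i p) ∂μ = a i := by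
    simp only [hcomm]
    exact B.integral_inner_commutator hx (hfs i) (hfd i) hσ
  have ha0 (i) : 0 ≤ a i := integral_nonneg fun p ↦ by positivity
  have ha1 (i) : a i ≤ 1 := by
    rw [← hone]
    refine integral_mono (hinteg ((hZc i).mul hw)) (hinteg hw) fun p ↦ ?_
    have h1 : ‖gradField (n := n) x (b i) p‖ ≤ 1 :=
      (norm_gradField_le hx (b i) p).trans_eq (b.norm_eq_one i)
    exact mul_le_of_le_one_left (by positivity) (pow_le_one₀ (norm_nonneg _) h1)
  have hasum : ∑ i, a i = n := by
    simp only [ha]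
    rw [← integral_finsetSum _ fun i _ ↦ hinteg (by fun_prop)]
    simp only [← Finset.sum_mul, sum_norm_gradField_sq hx b]
    rw [integral_const_mul, hone, mul_one]
  have key := B.sum_ev_sub_le hx hφ hψs hψψ hψ0 haa ha0 ha1 hasum
  have hC (i) : Continuous fun p ↦ ‖B.conn σ p (gradField x (b i) p)‖ ^ 2 := by
    have h1 : IsSmooth n F fun p ↦ B.conn σ p (gradField x (b i) p) :=
      hσ.conn B.conn_smooth (contMDiff_gradField hx (b i))
    simp only [← real_inner_self_eq_norm_sq]
    exact (h1.inner h1).continuous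
  have hCs (i) : Continuous fun p ↦ inner ℝ (B.conn σ p (gradField x (b i) p)) (σ p) :=
    (IsSmooth.inner (hσ.conn B.conn_smooth (contMDiff_gradField hx (b i))) hσ).continuous
  have hnorm (i) (p : M) : ‖B.dirac (B.dirac (ψ i)) p - ev 0 • ψ i p‖ ^ 2
      = 4 * ‖B.conn σ p (gradField x (b i) p)‖ ^ 2
        + 4 * (inner ℝ (B.conn σ p (gradField x (b i) p)) (σ p) * τ i p)
        + τ i p ^ 2 * ‖σ p‖ ^ 2 := by
    rw [hcomm, ← real_inner_self_eq_norm_sq, ← real_inner_self_eq_norm_sq,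
      ← real_inner_self_eq_norm_sq]
    simp only [inner_sub_left, inner_sub_right, inner_neg_left, inner_neg_right, inner_smul_left,
      inner_smul_right, RCLike.conj_to_real, real_inner_comm (B.conn σ p _) (σ p)]
    ring
  have hsum : ∑ i, ∫ p, ‖B.dirac (B.dirac (ψ i)) p - ev 0 • ψ i p‖ ^ 2 ∂μ
      = 4 * ∫ p, ∑ i, ‖B.conn σ p (gradField x (b i) p)‖ ^ 2 ∂μ
        + ∫ p, (n : ℝ) ^ 2 * meanCurvature (n := n) x p ^ 2 * ‖σ p‖ ^ 2 ∂μ := by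
    rw [← integral_finsetSum]
    -- Summing over the whole orthonormal basis removes the cross term and turns the squared
    -- Laplacians into `n² H²`.
    · have h1 (p : M) : ∑ i, ‖B.dirac (B.dirac (ψ i)) p - ev 0 • ψ i p‖ ^ 2
          = 4 * ∑ i, ‖B.conn σ p (gradField x (b i) p)‖ ^ 2
            + (n : ℝ) ^ 2 * meanCurvature (n := n) x p ^ 2 * ‖σ p‖ ^ 2 := by
        simp only [hnorm, Finset.sum_add_distrib, ← Finset.mul_sum, ← Finset.sum_mul]
        rw [B.sum_coordLaplacian_mul_inner hx b σ p (σ p),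
          sum_coordLaplacian_sq hx b B.leviCivita_torsion B.leviCivita_metric]
        ring
      simp only [h1]
      rw [integral_add, integral_const_mul]
      · exact hinteg (by fun_prop)
      · simp only [← sum_coordLaplacian_sq hx b B.leviCivita_torsion B.leviCivita_metric]
        exact hinteg ((continuous_finsetSum _ fun i _ ↦ (hτc i).pow 2).mul hw)
    · intro i _
      simp only [hnorm]
      exact hinteg (by fun_prop)
  have hgrad := B.integral_sum_norm_conn_sq hx b hσ
  have hev : ∫ p, inner ℝ (B.dirac (B.dirac σ) p) (σ p) ∂μ = ev 0 := by
    have h1 (p : M) : inner ℝ (B.dirac (B.dirac σ) p) (σ p) = ev 0 * ‖σ p‖ ^ 2 := by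
      rw [hφ.eigen 0 p, inner_smul_left, real_inner_self_eq_norm_sq, RCLike.conj_to_real]
    simp only [h1]
    rw [integral_const_mul, hone, mul_one]
  have hcurv : R ≤ ∫ p, inner ℝ (B.curvatureMorphism σ p) (σ p) ∂μ := by
    refine (hR 0).trans_eq ?_
    rw [← integral_re (B.integrable_inner hx (B.isSmooth_curvatureMorphism hx hσ) hσ)]
    exact integral_congr_ae (.of_forall fun p ↦ (real_inner_eq_re _ _).symm)
  set s := ⨆ p, meanCurvature (n := n) x p ^ 2 with hs
  have hmean : ∫ p, (n : ℝ) ^ 2 * meanCurvature (n := n) x p ^ 2 * ‖σ p‖ ^ 2 ∂μ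
      ≤ (n : ℝ) ^ 2 * s := by
    have h1 (p : M) : (n : ℝ) ^ 2 * meanCurvature (n := n) x p ^ 2 ≤ (n : ℝ) ^ 2 * s := by
      -- Boundedness is known for `n² H²`; dividing by `n²` requires `n > 0`.
      rcases Nat.eq_zero_or_pos n with hn | hn
      · simp [hn]
      · have hbdd : BddAbove (Set.range fun p ↦ meanCurvature (n := n) x p ^ 2) := by
          obtain ⟨C, hC⟩ := bddAbove_meanCurvature_sq hx B.leviCivita_smooth B.leviCivita_torsion
            B.leviCivita_metric
          refine ⟨C / (n : ℝ) ^ 2, ?_⟩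
          rintro _ ⟨q, rfl⟩
          rw [le_div_iff₀' (by positivity)]
          exact hC ⟨q, rfl⟩
        gcongr
        exact le_ciSup hbdd p
    calc ∫ p, (n : ℝ) ^ 2 * meanCurvature (n := n) x p ^ 2 * ‖σ p‖ ^ 2 ∂μ
        ≤ ∫ p, (n : ℝ) ^ 2 * s * ‖σ p‖ ^ 2 ∂μ := by
          refine integral_mono ?_ (hinteg (by fun_prop)) fun p ↦
            mul_le_mul_of_nonneg_right (h1 p) (by positivity)
          simp only [← sum_coordLaplacian_sq hx b B.leviCivita_torsion B.leviCivita_metric]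
          exact hinteg ((continuous_finsetSum _ fun i _ ↦ (hτc i).pow 2).mul hw)
      _ = (n : ℝ) ^ 2 * s := by rw [integral_const_mul, hone, mul_one]
  rw [hsum, hgrad, hev] at key
  have hdiff : ∑ i ∈ Finset.range n, (η (i + 1) - η 0)
      = ∑ i ∈ Finset.range n, (ev (i + 1) - ev 0) :=
    Finset.sum_congr rfl fun i _ ↦ by
      rw [hη, hη]
      ring
  rw [hdiff, hη 0]
  -- The bound is `4 (ev 0 - ∫⟨ℜσ, σ⟩) + n² s ≤ 4 (ev 0 - R) + n² s = 4 η 0`; the 1/4 in `η`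
  -- balances the factor 4 of the gradient term.
  linarith
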